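/- Let $X\in\mathbb R^{n\times d_x}$, $Y\in\mathbb R^{n\times d_y}$, $d=d_x+d_y$, $\lambda_x,\lambda_y\ge 0$, and put $\Sigma_{xx}=X^TX+\lambda_xI$, $\Sigma_{yy}=Y^TY+\lambda_yI$, $\Sigma_{xy}=X^TY$, where $\Sigma_{xx},\Sigma_{yy}$ are assumed positive definite. Let $q=\min(d_x,d_y)$. The canonical correlations $\sigma_1\ge\dots\ge\sigma_q$ are the numbers for which some $U\in\mathbb R^{d_x\times q},V\in\mathbb R^{d_y\times q}$ maximize $\mathrm{Tr}(U^T\Sigma_{xy}V)$ subject to $U^T\Sigma_{xx}U=V^T\Sigma_{yy}V=I_q$ and $U^T\Sigma_{xy}V=\mathrm{diag}(\sigma_1,\dots,\sigma_q)$ with non-increasing diagonal; put $\sigma_i=0$ for $i>q$. Let $1\le p\le q$, assume $\sigma_1>\dots>\sigma_{p+1}\ge0$, let $\mu_1>\dots>\mu_p>0$ and $N=\mathrm{diag}(\mu_1,\dots,\mu_p)$. On $\mathbb S=\{(U,V): U^T\Sigma_{xx}U=I_p,\ V^T\Sigma_{yy}V=I_p\}\subset\mathbb R^{d_x\times p}\times\mathbb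 R^{d_y\times p}$ consider $f(U,V)=-\mathrm{Tr}(U^T\Sigma_{xy}VN)$, and set $$\kappa^\star=\frac{\max\{\mu_1(\sigma_1+\sigma_{p+1}),\ \tfrac12(\mu_1+\mu_2)(\sigma_1+\sigma_2)\}}{\min\{\mu_p(\sigma_p-\sigma_{p+1}),\ \min_{1\le j<p}\tfrac12(\mu_j-\mu_{j+1})(\sigma_j-\sigma_{j+1})\}}$$ (the terms with $\mu_2$ and with $1\le j<p$ being absent if $p=1$). For $\delta\in(0,1)$ let $s_\lambda=\max\{\mathrm{Tr}(\Sigma_{xx}^{-1}X^TX),\mathrm{Tr}(\Sigma_{yy}^{-1}Y^TY)\}$ and $s=\max(\lceil 40s_\lambda^2/\delta\rceil,d)$. Let $S\in\mathbb R^{s\times n}$ be a CountSketch matrix: its $j$-th column has the single nonzero entry $g(j)$ in row $h(j)$, where $h:\{1,\dots,n\}\to\{1,\dots,s\}$ and $g:\{1,\dots,n\}\to\{-1,1\}$ are uniformly random and independent. Put $M_x=(SX)^TSX+\lambda_xI$, $M_y=(SY)^TSY+\lambda_yI$. 1. With probability at least $1-\delta$: $M_x$ and $M_y$ are positive definite,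 and at every global minimizer of $f$ on $\mathbb S$ the Riemannian Hessian of $f$, with respect to the metric $\mathrm{Tr}(\xi_U^TM_x\eta_U)+\mathrm{Tr}(\xi_V^TM_y\eta_V)$, is nonsingular on the tangent space and has condition number (largest over smallest absolute value of its eigenvalues) at most $3\kappa^\star$. This holds whatever the condition numbers of $\Sigma_{xx}$ and $\Sigma_{yy}$ are. 2. Costs are numbers of arithmetic operations ($+,-,\times,/$, square root, comparison, rational constants) for given dimensions and sparsity patterns, where the spectral decomposition of a symmetric $k\times k$ matrix counts as $k^3$ operations. Let $n\ge d\ge p$ and $s\ge d$. (a) Given the nonzero entries of $X,Y$, computing $SX$ and $SY$ takes $O(\mathrm{nnz}(X)+\mathrm{nnz}(Y))=O(nd)$ operations. (b) Given $SX,SY,\lambda_x,\lambda_y$ with $M_x,M_y$ positive definite, computing the Cholesky factors of $M_x,M_y$ takes $O(sd^2+d^2)$ operations. (c) Let $L$ be fixed. Given the nonzero entries of $X,Y$, these Cholesky factors, $\lambda_x,\lambda_y$ and $N$, the current point $Z\in\mathbb S$ and tangent search direction $\eta$ in ambient coordinates, and line-search parameters, one iteration of Riemannian conjugate gradient (Armijo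 backtracking with at most $L$ trial steps, the zero step being taken if all are rejected; polar- or QR-based retraction; vector transport by orthogonal projection on the new tangent space; Fletcher–Reeves, Polak–Ribière or Hestenes–Stiefel parameter) that produces the next point and search direction takes $O\big(p(\mathrm{nnz}(X)+\mathrm{nnz}(Y))+dp^2+d^2p\big)$ operations, with a constant depending only on $L$. -/

import Mathlib

open Matrix

namespace SketchCCA

noncomputable section

/-! ## Canonical correlation analysis on a product of generalized Stiefel manifolds -/

/-- The data of a regularized CCA problem: data matrices `X`, `Y`, regularization parameters, and
the diagonal `μ₁, …, μ_p` of the weight matrix `N` (0-indexed). -/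
structure CCAProblem (n dx dy p : ℕ) where
  X : Matrix (Fin n) (Fin dx) ℝ
  Y : Matrix (Fin n) (Fin dy) ℝ
  lamX : ℝ
  lamY : ℝ
  mu : Fin p → ℝ

/-- The regularized Gram matrix `AᵀA + λ I`. -/
def regGram {m d : ℕ} (A : Matrix (Fin m) (Fin d) ℝ) (lam : ℝ) : Matrix (Fin d) (Fin d) ℝ :=
  Aᵀ * A + lam • (1 : Matrix (Fin d) (Fin d) ℝ)

/-- `s_λ(A) = Tr((AᵀA + λ I)⁻¹ AᵀA)`. -/
def statDim {m d : ℕ} (A : Matrix (Fin m) (Fin d) ℝ) (lam : ℝ) : ℝ :=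
  ((regGram A lam)⁻¹ * (Aᵀ * A)).trace

/-- Ambient space of pairs `Z = (U, V)`, i.e. `ℝ^{d × p}` with `d = dx + dy`, split into blocks. -/
abbrev Pt (dx dy p : ℕ) : Type := Matrix (Fin dx) (Fin p) ℝ × Matrix (Fin dy) (Fin p) ℝ

namespace CCAProblem

variable {n dx dy p : ℕ}

def Sxx (P : CCAProblem n dx dy p) : Matrix (Fin dx) (Fin dx) ℝ := regGram P.X P.lamX

def Syy (P : CCAProblem n dx dy p) : Matrix (Fin dy) (Fin dy) ℝ := regGram P.Y P.lamY

def Sxy (P : CCAProblem n dx dy p) : Matrix (Fin dx) (Fin dy) ℝ := P.Xᵀ * P.Y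

def N (P : CCAProblem n dx dy p) : Matrix (Fin p) (Fin p) ℝ := Matrix.diagonal P.mu

/-- `f(Z) = -½ Tr(Zᵀ [0, Σxy; Σxyᵀ, 0] Z N)`, written out for `Z = (U, V)`. -/
def cost (P : CCAProblem n dx dy p) (Z : Pt dx dy p) : ℝ :=
  -(1 / 2 : ℝ) * ((Z.1ᵀ * P.Sxy * Z.2 + Z.2ᵀ * P.Sxyᵀ * Z.1) * P.N).trace

end CCAProblem

/-- `U`, `V` have `q` columns normalized for `Σxx`, `Σyy`, and `Uᵀ Xᵀ Y V = diag(σ)` with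
non-increasing `σ`. -/
def CanonicalFeasible {n dx dy p q : ℕ} (P : CCAProblem n dx dy p)
    (U : Matrix (Fin dx) (Fin q) ℝ) (V : Matrix (Fin dy) (Fin q) ℝ) (σ : Fin q → ℝ) : Prop :=
  Uᵀ * P.Sxx * U = 1 ∧ Vᵀ * P.Syy * V = 1 ∧ Uᵀ * P.Sxy * V = Matrix.diagonal σ ∧ Antitone σ

/-- `σ` lists the `(λx, λy)`-canonical correlations: it is attained by a maximizer of
`Tr(Uᵀ Xᵀ Y V)` under the constraints `CanonicalFeasible`. -/
def IsCanonicalCorrelations {n dx dy p : ℕ} (P : CCAProblem n dx dy p)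
    (σ : Fin (min dx dy) → ℝ) : Prop :=
  ∃ (U : Matrix (Fin dx) (Fin (min dx dy)) ℝ) (V : Matrix (Fin dy) (Fin (min dx dy)) ℝ),
    CanonicalFeasible P U V σ ∧
    ∀ (U' : Matrix (Fin dx) (Fin (min dx dy)) ℝ) (V' : Matrix (Fin dy) (Fin (min dx dy)) ℝ)
      (σ' : Fin (min dx dy) → ℝ), CanonicalFeasible P U' V' σ' →
      (U'ᵀ * P.Sxy * V').trace ≤ (Uᵀ * P.Sxy * V).trace

/-- Extension of a finite family by zero. -/
def ext0 {m : ℕ} (v : Fin m → ℝ) (i : ℕ) : ℝ := if h : i < m then v ⟨i, h⟩ else 0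

/-- The numerator of `κ⋆`, 0-indexed. The term with `μ₂` is absent for `p = 1`. -/
def kappaNum (p : ℕ) (mu σ : ℕ → ℝ) : ℝ :=
  if 2 ≤ p then max (mu 0 * (σ 0 + σ p)) (1 / 2 * (mu 0 + mu 1) * (σ 0 + σ 1))
  else mu 0 * (σ 0 + σ p)

/-- The denominator of `κ⋆`, 0-indexed: the minimum of `μ_p (σ_p - σ_{p+1})` and of the numbers
`½ (μ_j - μ_{j+1}) (σ_j - σ_{j+1})` for `1 ≤ j < p`. -/
def kappaDen (p : ℕ) (mu σ : ℕ → ℝ) : ℝ :=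
  (Finset.range (p - 1)).fold min (mu (p - 1) * (σ (p - 1) - σ p))
    (fun j => 1 / 2 * (mu j - mu (j + 1)) * (σ j - σ (j + 1)))

def kappaStar (p : ℕ) (mu σ : ℕ → ℝ) : ℝ := kappaNum p mu σ / kappaDen p mu σ

/-! ## Riemannian geometry: constraint matrices `B₁, B₂`, metric matrices `M₁, M₂` -/

/-- The constraint matrices `B = (B₁, B₂)` and the metric matrix `M = blockdiag(M₁, M₂)`. -/
structure Geometry (dx dy : ℕ) where
  B1 : Matrix (Fin dx) (Fin dx) ℝ
  B2 : Matrix (Fin dy) (Fin dy) ℝ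
  M1 : Matrix (Fin dx) (Fin dx) ℝ
  M2 : Matrix (Fin dy) (Fin dy) ℝ

namespace Geometry

variable {dx dy p : ℕ}

/-- `St_{B₁}(p, dx) × St_{B₂}(p, dy)`. -/
def manifold (G : Geometry dx dy) (p : ℕ) : Set (Pt dx dy p) :=
  {Z | Z.1ᵀ * G.B1 * Z.1 = 1 ∧ Z.2ᵀ * G.B2 * Z.2 = 1}

/-- The tangent space at `Z`. The formula makes sense at every point of the ambient space. -/
def tangent (G : Geometry dx dy) (Z : Pt dx dy p) : Set (Pt dx dy p) :=
  {ξ | ξ.1ᵀ * G.B1 * Z.1 + Z.1ᵀ * G.B1 * ξ.1 = 0 ∧ ξ.2ᵀ * G.B2 * Z.2 + Z.2ᵀ * G.B2 * ξ.2 = 0}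

/-- The Riemannian metric `Tr(ξᵀ M η)`. -/
def inner (G : Geometry dx dy) (ξ η : Pt dx dy p) : ℝ :=
  (ξ.1ᵀ * G.M1 * η.1).trace + (ξ.2ᵀ * G.M2 * η.2).trace

/-- The projection on the tangent space at `Z`, orthogonal with respect to the metric
(for positive definite `M₁, M₂` there is exactly one such `η`). -/
def proj (G : Geometry dx dy) (Z ξ : Pt dx dy p) : Pt dx dy p :=
  Classical.epsilon fun η => η ∈ G.tangent Z ∧ ∀ ζ ∈ G.tangent Z, G.inner ζ (ξ - η) = 0

/-- The Euclidean gradient in the ambient space: the matrices of partial derivatives. -/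
def euclGrad (f : Pt dx dy p → ℝ) (Z : Pt dx dy p) : Pt dx dy p :=
  (Matrix.of fun i j => deriv (fun t : ℝ => f (Z.1 + t • Matrix.single i j 1, Z.2)) 0,
   Matrix.of fun i j => deriv (fun t : ℝ => f (Z.1, Z.2 + t • Matrix.single i j 1)) 0)

/-- The Riemannian gradient `Π_Z(M⁻¹ ∇f(Z))`. As a function of all `Z` of the ambient space it is a
vector field there, which is smooth near the manifold if `f` is smooth. -/
def grad (G : Geometry dx dy) (f : Pt dx dy p → ℝ) (Z : Pt dx dy p) : Pt dx dy p :=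
  G.proj Z (G.M1⁻¹ * (euclGrad f Z).1, G.M2⁻¹ * (euclGrad f Z).2)

/-- Entrywise directional derivative at `Z` along `ξ` of a vector field of the ambient space. -/
def dirDeriv (F : Pt dx dy p → Pt dx dy p) (Z ξ : Pt dx dy p) : Pt dx dy p :=
  (Matrix.of fun i j => deriv (fun t : ℝ => (F (Z + t • ξ)).1 i j) 0,
   Matrix.of fun i j => deriv (fun t : ℝ => (F (Z + t • ξ)).2 i j) 0)

/-- The Riemannian Hessian `Hess f(Z)[ξ] = ∇_ξ grad f`. The manifold is a Riemannian submanifold of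
the ambient space with the constant metric `M`, so the Levi-Civita connection is the projected
directional derivative of any smooth extension. -/
def hess (G : Geometry dx dy) (f : Pt dx dy p → ℝ) (Z ξ : Pt dx dy p) : Pt dx dy p :=
  G.proj Z (dirDeriv (G.grad f) Z ξ)

/-- The eigenvalues of `Hess f(Z)` as an operator on the tangent space at `Z`. -/
def hessEigenvalues (G : Geometry dx dy) (f : Pt dx dy p → ℝ) (Z : Pt dx dy p) : Set ℝ :=
  {c | ∃ ξ ∈ G.tangent Z, ξ ≠ 0 ∧ G.hess f Z ξ = c • ξ}

/-- The condition number of `Hess f(Z)`: the largest over the smallest eigenvalue in absolute value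
(to be used together with `0 ∉ G.hessEigenvalues f Z`). -/
def hessCond (G : Geometry dx dy) (f : Pt dx dy p → ℝ) (Z : Pt dx dy p) : ℝ :=
  sSup (abs '' G.hessEigenvalues f Z) / sInf (abs '' G.hessEigenvalues f Z)

end Geometry

/-! ## CountSketch and the sketched preconditioner -/

/-- The CountSketch matrix: column `j` has the single nonzero entry `g j` in row `h j`. -/
def countSketch {n s : ℕ} (h : Fin n → Fin s) (g : Fin n → ℤˣ) : Matrix (Fin s) (Fin n) ℝ :=
  Matrix.of fun i j => if h j = i then ((g j : ℤ) : ℝ) else 0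

/-- Probability of an event under the uniform distribution on a finite type. -/
def uniformProb {Ω : Type} [Fintype Ω] (E : Set Ω) : ℝ := (E.ncard : ℝ) / (Fintype.card Ω : ℝ)

/-- The geometry used by the algorithm: the constraints are given by `Σxx`, `Σyy`, the metric by
`(SX)ᵀ(SX) + λx I` and `(SY)ᵀ(SY) + λy I`. -/
def sketchedGeometry {n dx dy p s : ℕ} (P : CCAProblem n dx dy p) (h : Fin n → Fin s)
    (g : Fin n → ℤˣ) : Geometry dx dy where
  B1 := P.Sxx
  B2 := P.Syy
  M1 := regGram (countSketch h g * P.X) P.lamX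
  M2 := regGram (countSketch h g * P.Y) P.lamY

/-! ## Matrix factorizations and retractions -/

/-- `R` is upper triangular with positive diagonal. -/
def IsPosUpper {k : ℕ} (R : Matrix (Fin k) (Fin k) ℝ) : Prop :=
  (∀ i j, j < i → R i j = 0) ∧ ∀ i, 0 < R i i

/-- The Cholesky factor: upper triangular with positive diagonal and `RᵀR = A`
(unique and existing for positive definite `A`). -/
def cholesky {k : ℕ} (A : Matrix (Fin k) (Fin k) ℝ) : Matrix (Fin k) (Fin k) ℝ :=
  Classical.epsilon fun R => IsPosUpper R ∧ Rᵀ * R = A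

/-- The positive definite square root of a positive definite matrix. -/
def spdSqrt {k : ℕ} (A : Matrix (Fin k) (Fin k) ℝ) : Matrix (Fin k) (Fin k) ℝ :=
  Classical.epsilon fun Q => Q.PosDef ∧ Q * Q = A

/-- The Q factor of the thin QR factorization (positive diagonal of R) of a full-rank matrix. -/
def qf {d p : ℕ} (A : Matrix (Fin d) (Fin p) ℝ) : Matrix (Fin d) (Fin p) ℝ :=
  Classical.epsilon fun Q => Qᵀ * Q = 1 ∧ ∃ R, IsPosUpper R ∧ A = Q * R

inductive RetractionKind where
  | polar
  | qr

/-- The polar-based and QR-based retractions on `St_B(p, d)`. -/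
def retractSt {d p : ℕ} (k : RetractionKind) (B : Matrix (Fin d) (Fin d) ℝ)
    (X ξ : Matrix (Fin d) (Fin p) ℝ) : Matrix (Fin d) (Fin p) ℝ :=
  match k with
  | .polar => (X + ξ) * (spdSqrt (1 + ξᵀ * B * ξ))⁻¹
  | .qr => (spdSqrt B)⁻¹ * qf (spdSqrt B * (X + ξ))

def Geometry.retract {dx dy p : ℕ} (G : Geometry dx dy) (k : RetractionKind)
    (Z ξ : Pt dx dy p) : Pt dx dy p :=
  (retractSt k G.B1 Z.1 ξ.1, retractSt k G.B2 Z.2 ξ.2)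

/-! ## One iteration of Riemannian conjugate gradient -/

/-- Rules for the conjugation parameter. -/
inductive BetaRule where
  | fletcherReeves
  | polakRibiere
  | hestenesStiefel

/-- Armijo backtracking with at most `L` trial steps `t, τ t, τ² t, …`: the first trial step with
`φ t ≤ f₀ + c t · slope`, or `0` (rejected step) if there is none among the `L` trials. -/
def armijo (φ : ℝ → ℝ) (f0 slope c τ : ℝ) : ℕ → ℝ → ℝ
  | 0, _ => 0
  | L + 1, t => if φ t ≤ f0 + c * t * slope then t else armijo φ f0 slope c τ L (τ * t)

/-- The conjugation parameter; `gr`, `gr'` are the old and new gradients, and `trGr`, `trEta` are the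
transported old gradient and old direction. -/
def betaCoeff {dx dy p : ℕ} (G : Geometry dx dy) (rule : BetaRule)
    (gr gr' trGr trEta : Pt dx dy p) : ℝ :=
  match rule with
  | .fletcherReeves => G.inner gr' gr' / G.inner gr gr
  | .polakRibiere => G.inner gr' (gr' - trGr) / G.inner gr gr
  | .hestenesStiefel => G.inner gr' (gr' - trGr) / G.inner trEta (gr' - trGr)

/-- One iteration of Riemannian CG: from the iterate `Z` and the search direction `η` to the next
iterate and the next search direction. Vector transport is projection on the new tangent space. -/
def rcgStep {dx dy p : ℕ} (G : Geometry dx dy) (f : Pt dx dy p → ℝ) (k : RetractionKind)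
    (rule : BetaRule) (L : ℕ) (t0 τ c : ℝ) (Z η : Pt dx dy p) : Pt dx dy p × Pt dx dy p :=
  let gr := G.grad f Z
  let α := armijo (fun t => f (G.retract k Z (t • η))) (f Z) (G.inner gr η) c τ L t0
  let Z' := G.retract k Z (α • η)
  let gr' := G.grad f Z'
  let β := betaCoeff G rule gr gr' (G.proj Z' gr) (G.proj Z' η)
  (Z', -gr' + β • G.proj Z' η)

/-! ## Cost model: programs counting arithmetic operations

A program is a list of instructions on real registers. The registers `Sum.inl i` hold the input and
are read-only; the work registers `Sum.inr k` are initially zero. Each scalar operation costs `1`;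
the spectral decomposition of a symmetric `k × k` matrix is a primitive that costs `k ^ 3`, as is
the convention in numerical linear algebra (it is not a finite sequence of scalar operations).
A program does not depend on the numerical values of its input. -/

inductive Instr (ι : Type) where
  | const (dst : ℕ) (q : ℚ)
  | add (dst : ℕ) (a b : ι ⊕ ℕ)
  | sub (dst : ℕ) (a b : ι ⊕ ℕ)
  | mul (dst : ℕ) (a b : ι ⊕ ℕ)
  | div (dst : ℕ) (a b : ι ⊕ ℕ)
  | sqrt (dst : ℕ) (a : ι ⊕ ℕ)
  /-- `dst := if a ≤ b then u else v`. -/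
  | select (dst : ℕ) (a b u v : ι ⊕ ℕ)
  /-- Spectral decomposition of the `k × k` matrix in the registers `src i j`. Eigenvector entries
  go to the registers `base + (i * k + j)`, eigenvalues to `base + (k * k + i)`. -/
  | eig (k base : ℕ) (src : Fin k → Fin k → ι ⊕ ℕ)

/-- A solver for the symmetric eigenvalue problem. Programs must work with every such solver. -/
structure EigSolver where
  vec : ∀ k : ℕ, Matrix (Fin k) (Fin k) ℝ → Matrix (Fin k) (Fin k) ℝ
  val : ∀ k : ℕ, Matrix (Fin k) (Fin k) ℝ → Fin k → ℝ
  orthogonal : ∀ (k : ℕ) (A : Matrix (Fin k) (Fin k) ℝ), A.IsSymm → (vec k A)ᵀ * vec k A = 1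
  spectral : ∀ (k : ℕ) (A : Matrix (Fin k) (Fin k) ℝ), A.IsSymm →
    A = vec k A * Matrix.diagonal (val k A) * (vec k A)ᵀ

namespace Instr

variable {ι : Type}

def cost : Instr ι → ℕ
  | eig k _ _ => k ^ 3
  | _ => 1

/-- Write a real number to a work register. -/
def write (m : ι ⊕ ℕ → ℝ) (dst : ℕ) (x : ℝ) : ι ⊕ ℕ → ℝ
  | Sum.inl i => m (Sum.inl i)
  | Sum.inr r => if r = dst then x else m (Sum.inr r)

/-- Effect of an instruction on the registers. -/
def exec (E : EigSolver) (m : ι ⊕ ℕ → ℝ) : Instr ι → (ι ⊕ ℕ → ℝ)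
  | const dst q => write m dst (q : ℝ)
  | add dst a b => write m dst (m a + m b)
  | sub dst a b => write m dst (m a - m b)
  | mul dst a b => write m dst (m a * m b)
  | div dst a b => write m dst (m a / m b)
  | sqrt dst a => write m dst (Real.sqrt (m a))
  | select dst a b u v => write m dst (if m a ≤ m b then m u else m v)
  | eig k base src => fun r =>
      match r with
      | Sum.inl i => m (Sum.inl i)
      | Sum.inr r =>
          let A : Matrix (Fin k) (Fin k) ℝ := Matrix.of fun i j => m (src i j)
          if hv : ∃ ij : Fin k × Fin k, r = base + (ij.1 * k + ij.2) then
            E.vec k A hv.choose.1 hv.choose.2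
          else if hl : ∃ i : Fin k, r = base + (k * k + i) then E.val k A hl.choose
          else m (Sum.inr r)

end Instr

/-- Registers after running a program on the input `inp`. -/
def runProgram {ι : Type} (E : EigSolver) (prog : List (Instr ι)) (inp : ι → ℝ) : ι ⊕ ℕ → ℝ :=
  prog.foldl (Instr.exec E) (Sum.elim inp fun _ => 0)

def programCost {ι : Type} (prog : List (Instr ι)) : ℕ := (prog.map Instr.cost).sum

/-- Some program of cost at most `c` computes, for every instance `x : D`, the numbers `out x` from
the numbers `inp x`. -/
def ComputableWithin {D ι o : Type} (inp : D → ι → ℝ) (out : D → o → ℝ) (c : ℕ) : Prop :=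
  ∃ (prog : List (Instr ι)) (loc : o → ι ⊕ ℕ), programCost prog ≤ c ∧
    ∀ (E : EigSolver) (x : D) (j : o), runProgram E prog (inp x) (loc j) = out x j

/-! ## The computational tasks of the algorithm

Sparsity patterns `PX`, `PY` are sets of positions outside of which `X`, `Y` vanish; only the entries
in the patterns are input, and `PX.card`, `PY.card` are the numbers of nonzeros. -/

/-- `A` vanishes outside of the pattern. -/
def SupportedOn {m d : ℕ} (pat : Finset (Fin m × Fin d)) (A : Matrix (Fin m) (Fin d) ℝ) : Prop :=
  ∀ i j, (i, j) ∉ pat → A i j = 0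

/-- Instances of the sketching task: sparse matrices `X`, `Y`. -/
structure SketchInput {n dx dy : ℕ} (PX : Finset (Fin n × Fin dx)) (PY : Finset (Fin n × Fin dy)) where
  X : Matrix (Fin n) (Fin dx) ℝ
  Y : Matrix (Fin n) (Fin dy) ℝ
  suppX : SupportedOn PX X
  suppY : SupportedOn PY Y

/-- Input of the sketching task: the entries of `X`, `Y` in the patterns. -/
def SketchInput.read {n dx dy : ℕ} {PX : Finset (Fin n × Fin dx)} {PY : Finset (Fin n × Fin dy)}
    (I : SketchInput PX PY) : PX ⊕ PY → ℝ
  | Sum.inl e => I.X e.1.1 e.1.2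
  | Sum.inr e => I.Y e.1.1 e.1.2

/-- Output of the sketching task: all entries of `SX` and `SY`. -/
def SketchInput.result {n dx dy s : ℕ} {PX : Finset (Fin n × Fin dx)}
    {PY : Finset (Fin n × Fin dy)} (h : Fin n → Fin s) (g : Fin n → ℤˣ) (I : SketchInput PX PY) :
    (Fin s × Fin dx) ⊕ (Fin s × Fin dy) → ℝ
  | Sum.inl e => (countSketch h g * I.X) e.1 e.2
  | Sum.inr e => (countSketch h g * I.Y) e.1 e.2

/-- Instances of the factorization task: sketched matrices `XS`, `YS` and regularization parameters
such that `XSᵀXS + λx I` and `YSᵀYS + λy I` are positive definite. -/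
structure FactorInput (s dx dy : ℕ) where
  XS : Matrix (Fin s) (Fin dx) ℝ
  YS : Matrix (Fin s) (Fin dy) ℝ
  lamX : ℝ
  lamY : ℝ
  lamX_nonneg : 0 ≤ lamX
  lamY_nonneg : 0 ≤ lamY
  posX : (regGram XS lamX).PosDef
  posY : (regGram YS lamY).PosDef

inductive FactorVar (s dx dy : ℕ) : Type where
  | xs (i : Fin s) (j : Fin dx)
  | ys (i : Fin s) (j : Fin dy)
  | lamX
  | lamY

def FactorInput.read {s dx dy : ℕ} (I : FactorInput s dx dy) : FactorVar s dx dy → ℝ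
  | .xs i j => I.XS i j
  | .ys i j => I.YS i j
  | .lamX => I.lamX
  | .lamY => I.lamY

/-- Output of the factorization task: the Cholesky factors of the two metric matrices. -/
def FactorInput.result {s dx dy : ℕ} (I : FactorInput s dx dy) :
    (Fin dx × Fin dx) ⊕ (Fin dy × Fin dy) → ℝ
  | Sum.inl e => cholesky (regGram I.XS I.lamX) e.1 e.2
  | Sum.inr e => cholesky (regGram I.YS I.lamY) e.1 e.2

/-- Instances of one iteration: a CCA problem with sparse data, an iterate `Z`, a tangent search
direction `η`, and line-search parameters. -/
structure IterInput {n dx dy s : ℕ} (p : ℕ) (PX : Finset (Fin n × Fin dx))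
    (PY : Finset (Fin n × Fin dy)) (h : Fin n → Fin s) (g : Fin n → ℤˣ) where
  P : CCAProblem n dx dy p
  suppX : SupportedOn PX P.X
  suppY : SupportedOn PY P.Y
  lamX_nonneg : 0 ≤ P.lamX
  lamY_nonneg : 0 ≤ P.lamY
  mu_anti : StrictAnti P.mu
  mu_pos : ∀ i, 0 < P.mu i
  posX : P.Sxx.PosDef
  posY : P.Syy.PosDef
  posMX : (sketchedGeometry P h g).M1.PosDef
  posMY : (sketchedGeometry P h g).M2.PosDef
  Z : Pt dx dy p
  Z_mem : Z ∈ (sketchedGeometry P h g).manifold p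
  η : Pt dx dy p
  η_mem : η ∈ (sketchedGeometry P h g).tangent Z
  t0 : ℝ
  τ : ℝ
  c : ℝ

/-- Names of the input numbers of one iteration (in ambient coordinates): the entries of `X`, `Y` in
the patterns, the regularization parameters, the Cholesky factors from the preprocessing, the
weights, the current iterate and direction, and the line-search parameters. -/
inductive IterVar {n dx dy : ℕ} (p : ℕ) (PX : Finset (Fin n × Fin dx))
    (PY : Finset (Fin n × Fin dy)) : Type where
  | x (e : PX)
  | y (e : PY)
  | lamX
  | lamY
  | rx (i j : Fin dx)
  | ry (i j : Fin dy)
  | mu (j : Fin p)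
  | u (i : Fin dx) (j : Fin p)
  | v (i : Fin dy) (j : Fin p)
  | etaU (i : Fin dx) (j : Fin p)
  | etaV (i : Fin dy) (j : Fin p)
  | t0
  | τ
  | c

section Iteration

variable {n dx dy s p : ℕ} {PX : Finset (Fin n × Fin dx)} {PY : Finset (Fin n × Fin dy)}
  {h : Fin n → Fin s} {g : Fin n → ℤˣ}

def IterInput.read (I : IterInput p PX PY h g) : IterVar p PX PY → ℝ
  | .x e => I.P.X e.1.1 e.1.2
  | .y e => I.P.Y e.1.1 e.1.2
  | .lamX => I.P.lamX
  | .lamY => I.P.lamY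
  | .rx i j => cholesky (sketchedGeometry I.P h g).M1 i j
  | .ry i j => cholesky (sketchedGeometry I.P h g).M2 i j
  | .mu j => I.P.mu j
  | .u i j => I.Z.1 i j
  | .v i j => I.Z.2 i j
  | .etaU i j => I.η.1 i j
  | .etaV i j => I.η.2 i j
  | .t0 => I.t0
  | .τ => I.τ
  | .c => I.c

/-- The next iterate and the next search direction. -/
def IterInput.next (k : RetractionKind) (rule : BetaRule) (L : ℕ) (I : IterInput p PX PY h g) :
    Pt dx dy p × Pt dx dy p :=
  rcgStep (sketchedGeometry I.P h g) I.P.cost k rule L I.t0 I.τ I.c I.Z I.η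

/-- Output of one iteration: all entries of the next iterate and of the next search direction. -/
def IterInput.result (k : RetractionKind) (rule : BetaRule) (L : ℕ) (I : IterInput p PX PY h g) :
    (Bool × ((Fin dx × Fin p) ⊕ (Fin dy × Fin p))) → ℝ
  | (true, Sum.inl e) => (I.next k rule L).1.1 e.1 e.2
  | (true, Sum.inr e) => (I.next k rule L).1.2 e.1 e.2
  | (false, Sum.inl e) => (I.next k rule L).2.1 e.1 e.2
  | (false, Sum.inr e) => (I.next k rule L).2.2 e.1 e.2

end Iteration

end

end SketchCCA

/-! Conditioning. The maximality built into the canonical correlations upgrades the given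
diagonalization to a full singular value decomposition (`exists_full_svd_of_maximal`,
`exists_canonical_basis`): there are bases in which both Gram matrices are the identity and the
cross matrix is rectangular diagonal with entries `s k`. In these coordinates, minimizing the cost
is maximizing `∑ m j * s k * x k j * y k j` over matrices with orthonormal columns. As `x * y ≤ (x ^
2 + y ^ 2) / 2` and the averaged squares are doubly substochastic, this is dominated by an
assignment problem with strictly ordered weights. An explicit dual potential and complementary
slackness leave only the signed diagonal points (`assignment_unique`, `minimizer_eq`).

At a critical point the Hessian, paired with tangent vectors in the metric, is the second derivative
of the Lagrangian, so the metric drops out of the quadratic form (`inner_hess`). To see this, the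
gradient is differentiated as an ambient field whose normal part is `M⁻¹ * (B * Z) * S`, where `S`
solves a Lyapunov equation and so depends differentiably on the point; the derivative of `S`
contributes only a normal vector. In canonical coordinates the form splits into blocks indexed by
pairs, and these give the numerator and the denominator of `κ⋆` as bounds relative to the norm
defined by `Σxx`, `Σyy` (`hessian_form_bounds`). If the sketched metric is within relative error
`1/2` of that norm, every eigenvalue lies in `[2/3 * lo, 2 * hi]`, hence the factor `3`
(`hessCond_le`).

For the sketch, whiten the data: `X = A * R` with `Rᵀ * R = Σxx`. Then `Tr(Aᵀ * A)` is the
statistical dimension, and only `(S * A)ᵀ * (S * A) - Aᵀ * A` has to be small, whatever the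
conditioning of `Σxx`. Its entries are Rademacher chaoses over colliding pairs of rows; their second
moment gives mean squared Frobenius error at most `2 * t ^ 2 / s` (`sum_sketchError_le`), and
Markov's inequality with a union bound finishes.

Costs. `Derives inp S T c` says that any program knowing the quantities in `S` can be prolonged at
cost `c` to one that also knows those in `T`; it composes, so programs are never written down. An
iteration forms no `d × d` product: `Σxx` acts by two sparse products, `M⁻¹` by two triangular
solves, the projection needs one `p × p` Lyapunov equation per factor, and either retraction needs
one `p × p` spectral or Cholesky decomposition per factor. Each such operation fits into a constant
number of budgets `W` (`Block`), so the final bound is a bookkeeping of multiples of `W` depending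
only on `L` (`rcgStep_within`). -/

namespace SketchCCA

noncomputable section

/-! ## A calculus of computable quantities

Quantities are functions of the eigenvalue solver and of the instance. -/

/-- A program together with a bound on the registers that it uses. -/
structure ProgState (ι : Type) where
  prog : List (Instr ι)
  bound : ℕ

/-- Some register in use holds the quantity `f` after the program. -/
def Knows {D ι : Type} (inp : D → ι → ℝ) (st : ProgState ι) (f : EigSolver × D → ℝ) : Prop :=
  ∃ r : ι ⊕ ℕ, (∀ k, r = Sum.inr k → k < st.bound) ∧
    ∀ E x, runProgram E st.prog (inp x) r = f (E, x)

/-- `st'` costs at most `c` more than `st`, and knows everything that `st` knows. -/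
def Extends {D ι : Type} (inp : D → ι → ℝ) (st : ProgState ι) (c : ℕ) (st' : ProgState ι) : Prop :=
  programCost st'.prog ≤ programCost st.prog + c ∧ ∀ f, Knows inp st f → Knows inp st' f

theorem Extends.trans {D ι : Type} {inp : D → ι → ℝ} {s₁ s₂ s₃ : ProgState ι} {a b : ℕ}
    (h : Extends inp s₁ a s₂) (h' : Extends inp s₂ b s₃) : Extends inp s₁ (a + b) s₃ :=
  ⟨by have := h.1; have := h'.1; omega, fun f hf => h'.2 f (h.2 f hf)⟩

/-- From the quantities in `S`, those in `T` can be computed at cost `c`. -/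
def Derives {D ι : Type} (inp : D → ι → ℝ) (S T : Set (EigSolver × D → ℝ)) (c : ℕ) : Prop :=
  ∀ st, Knows inp st (fun _ => 0) → (∀ f ∈ S, Knows inp st f) →
    ∃ st', Extends inp st c st' ∧ ∀ f ∈ T, Knows inp st' f

namespace Derives

variable {D ι : Type} {inp : D → ι → ℝ} {S S' T T' U : Set (EigSolver × D → ℝ)} {a b c : ℕ}

theorem of_subset (h : T ⊆ S) : Derives inp S T 0 := fun st _ hS =>
  ⟨st, ⟨by simp, fun _ h => h⟩, fun f hf => hS f (h hf)⟩

theorem mono (h : Derives inp S T a) (hS : S ⊆ S') (hT : T' ⊆ T) (hab : a ≤ b) :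
    Derives inp S' T' b := fun st h0 hst => by
  obtain ⟨st', h1, h2⟩ := h st h0 fun f hf => hst f (hS hf)
  exact ⟨st', ⟨h1.1.trans (by omega), h1.2⟩, fun f hf => h2 f (hT hf)⟩

/-- The intermediate quantities `T` stay known afterwards, so shared subexpressions are paid for
only once. -/
theorem bind (h : Derives inp S T a) (h' : Derives inp (S ∪ T) U b) :
    Derives inp S (T ∪ U) (a + b) := fun st h0 hst => by
  obtain ⟨st', h1, h2⟩ := h st h0 hst
  obtain ⟨st'', h3, h4⟩ := h' st' (h1.2 _ h0) (by
    rintro f (hf | hf)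
    · exact h1.2 _ (hst f hf)
    · exact h2 f hf)
  refine ⟨st'', h1.trans h3, ?_⟩
  rintro f (hf | hf)
  · exact h3.2 _ (h2 f hf)
  · exact h4 f hf

theorem trans (h : Derives inp S T a) (h' : Derives inp (S ∪ T) U b) :
    Derives inp S U (a + b) :=
  (h.bind h').mono subset_rfl Set.subset_union_right le_rfl

theorem union (h : Derives inp S T a) (h' : Derives inp S U b) :
    Derives inp S (T ∪ U) (a + b) :=
  h.bind (h'.mono Set.subset_union_left subset_rfl le_rfl)

/-- Families indexed by a finite set. -/
theorem biUnion {α : Type*} (s : Finset α) {F : α → Set (EigSolver × D → ℝ)} {c : α → ℕ}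
    (h : ∀ i ∈ s, Derives inp S (F i) (c i)) :
    Derives inp S (⋃ i ∈ s, F i) (∑ i ∈ s, c i) := by
  classical
  induction s using Finset.induction_on with
  | empty => simpa using of_subset (Set.empty_subset _)
  | insert i s hi ih =>
    rw [Finset.set_biUnion_insert, Finset.sum_insert hi]
    exact (h i (by simp)).union (ih fun j hj => h j (by simp [hj]))

/-- Families computed one after the other. -/
theorem chain (m : ℕ) {F : ℕ → Set (EigSolver × D → ℝ)}
    (h : ∀ i < m, Derives inp (S ∪ ⋃ j ∈ Finset.range i, F j) (F i) c) :
    Derives inp S (⋃ j ∈ Finset.range m, F j) (m * c) := by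
  induction m with
  | zero => simpa using of_subset (Set.empty_subset _)
  | succ m ih =>
    rw [Finset.range_add_one, Finset.set_biUnion_insert, Set.union_comm, add_mul, one_mul]
    exact (ih fun i hi => h i (by omega)).bind (h m (by omega))

/-- A quantity obtained by one instruction that writes to the first free register. -/
theorem of_instr {f : EigSolver × D → ℝ} (hS : ∀ st, Knows inp st (fun _ => 0) →
      (∀ f ∈ S, Knows inp st f) → ∃ i : Instr ι, i.cost = 1 ∧
        ∀ E x, ∃ m, m = runProgram E st.prog (inp x) ∧
          Instr.exec E m i = Instr.write m st.bound (f (E, x))) :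
    Derives inp S {f} 1 := fun st h0 hst => by
  obtain ⟨i, hi, he⟩ := hS st h0 hst
  have he' : ∀ E x, runProgram E (st.prog ++ [i]) (inp x) =
      Instr.write (runProgram E st.prog (inp x)) st.bound (f (E, x)) := fun E x => by
    obtain ⟨m, rfl, h⟩ := he E x
    rw [← h]; simp [runProgram]
  refine ⟨⟨st.prog ++ [i], st.bound + 1⟩, ⟨by simp [programCost, hi], ?_⟩, ?_⟩
  · rintro g ⟨r, hr, hg⟩
    refine ⟨r, fun k hk => (hr k hk).trans (by simp), fun E x => ?_⟩
    rw [he', ← hg]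
    cases r with
    | inl r => rfl
    -- Registers in use lie strictly below the bound, so writing at the bound preserves all that is
    -- known.
    | inr k => exact if_neg (hr k rfl).ne
  · rintro g rfl
    refine ⟨Sum.inr st.bound, fun k hk => by simp_all, fun E x => ?_⟩
    rw [he']; simp [Instr.write]

end Derives

/-- One quantity. -/
abbrev Computes {D ι : Type} (inp : D → ι → ℝ) (S : Set (EigSolver × D → ℝ))
    (f : EigSolver × D → ℝ) (c : ℕ) : Prop := Derives inp S {f} c

namespace Computes

variable {D ι : Type} {inp : D → ι → ℝ} {S T : Set (EigSolver × D → ℝ)} {a b c d : ℕ}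
  {f g u v : EigSolver × D → ℝ}

theorem of_mem (h : f ∈ S) : Computes inp S f 0 := Derives.of_subset (by simpa using h)

/-- Free of charge, because `Derives` only starts from states in which some register holds zero. -/
theorem zero : Computes inp S (fun _ => 0) 0 := fun st h0 _ =>
  ⟨st, ⟨by simp, fun _ h => h⟩, fun f hf => by rw [Set.mem_singleton_iff.1 hf]; exact h0⟩

theorem le (h : Computes inp S f a) (hab : a ≤ b) : Computes inp S f b :=
  Derives.mono h subset_rfl subset_rfl hab

theorem congr (h : Computes inp S f a) (hfg : ∀ ω, f ω = g ω) : Computes inp S g a := by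
  rwa [← funext hfg]

theorem after (h : Derives inp S T a) (h' : Computes inp (S ∪ T) f b) :
    Computes inp S f (a + b) := Derives.trans h h'

theorem const (q : ℚ) : Computes inp S (fun _ => (q : ℝ)) 1 :=
  Derives.of_instr fun st _ _ => ⟨.const st.bound q, rfl, fun _ _ => ⟨_, rfl, rfl⟩⟩

theorem binary {op : ℝ → ℝ → ℝ} {ins : ℕ → ι ⊕ ℕ → ι ⊕ ℕ → Instr ι}
    (hc : ∀ d r s, (ins d r s).cost = 1)
    (he : ∀ E m d r s, Instr.exec E m (ins d r s) = Instr.write m d (op (m r) (m s)))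
    (hf : Computes inp S f a) (hg : Computes inp S g b) :
    Computes inp S (fun ω => op (f ω) (g ω)) (a + b + 1) := by
  refine Derives.trans (T := {f} ∪ {g}) (hf.union hg) (Derives.of_instr fun st _ hst => ?_)
  obtain ⟨r, -, hr⟩ := hst f (by simp)
  obtain ⟨s, -, hs⟩ := hst g (by simp)
  exact ⟨ins st.bound r s, hc _ _ _, fun E x => ⟨_, rfl, by rw [he, hr, hs]⟩⟩

theorem add (hf : Computes inp S f a) (hg : Computes inp S g b) :
    Computes inp S (fun ω => f ω + g ω) (a + b + 1) :=
  binary (ins := Instr.add) (fun _ _ _ => rfl) (fun _ _ _ _ _ => rfl) hf hg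

theorem sub (hf : Computes inp S f a) (hg : Computes inp S g b) :
    Computes inp S (fun ω => f ω - g ω) (a + b + 1) :=
  binary (ins := Instr.sub) (fun _ _ _ => rfl) (fun _ _ _ _ _ => rfl) hf hg

theorem mul (hf : Computes inp S f a) (hg : Computes inp S g b) :
    Computes inp S (fun ω => f ω * g ω) (a + b + 1) :=
  binary (ins := Instr.mul) (fun _ _ _ => rfl) (fun _ _ _ _ _ => rfl) hf hg

theorem div (hf : Computes inp S f a) (hg : Computes inp S g b) :
    Computes inp S (fun ω => f ω / g ω) (a + b + 1) :=
  binary (ins := Instr.div) (fun _ _ _ => rfl) (fun _ _ _ _ _ => rfl) hf hg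

theorem sqrt (hf : Computes inp S f a) : Computes inp S (fun ω => √(f ω)) (a + 1) := by
  refine Derives.trans (T := {f}) hf (Derives.of_instr fun st _ hst => ?_)
  obtain ⟨r, -, hr⟩ := hst f (by simp)
  exact ⟨.sqrt st.bound r, rfl, fun E x => ⟨_, rfl, by rw [Instr.exec, hr]⟩⟩

/-- Both alternatives are computed and paid for: programs are straight-line and can only choose
between finished values. -/
theorem select (hf : Computes inp S f a) (hg : Computes inp S g b) (hu : Computes inp S u c)
    (hv : Computes inp S v d) :
    Computes inp S (fun ω => if f ω ≤ g ω then u ω else v ω) (a + b + (c + d) + 1) := by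
  refine Derives.trans (T := ({f} ∪ {g}) ∪ ({u} ∪ {v})) ((hf.union hg).union (hu.union hv))
    (Derives.of_instr fun st _ hst => ?_)
  obtain ⟨r, -, hr⟩ := hst f (by simp)
  obtain ⟨s, -, hs⟩ := hst g (by simp)
  obtain ⟨t, -, ht⟩ := hst u (by simp)
  obtain ⟨w, -, hw⟩ := hst v (by simp)
  exact ⟨.select st.bound r s t w, rfl, fun E x => ⟨_, rfl, by rw [Instr.exec, hr, hs, ht, hw]⟩⟩

theorem sum {α : Type*} (s : Finset α) {F : α → EigSolver × D → ℝ} {c : α → ℕ}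
    (h : ∀ i ∈ s, Computes inp S (F i) (c i)) :
    Computes inp S (fun ω => ∑ i ∈ s, F i ω) (∑ i ∈ s, (c i + 1)) := by
  classical
  induction s using Finset.induction_on with
  | empty => simpa using zero
  | insert i s hi ih =>
    simp only [Finset.sum_insert hi]
    exact ((h i (by simp)).add (ih fun j hj => h j (by simp [hj]))).le (by omega)

theorem sum_const {α : Type*} (s : Finset α) {F : α → EigSolver × D → ℝ}
    (h : ∀ i ∈ s, Computes inp S (F i) c) :
    Computes inp S (fun ω => ∑ i ∈ s, F i ω) (s.card * (c + 1)) :=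
  (sum s h).le (by simp)

end Computes

/-- The entries of a matrix of quantities. -/
def entries {Ω : Type} {m n : Type*} (A : Ω → Matrix m n ℝ) : Set (Ω → ℝ) :=
  Set.range fun ij : m × n => fun ω => A ω ij.1 ij.2

theorem mem_entries {Ω : Type} {m n : Type*} (A : Ω → Matrix m n ℝ) (i : m) (j : n) :
    (fun ω => A ω i j) ∈ entries A := ⟨(i, j), rfl⟩

theorem ComputableWithin.of_derives {D ι o : Type} {inp : D → ι → ℝ} {out : D → o → ℝ} {c : ℕ}
    (hd : Derives inp (Set.range fun i : ι => fun ω => inp ω.2 i)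
      (Set.range fun j : o => fun ω => out ω.2 j) c) :
    ComputableWithin inp out c := by
  -- The empty program starts with bound `1`, not `0`: work register `0` is initially zero and is
  -- reserved as the permanent zero.
  obtain ⟨st, h1, h2⟩ := hd ⟨[], 1⟩ ⟨Sum.inr 0, by simp, fun E x => rfl⟩ (by
    rintro _ ⟨i, rfl⟩
    exact ⟨Sum.inl i, by simp, fun E x => rfl⟩)
  choose loc hloc using fun j => h2 _ ⟨j, rfl⟩
  exact ⟨st.prog, loc, by simpa [programCost] using h1.1, fun E x j => (hloc j).2 E x⟩

/-! ### Costs of dense and sparse matrix operations. -/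

section MatrixCalculus

variable {D ι : Type} {inp : D → ι → ℝ} {S T : Set (EigSolver × D → ℝ)} {a b c : ℕ}
  {k m n : Type*}

/-- Transposing and reindexing cost nothing, since they only rename the registers that hold the
entries. -/
theorem Derives.entries_transpose {A : EigSolver × D → Matrix m n ℝ}
    (h : Derives inp S (entries A) a) : Derives inp S (entries fun ω => (A ω)ᵀ) a :=
  h.mono subset_rfl (by rintro _ ⟨⟨i, j⟩, rfl⟩; exact ⟨(j, i), rfl⟩) le_rfl

theorem Derives.entries_reindex {α β : Type*} {A : EigSolver × D → Matrix m n ℝ} (f : α → m)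
    (g : β → n) (h : Derives inp S (entries A) a) :
    Derives inp S (entries fun ω => (A ω).submatrix f g) a :=
  h.mono subset_rfl (by rintro _ ⟨⟨i, j⟩, rfl⟩; exact ⟨(f i, g j), rfl⟩) le_rfl

theorem Derives.entries_congr {A B : EigSolver × D → Matrix m n ℝ}
    (h : Derives inp S (entries A) a) (hAB : ∀ ω, A ω = B ω) : Derives inp S (entries B) a := by
  rwa [← funext hAB]

/-- The entries of a matrix of quantities in the positions of a pattern. -/
def entriesOn {Ω : Type} (pat : Finset (m × n)) (A : Ω → Matrix m n ℝ) : Set (Ω → ℝ) :=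
  {f | ∃ ij ∈ pat, f = fun ω => A ω ij.1 ij.2}

theorem entriesOn_swap {Ω : Type} (pat : Finset (m × n)) (A : Ω → Matrix m n ℝ) :
    entriesOn (pat.map (Equiv.prodComm m n).toEmbedding) (fun ω => (A ω)ᵀ) ⊆ entriesOn pat A := by
  rintro _ ⟨⟨i, j⟩, h, rfl⟩
  exact ⟨(j, i), by simpa using h, rfl⟩

variable [Fintype k] [Fintype m] [Fintype n]

theorem Derives.entries_of {A : EigSolver × D → Matrix m n ℝ} {c : m → n → ℕ}
    (h : ∀ i j, Computes inp S (fun ω => A ω i j) (c i j)) :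
    Derives inp S (entries A) (∑ i, ∑ j, c i j) := by
  refine (Derives.biUnion Finset.univ fun i _ => Derives.biUnion Finset.univ
    fun j _ => h i j).mono subset_rfl ?_ le_rfl
  rintro _ ⟨⟨i, j⟩, rfl⟩
  simp only [Set.mem_iUnion]
  exact ⟨i, Finset.mem_univ _, j, Finset.mem_univ _, rfl⟩

theorem Derives.entries_of_const {A : EigSolver × D → Matrix m n ℝ}
    (h : ∀ i j, Computes inp S (fun ω => A ω i j) c) :
    Derives inp S (entries A) (Fintype.card m * Fintype.card n * c) :=
  (Derives.entries_of h).mono subset_rfl subset_rfl (by simp [mul_assoc])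

theorem Derives.entries_mul {A : EigSolver × D → Matrix m k ℝ} {B : EigSolver × D → Matrix k n ℝ}
    (hA : Derives inp S (entries A) a) (hB : Derives inp S (entries B) b) :
    Derives inp S (entries fun ω => A ω * B ω)
      (a + b + Fintype.card m * Fintype.card n * (Fintype.card k * 2)) := by
  refine Derives.trans (hA.union hB) (Derives.entries_of_const fun i j => ?_)
  simp only [Matrix.mul_apply]
  exact Computes.sum_const Finset.univ (c := 1) fun r _ =>
    (Computes.of_mem (by simp [mem_entries])).mul (Computes.of_mem (by simp [mem_entries]))

theorem Derives.entries_add {A B : EigSolver × D → Matrix m n ℝ}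
    (hA : Derives inp S (entries A) a) (hB : Derives inp S (entries B) b) :
    Derives inp S (entries fun ω => A ω + B ω) (a + b + Fintype.card m * Fintype.card n * 1) :=
  Derives.trans (hA.union hB) (Derives.entries_of_const fun i j =>
    (Computes.of_mem (by simp [mem_entries])).add (Computes.of_mem (by simp [mem_entries])))

theorem Derives.entries_sub {A B : EigSolver × D → Matrix m n ℝ}
    (hA : Derives inp S (entries A) a) (hB : Derives inp S (entries B) b) :
    Derives inp S (entries fun ω => A ω - B ω) (a + b + Fintype.card m * Fintype.card n * 1) :=
  Derives.trans (hA.union hB) (Derives.entries_of_const fun i j =>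
    (Computes.of_mem (by simp [mem_entries])).sub (Computes.of_mem (by simp [mem_entries])))

theorem Derives.entries_smul {f : EigSolver × D → ℝ} {A : EigSolver × D → Matrix m n ℝ}
    (hf : Computes inp S f a) (hA : Derives inp S (entries A) b) :
    Derives inp S (entries fun ω => f ω • A ω) (a + b + Fintype.card m * Fintype.card n * 1) :=
  Derives.trans (Derives.union hf hA) (Derives.entries_of_const fun i j =>
    (Computes.of_mem (by simp)).mul (Computes.of_mem (by simp [mem_entries])))

theorem Computes.trace_transpose_mul {A B : EigSolver × D → Matrix m n ℝ}
    (hA : Derives inp S (entries A) a) (hB : Derives inp S (entries B) b) :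
    Computes inp S (fun ω => ((A ω)ᵀ * B ω).trace)
      (a + b + Fintype.card m * Fintype.card n * 2) := by
  refine Computes.after (hA.union hB) (((Computes.sum_const (Finset.univ : Finset (m × n)) (c := 1)
    (F := fun ij ω => A ω ij.1 ij.2 * B ω ij.1 ij.2) fun r _ =>
    (Computes.of_mem (by simp [mem_entries])).mul
      (Computes.of_mem (by simp [mem_entries]))).congr fun ω => ?_).le (by simp))
  rw [Fintype.sum_prod_type_right]
  simp [Matrix.trace, Matrix.mul_apply]

/-- Entry `(i, j)` only needs the indices `r` with `(i, r)` in the pattern. Summing over `i`, these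
fibres partition the pattern, so each column of `B` costs two operations per position in the
pattern. -/
theorem Derives.sparse_mul {A : EigSolver × D → Matrix m k ℝ} {B : EigSolver × D → Matrix k n ℝ}
    (pat : Finset (m × k)) (hpat : ∀ ω i j, (i, j) ∉ pat → A ω i j = 0)
    (hA : Derives inp S (entriesOn pat A) a) (hB : Derives inp S (entries B) b) :
    Derives inp S (entries fun ω => A ω * B ω) (a + b + Fintype.card n * pat.card * 2) := by
  classical
  have hcard : ∑ i, (Finset.univ.filter fun r => (i, r) ∈ pat).card = pat.card := by
    rw [Finset.card_eq_sum_card_fiberwise (f := Prod.fst) (t := Finset.univ) (by simp)]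
    refine Finset.sum_congr rfl fun i _ => Finset.card_bij (fun r _ => (i, r)) ?_ ?_ ?_
    · simp
    · simp
    · rintro ⟨i', r⟩ h
      simp only [Finset.mem_filter] at h
      obtain ⟨h1, rfl⟩ := h
      exact ⟨r, by simpa using h1, rfl⟩
  have key : Derives inp (S ∪ (entriesOn pat A ∪ entries B)) (entries fun ω => A ω * B ω)
      (∑ i, ∑ _j : n, (Finset.univ.filter fun r => (i, r) ∈ pat).card * 2) := by
    refine Derives.entries_of fun i j => ?_
    refine (Computes.sum_const (Finset.univ.filter fun r => (i, r) ∈ pat) (c := 1)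
      (F := fun r ω => A ω i r * B ω r j) fun r hr => ?_).congr fun ω => ?_
    · refine (Computes.of_mem (Or.inr (Or.inl ⟨(i, r), ?_, rfl⟩))).mul
        (Computes.of_mem (by simp [mem_entries]))
      simpa using hr
    · rw [Matrix.mul_apply, Finset.sum_filter]
      refine Finset.sum_congr rfl fun r _ => ?_
      split_ifs with h
      · rfl
      · rw [hpat ω i r h, zero_mul]
  refine Derives.trans (hA.union hB) (key.mono subset_rfl subset_rfl ?_)
  simp only [Finset.sum_const, Finset.card_univ, smul_eq_mul, ← Finset.mul_sum, ← Finset.sum_mul,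
    hcard, mul_assoc]
  exact le_rfl

end MatrixCalculus

/-! ## Factorizations and triangular systems -/

section Triangular

variable {D ι : Type} {inp : D → ι → ℝ} {S : Set (EigSolver × D → ℝ)} {a b : ℕ} {k : ℕ}

/-- Row `i` of a matrix of quantities. -/
def rowEntries {Ω n : Type} {k : ℕ} (A : Ω → Matrix (Fin k) n ℝ) (i : ℕ) : Set (Ω → ℝ) :=
  {f | ∃ (hi : i < k) (j : n), f = fun ω => A ω ⟨i, hi⟩ j}

/-- The recursion scheme common to forward substitution and the Cholesky factorization, both of
which express a row through the rows before it. -/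
theorem Derives.of_rows {n : Type} {A : EigSolver × D → Matrix (Fin k) n ℝ} {c : ℕ}
    (h : ∀ i (hi : i < k), Derives inp (S ∪ {f | ∃ r < (⟨i, hi⟩ : Fin k), ∃ j, f = fun ω => A ω r j})
      {f | ∃ j, f = fun ω => A ω ⟨i, hi⟩ j} c) :
    Derives inp S (entries A) (k * c) := by
  refine (Derives.chain k (F := rowEntries A) (c := c) fun i hi => ?_).mono subset_rfl ?_ le_rfl
  · refine (h i hi).mono (Set.union_subset_union_right _ ?_) ?_ le_rfl
    · rintro _ ⟨r, hr, j, rfl⟩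
      simp only [Set.mem_iUnion]
      exact ⟨r, Finset.mem_range.2 hr, r.2, j, rfl⟩
    · rintro _ ⟨_, j, rfl⟩
      exact ⟨j, rfl⟩
  · rintro _ ⟨⟨i, j⟩, rfl⟩
    simp only [Set.mem_iUnion]
    exact ⟨i, by simp, i.2, j, rfl⟩

theorem Derives.row {n : Type} [Fintype n] {f : n → EigSolver × D → ℝ} {c : ℕ}
    (h : ∀ j, Computes inp S (f j) c) :
    Derives inp S {g | ∃ j, g = f j} (Fintype.card n * c) := by
  refine (Derives.biUnion Finset.univ fun j _ => h j).mono subset_rfl ?_ (by simp)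
  rintro _ ⟨j, rfl⟩
  simp only [Set.mem_iUnion]
  exact ⟨j, Finset.mem_univ _, rfl⟩

/-- Splitting off the diagonal term lets row `i` of `W` be solved for from the earlier rows, by
division by the pivot. -/
theorem IsPosUpper.transpose_mul_apply {n : Type*} {R : Matrix (Fin k) (Fin k) ℝ}
    (hR : IsPosUpper R) (W : Matrix (Fin k) n ℝ) (i : Fin k) (j : n) :
    (Rᵀ * W) i j = ∑ r ∈ Finset.Iio i, R r i * W r j + R i i * W i j := by
  rw [Matrix.mul_apply, ← Finset.sum_subset (Finset.subset_univ (Finset.Iic i))]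
  · rw [← Finset.Iio_insert, Finset.sum_insert (by simp), add_comm]
    rfl
  · intro r _ hr
    rw [Matrix.transpose_apply, hR.1 r i (by simpa using hr), zero_mul]

/-- Forward substitution. -/
theorem Derives.forward_solve {n : Type} [Fintype n] {R : EigSolver × D → Matrix (Fin k) (Fin k) ℝ}
    {W B : EigSolver × D → Matrix (Fin k) n ℝ} (hR : ∀ ω, IsPosUpper (R ω))
    (hB : ∀ ω, (R ω)ᵀ * W ω = B ω) (hRS : Derives inp S (entries R) a)
    (hBS : Derives inp S (entries B) b) :
    Derives inp S (entries W) (a + b + k * (Fintype.card n * (k * 2 + 2))) := by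
  refine Derives.trans (hRS.union hBS) (Derives.of_rows fun i hi => Derives.row fun j => ?_)
  have h1 : ∀ ω, (B ω ⟨i, hi⟩ j - ∑ r ∈ Finset.Iio (⟨i, hi⟩ : Fin k), R ω r ⟨i, hi⟩ * W ω r j) /
      R ω ⟨i, hi⟩ ⟨i, hi⟩ = W ω ⟨i, hi⟩ j := fun ω => by
    rw [← hB, (hR ω).transpose_mul_apply, add_sub_cancel_left,
      mul_div_cancel_left₀ _ ((hR ω).2 _).ne']
  refine ((((Computes.of_mem ?_).sub (Computes.sum_const _ (c := 1) fun r hr =>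
    (Computes.of_mem ?_).mul (Computes.of_mem ?_))).div (Computes.of_mem ?_)).congr h1).le ?_
  · simp [mem_entries]
  · simp [mem_entries]
  · exact Or.inr ⟨r, by simpa using hr, j, rfl⟩
  · simp [mem_entries]
  · simp; omega

/-- Reversing the order of the indices turns upper into lower triangular, and transposition turns it
back; this reduces backward to forward substitution. -/
theorem IsPosUpper.rev {R : Matrix (Fin k) (Fin k) ℝ} (hR : IsPosUpper R) :
    IsPosUpper (R.submatrix Fin.rev Fin.rev)ᵀ :=
  ⟨fun i j h => hR.1 _ _ (by simpa using h), fun i => hR.2 _⟩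

/-- Backward substitution. -/
theorem Derives.backward_solve {n : Type} [Fintype n]
    {R : EigSolver × D → Matrix (Fin k) (Fin k) ℝ}
    {W B : EigSolver × D → Matrix (Fin k) n ℝ} (hR : ∀ ω, IsPosUpper (R ω))
    (hB : ∀ ω, R ω * W ω = B ω) (hRS : Derives inp S (entries R) a)
    (hBS : Derives inp S (entries B) b) :
    Derives inp S (entries W) (a + b + k * (Fintype.card n * (k * 2 + 2))) := by
  have h := Derives.forward_solve (inp := inp) (S := S) (a := a) (b := b)
    (R := fun ω => ((R ω).submatrix Fin.rev Fin.rev)ᵀ)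
    (W := fun ω => (W ω).submatrix Fin.rev id) (B := fun ω => (B ω).submatrix Fin.rev id)
    (fun ω => (hR ω).rev)
    (fun ω => by
      rw [Matrix.transpose_transpose, ← hB,
        Matrix.submatrix_mul _ _ Fin.rev Fin.rev id Fin.rev_bijective])
    (hRS.entries_reindex _ _).entries_transpose (hBS.entries_reindex _ _)
  refine (h.entries_reindex Fin.rev id).entries_congr fun ω => ?_
  ext i j
  simp

/-- Computation of a Cholesky factor. -/
theorem Derives.cholesky_factor {R A : EigSolver × D → Matrix (Fin k) (Fin k) ℝ}
    (hR : ∀ ω, IsPosUpper (R ω)) (hA : ∀ ω, (R ω)ᵀ * R ω = A ω)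
    (hAS : Derives inp S (entries A) a) :
    Derives inp S (entries R) (a + k * (k * 2 + 2 + k * (k * 2 + 2))) := by
  refine Derives.trans hAS (Derives.of_rows fun i hi => ?_)
  set i' : Fin k := ⟨i, hi⟩
  have hsum : ∀ j ω, A ω i' j = ∑ r ∈ Finset.Iio i', R ω r i' * R ω r j + R ω i' i' * R ω i' j :=
    fun j ω => by rw [← hA, (hR ω).transpose_mul_apply]
  have hs : ∀ (U : Set (EigSolver × D → ℝ)) (j : Fin k),
      (S ∪ entries A ∪ {f | ∃ r < i', ∃ j, f = fun ω => R ω r j}) ⊆ U →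
      Computes inp U (fun ω => A ω i' j - ∑ r ∈ Finset.Iio i', R ω r i' * R ω r j)
        (k * 2 + 1) := fun U j hU => by
    refine ((Computes.of_mem ?_).sub (Computes.sum_const _ (c := 1) fun r hr =>
      (Computes.of_mem ?_).mul (Computes.of_mem ?_))).le ?_
    · exact hU (by simp [mem_entries])
    · exact hU (Or.inr ⟨r, by simpa using hr, i', rfl⟩)
    · exact hU (Or.inr ⟨r, by simpa using hr, j, rfl⟩)
    · simp [i']; omega
  -- The residual of row `i'` is the pivot times that row of `R`. Its diagonal entry is the squared
  -- pivot, so the pivot comes first, by a square root, and then the row by division.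
  refine Derives.trans (T := {fun ω => R ω i' i'}) (((hs _ i' subset_rfl).sqrt).congr fun ω => ?_)
    ((Derives.row (c := k * 2 + 2) fun j => ?_).mono subset_rfl subset_rfl (by simp))
  · rw [hsum, add_sub_cancel_left, Real.sqrt_mul_self ((hR ω).2 _).le]
  · refine ((hs _ j Set.subset_union_left).div (Computes.of_mem (f := fun ω => R ω i' i')
      (by simp))).congr fun ω => ?_
    rw [hsum, add_sub_cancel_left, mul_div_cancel_left₀ _ ((hR ω).2 _).ne']

/-- The spectral decomposition of a symmetric matrix. -/
theorem Derives.eig {A : EigSolver × D → Matrix (Fin k) (Fin k) ℝ}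
    (hAS : Derives inp S (entries A) a) :
    Derives inp S ((entries fun ω => ω.1.vec k (A ω)) ∪
      Set.range fun (i : Fin k) ω => ω.1.val k (A ω) i) (a + k ^ 3) := by
  refine Derives.trans hAS fun st h0 hst => ?_
  choose src hlt hsrc using fun i j => hst (fun ω => A ω i j) (by simp [mem_entries])
  have hA : ∀ E x, (Matrix.of fun i j => runProgram E st.prog (inp x) (src i j)) = A (E, x) :=
    fun E x => by ext i j; simp [hsrc]
  have hrun : ∀ E x, runProgram E (st.prog ++ [.eig k st.bound src]) (inp x) =
      Instr.exec E (runProgram E st.prog (inp x)) (.eig k st.bound src) := fun E x => by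
    simp [runProgram]
  have hidx : ∀ i j : Fin k, (i : ℕ) * k + j < k * k := fun i j =>
    calc (i : ℕ) * k + j < i * k + k := by omega
      _ = (i + 1) * k := by ring
      _ ≤ k * k := Nat.mul_le_mul_right _ i.2
  refine ⟨⟨st.prog ++ [.eig k st.bound src], st.bound + (k * k + k)⟩,
    ⟨by simp [programCost, Instr.cost], ?_⟩, ?_⟩
  · rintro g ⟨r, hr, hg⟩
    refine ⟨r, fun q hq => (hr q hq).trans_le (by simp), fun E x => ?_⟩
    rw [hrun, ← hg]
    cases r with
    | inl r => rfl
    | inr q =>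
      have hq := hr q rfl
      simp only [Instr.exec]
      rw [dif_neg (by rintro ⟨ij, h⟩; omega), dif_neg (by rintro ⟨i, h⟩; omega)]
  · rintro _ (⟨⟨i, j⟩, rfl⟩ | ⟨i, rfl⟩)
    · refine ⟨Sum.inr (st.bound + (i * k + j)), fun q hq => ?_, fun E x => ?_⟩
      · have := hidx i j
        simp only [Sum.inr.injEq] at hq
        simp only; omega
      · rw [hrun]
        simp only [Instr.exec, hA]
        have hv : ∃ ij : Fin k × Fin k,
            st.bound + ((i : ℕ) * k + j) = st.bound + (ij.1 * k + ij.2) := ⟨(i, j), rfl⟩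
        rw [dif_pos hv]
        -- The instruction recovers the position by `choose`, so the address must determine the
        -- pair: quotient and remainder modulo `k`.
        have key : ∀ q : Fin k × Fin k, (i : ℕ) * k + j = q.1 * k + q.2 → q = (i, j) := by
          rintro ⟨q, r⟩ h
          have hk : 0 < k := i.pos
          have e1 : (i : ℕ) = q := by
            have := congrArg (· / k) h
            simpa only [mul_comm _ k, Nat.mul_add_div hk, Nat.div_eq_of_lt (Fin.is_lt _),
              add_zero] using this
          have e2 : (j : ℕ) = r := by simp only [e1] at h; omega
          rw [Fin.ext e1, Fin.ext e2]
        rw [key _ (Nat.add_left_cancel hv.choose_spec)]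
    · refine ⟨Sum.inr (st.bound + (k * k + i)), fun q hq => ?_, fun E x => ?_⟩
      · simp only [Sum.inr.injEq] at hq
        simp only; omega
      · rw [hrun]
        simp only [Instr.exec, hA]
        rw [dif_neg (by rintro ⟨ij, h⟩; have := hidx ij.1 ij.2; omega)]
        have hl : ∃ i' : Fin k, st.bound + (k * k + (i : ℕ)) = st.bound + (k * k + i') := ⟨i, rfl⟩
        rw [dif_pos hl]
        have h := hl.choose_spec
        have e : hl.choose = i := Fin.ext (by omega)
        rw [e]

end Triangular

/-! ## Linear algebra -/

section LinearAlgebra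

variable {k d p : ℕ}

theorem IsPosUpper.det_ne_zero {R : Matrix (Fin k) (Fin k) ℝ} (hR : IsPosUpper R) : R.det ≠ 0 := by
  rw [Matrix.det_of_isUpperTriangular (fun i j h => hR.1 i j h)]
  exact Finset.prod_ne_zero_iff.2 fun i _ => (hR.2 i).ne'

theorem IsPosUpper.isUnit {R : Matrix (Fin k) (Fin k) ℝ} (hR : IsPosUpper R) : IsUnit R.det :=
  hR.det_ne_zero.isUnit

/-- From the LDL decomposition with unit `W`, the matrix `T = √D * (W⁻¹)ᵀ` is upper triangular with
`Tᵀ * T = A`. Multiplying its rows by the signs of its diagonal entries makes the diagonal positive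
and does not change `Tᵀ * T`. -/
theorem exists_cholesky {A : Matrix (Fin k) (Fin k) ℝ} (hA : A.PosDef) :
    ∃ R, IsPosUpper R ∧ Rᵀ * R = A := by
  set W := LDL.lowerInv hA
  have hW : IsUnit W.det := by
    have := (LDL.invertibleLowerInv hA)
    exact (Matrix.isUnit_iff_isUnit_det _).1 (isUnit_of_invertible W)
  have hD : LDL.diag hA = W * A * Wᵀ := LDL.diag_eq_lowerInv_conj hA
  have hDpos : (LDL.diag hA).PosDef := by
    rw [hD]
    have := hA.mul_mul_conjTranspose_same (B := W) (by
      have hW' : IsUnit W := (Matrix.isUnit_iff_isUnit_det _).2 hW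
      exact Matrix.vecMul_injective_of_isUnit hW')
    simpa using this
  have hpos : ∀ i, 0 < LDL.diagEntries hA i := fun i => by
    have := hDpos.diag_pos (i := i)
    simpa [LDL.diag] using this
  have htri : ∀ i j : Fin k, i < j → W⁻¹ i j = 0 := by
    have hinv := LDL.invertibleLowerInv hA
    have h : Matrix.BlockTriangular W OrderDual.toDual := fun i j h =>
      LDL.lowerInv_triangular hA h
    have := Matrix.blockTriangular_inv_of_blockTriangular h
    exact fun i j h => this h
  set T : Matrix (Fin k) (Fin k) ℝ :=
    Matrix.diagonal (fun i => √(LDL.diagEntries hA i)) * (W⁻¹)ᵀ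
  have hTT : Tᵀ * T = A := by
    have h1 : Matrix.diagonal (fun i => √(LDL.diagEntries hA i)) *
        Matrix.diagonal (fun i => √(LDL.diagEntries hA i)) = LDL.diag hA := by
      rw [Matrix.diagonal_mul_diagonal, LDL.diag]
      congr 1
      ext i
      exact Real.mul_self_sqrt (hpos i).le
    calc Tᵀ * T = W⁻¹ * (Matrix.diagonal (fun i => √(LDL.diagEntries hA i)) *
        Matrix.diagonal (fun i => √(LDL.diagEntries hA i))) * (W⁻¹)ᵀ := by
          simp only [T, Matrix.transpose_mul, Matrix.diagonal_transpose, Matrix.transpose_transpose,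
            Matrix.mul_assoc]
      _ = W⁻¹ * W * A * (W⁻¹ * W)ᵀ := by
          rw [h1, hD, Matrix.transpose_mul]; simp only [Matrix.mul_assoc]
      _ = A := by rw [Matrix.nonsing_inv_mul _ hW]; simp
  have hTtri : ∀ i j, j < i → T i j = 0 := fun i j h => by
    simp [T, Matrix.diagonal_mul, htri j i h]
  have hTdet : T.det ≠ 0 := fun h => by
    have := congrArg Matrix.det hTT
    rw [Matrix.det_mul, h, mul_zero] at this
    exact hA.det_pos.ne this
  have hTdiag : ∀ i, T i i ≠ 0 := by
    rw [Matrix.det_of_isUpperTriangular (fun i j h => hTtri i j h)] at hTdet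
    exact fun i => Finset.prod_ne_zero_iff.1 hTdet i (Finset.mem_univ _)
  refine ⟨Matrix.diagonal (fun i => SignType.sign (T i i) : Fin k → ℝ) * T, ⟨fun i j h => ?_,
    fun i => ?_⟩, ?_⟩
  · simp [Matrix.diagonal_mul, hTtri i j h]
  · rw [Matrix.diagonal_mul, sign_mul_self]
    exact abs_pos.2 (hTdiag i)
  · rw [Matrix.transpose_mul, Matrix.mul_assoc, ← Matrix.mul_assoc _ _ T,
      Matrix.diagonal_transpose, Matrix.diagonal_mul_diagonal]
    have : (fun i => ((SignType.sign (T i i) : ℝ) * (SignType.sign (T i i) : ℝ))) = fun _ => 1 := by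
      ext i
      rcases lt_or_gt_of_ne (hTdiag i) with h | h
      · simp [sign_neg h]
      · simp [sign_pos h]
    rw [this, Matrix.diagonal_one, Matrix.one_mul, hTT]

theorem cholesky_spec {A : Matrix (Fin k) (Fin k) ℝ} (hA : A.PosDef) :
    IsPosUpper (cholesky A) ∧ (cholesky A)ᵀ * cholesky A = A :=
  Classical.epsilon_spec (exists_cholesky hA)

theorem posDef_of_isUnit_det {R : Matrix (Fin k) (Fin k) ℝ} (hR : IsUnit R.det) :
    (Rᵀ * R).PosDef := by
  have := Matrix.PosDef.conjTranspose_mul_self R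
    (Matrix.mulVec_injective_of_isUnit ((Matrix.isUnit_iff_isUnit_det _).2 hR))
  simpa using this

theorem _root_.Matrix.PosDef.isSymm {A : Matrix (Fin k) (Fin k) ℝ} (hA : A.PosDef) : Aᵀ = A := by
  simpa [Matrix.IsHermitian] using hA.isHermitian

theorem _root_.Matrix.PosDef.isUnit_det {A : Matrix (Fin k) (Fin k) ℝ} (hA : A.PosDef) :
    IsUnit A.det := (Matrix.isUnit_iff_isUnit_det _).1 hA.isUnit

theorem trace_transpose_mul_self_nonneg {m n : Type*} [Fintype m] [Fintype n] (A : Matrix m n ℝ) :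
    0 ≤ (Aᵀ * A).trace := by
  simpa using (Matrix.posSemidef_conjTranspose_mul_self A).trace_nonneg

theorem trace_quadForm_nonneg {A : Matrix (Fin d) (Fin d) ℝ} (hA : A.PosDef)
    (ξ : Matrix (Fin d) (Fin p) ℝ) : 0 ≤ (ξᵀ * A * ξ).trace := by
  simpa using (hA.posSemidef.conjTranspose_mul_mul_same ξ).trace_nonneg

theorem eq_zero_of_trace_quadForm {A : Matrix (Fin d) (Fin d) ℝ} (hA : A.PosDef)
    {ξ : Matrix (Fin d) (Fin p) ℝ} (h : (ξᵀ * A * ξ).trace = 0) : ξ = 0 := by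
  obtain ⟨R, hR, rfl⟩ := exists_cholesky hA
  have h1 : ((R * ξ)ᵀ * (R * ξ)).trace = 0 := by
    rw [← h]; simp [Matrix.mul_assoc]
  have h2 : R * ξ = 0 := by
    have := Matrix.trace_conjTranspose_mul_self_eq_zero_iff (A := R * ξ)
    simpa using this.1 (by simpa using h1)
  calc ξ = R⁻¹ * (R * ξ) := by rw [← Matrix.mul_assoc, Matrix.nonsing_inv_mul _ hR.isUnit,
        Matrix.one_mul]
    _ = 0 := by rw [h2, Matrix.mul_zero]

/-! ### The Lyapunov equation -/

/-- Multiplying by `Sᵀ` and taking the trace gives a vanishing sum of two nonnegative quadratic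
forms. Two different matrices `K`, `K'` are allowed so that the uniqueness of square roots follows
as well. -/
theorem lyapunov_injective {K K' : Matrix (Fin p) (Fin p) ℝ} (hK : K.PosDef) (hK' : K'.PosDef)
    {S : Matrix (Fin p) (Fin p) ℝ} (h : K * S + S * K' = 0) : S = 0 := by
  have h1 : (Sᵀ * K * S).trace + (Sᵀᵀ * K' * Sᵀ).trace = 0 := by
    have h2 := congrArg (fun T => (Sᵀ * T).trace) h
    simp only [Matrix.mul_add, Matrix.trace_add, Matrix.mul_zero, Matrix.trace_zero] at h2
    rw [← h2, Matrix.mul_assoc, Matrix.transpose_transpose, Matrix.trace_mul_comm Sᵀ (S * K')]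
  have h3 := trace_quadForm_nonneg hK S
  have h4 := trace_quadForm_nonneg hK' Sᵀ
  exact eq_zero_of_trace_quadForm hK (by linarith)

/-- The difference `S = A - B` solves `A * S + S * B = A * A - B * B = 0`. -/
theorem posDef_sqrt_unique {A B : Matrix (Fin k) (Fin k) ℝ} (hA : A.PosDef) (hB : B.PosDef)
    (h : A * A = B * B) : A = B :=
  sub_eq_zero.1 (lyapunov_injective hA hB (by
    rw [Matrix.mul_sub, Matrix.sub_mul, h]; abel))

theorem posDef_diagonalize {V : Matrix (Fin k) (Fin k) ℝ} (hV : Vᵀ * V = 1) {w : Fin k → ℝ} :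
    (V * Matrix.diagonal w * Vᵀ).PosDef ↔ ∀ i, 0 < w i := by
  have hV' : IsUnit V := (Matrix.isUnit_iff_isUnit_det _).2 (Matrix.isUnit_det_of_left_inverse hV)
  have := Matrix.IsUnit.posDef_star_right_conjugate_iff (x := Matrix.diagonal w) hV'
  rw [← Matrix.posDef_diagonal_iff, ← this]
  simp [Matrix.star_eq_conjTranspose]

theorem mul_diagonalize {V : Matrix (Fin k) (Fin k) ℝ} (hV : Vᵀ * V = 1) (w w' : Fin k → ℝ) :
    (V * Matrix.diagonal w * Vᵀ) * (V * Matrix.diagonal w' * Vᵀ) =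
      V * Matrix.diagonal (fun i => w i * w' i) * Vᵀ := by
  calc _ = V * Matrix.diagonal w * (Vᵀ * V) * Matrix.diagonal w' * Vᵀ := by
        simp only [Matrix.mul_assoc]
    _ = _ := by rw [hV, Matrix.mul_one, Matrix.mul_assoc V, Matrix.diagonal_mul_diagonal]

theorem exists_spectral {A : Matrix (Fin k) (Fin k) ℝ} (hA : Aᵀ = A) :
    ∃ (V : Matrix (Fin k) (Fin k) ℝ) (w : Fin k → ℝ), Vᵀ * V = 1 ∧
      A = V * Matrix.diagonal w * Vᵀ := by
  have hA' : A.IsHermitian := by simpa [Matrix.IsHermitian] using hA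
  refine ⟨hA'.eigenvectorUnitary, hA'.eigenvalues, ?_, ?_⟩
  · have := Matrix.mem_unitaryGroup_iff'.1 hA'.eigenvectorUnitary.2
    simpa [Matrix.star_eq_conjTranspose] using this
  · conv_lhs => rw [hA'.spectral_theorem]
    simp [Matrix.star_eq_conjTranspose, Unitary.conjStarAlgAut_apply]

/-- Uniqueness pins down the choice made by `epsilon`, so the root can be read off from whichever
spectral decomposition a solver returns. -/
theorem spdSqrt_diagonalize {V : Matrix (Fin k) (Fin k) ℝ} (hV : Vᵀ * V = 1) {w : Fin k → ℝ}
    (hw : ∀ i, 0 < w i) :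
    spdSqrt (V * Matrix.diagonal w * Vᵀ) = V * Matrix.diagonal (fun i => √(w i)) * Vᵀ := by
  have hex : (V * Matrix.diagonal (fun i => √(w i)) * Vᵀ).PosDef ∧
      (V * Matrix.diagonal (fun i => √(w i)) * Vᵀ) * (V * Matrix.diagonal (fun i => √(w i)) * Vᵀ) =
        V * Matrix.diagonal w * Vᵀ := by
    refine ⟨(posDef_diagonalize hV).2 fun i => Real.sqrt_pos.2 (hw i), ?_⟩
    rw [mul_diagonalize hV]
    congr 3
    ext i
    exact Real.mul_self_sqrt (hw i).le
  have h := Classical.epsilon_spec (p := fun Q : Matrix (Fin k) (Fin k) ℝ => Q.PosDef ∧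
    Q * Q = V * Matrix.diagonal w * Vᵀ) ⟨_, hex⟩
  exact posDef_sqrt_unique h.1 hex.1 (h.2.trans hex.2.symm)

theorem spdSqrt_spec {A : Matrix (Fin k) (Fin k) ℝ} (hA : A.PosDef) :
    (spdSqrt A).PosDef ∧ spdSqrt A * spdSqrt A = A := by
  obtain ⟨V, w, hV, rfl⟩ := exists_spectral hA.isSymm
  have hw := (posDef_diagonalize hV).1 hA
  rw [spdSqrt_diagonalize hV hw, mul_diagonalize hV]
  refine ⟨(posDef_diagonalize hV).2 fun i => Real.sqrt_pos.2 (hw i), ?_⟩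
  congr 3
  ext i
  exact Real.mul_self_sqrt (hw i).le

theorem spdSqrt_inv_diagonalize {V : Matrix (Fin k) (Fin k) ℝ} (hV : Vᵀ * V = 1) {w : Fin k → ℝ}
    (hw : ∀ i, 0 < w i) :
    (spdSqrt (V * Matrix.diagonal w * Vᵀ))⁻¹ =
      V * Matrix.diagonal (fun i => 1 / √(w i)) * Vᵀ := by
  rw [spdSqrt_diagonalize hV hw]
  refine Matrix.inv_eq_right_inv ?_
  rw [mul_diagonalize hV]
  have : (fun i => √(w i) * (1 / √(w i))) = fun _ => 1 := by
    ext i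
    exact mul_one_div_cancel (Real.sqrt_pos.2 (hw i)).ne'
  rw [this, Matrix.diagonal_one, Matrix.mul_one]
  exact mul_eq_one_comm.1 hV

/-- The solution of the Lyapunov equation in spectral coordinates. -/
def lyapunovSol (V : Matrix (Fin p) (Fin p) ℝ) (w : Fin p → ℝ) (R : Matrix (Fin p) (Fin p) ℝ) :
    Matrix (Fin p) (Fin p) ℝ :=
  V * (Matrix.of fun i j => (Vᵀ * R * V) i j / (w i + w j)) * Vᵀ

/-- In the eigenbasis the Lyapunov operator multiplies entry `(i, j)` by `w i + w j`, which is
positive. -/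
theorem lyapunovSol_spec {V : Matrix (Fin p) (Fin p) ℝ} (hV : Vᵀ * V = 1) {w : Fin p → ℝ}
    (hw : ∀ i, 0 < w i) (R : Matrix (Fin p) (Fin p) ℝ) :
    (V * Matrix.diagonal w * Vᵀ) * lyapunovSol V w R + lyapunovSol V w R *
      (V * Matrix.diagonal w * Vᵀ) = R := by
  have hV' : V * Vᵀ = 1 := mul_eq_one_comm.1 hV
  set E : Matrix (Fin p) (Fin p) ℝ := Matrix.of fun i j => (Vᵀ * R * V) i j / (w i + w j) with hE
  have h1 : Matrix.diagonal w * E + E * Matrix.diagonal w = Vᵀ * R * V := by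
    ext i j
    have : w i + w j ≠ 0 := (add_pos (hw i) (hw j)).ne'
    rw [Matrix.add_apply, Matrix.diagonal_mul, Matrix.mul_diagonal, hE, Matrix.of_apply]
    field_simp
  have h2 : lyapunovSol V w R = V * E * Vᵀ := rfl
  rw [h2]
  calc _ = V * (Matrix.diagonal w * (Vᵀ * V) * E + E * (Vᵀ * V) * Matrix.diagonal w) * Vᵀ := by
        simp only [Matrix.mul_add, Matrix.add_mul, Matrix.mul_assoc]
    _ = (V * Vᵀ) * R * (V * Vᵀ) := by
        rw [hV, Matrix.mul_one, Matrix.mul_one, h1]; simp only [Matrix.mul_assoc]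
    _ = R := by rw [hV', Matrix.one_mul, Matrix.mul_one]

theorem exists_lyapunov {K : Matrix (Fin p) (Fin p) ℝ} (hK : K.PosDef)
    (R : Matrix (Fin p) (Fin p) ℝ) : ∃ S, K * S + S * K = R := by
  obtain ⟨V, w, hV, rfl⟩ := exists_spectral hK.isSymm
  exact ⟨_, lyapunovSol_spec hV ((posDef_diagonalize hV).1 hK) R⟩

/-- The transpose solves the same equation, and solutions are unique. -/
theorem lyapunov_symm {K : Matrix (Fin p) (Fin p) ℝ} (hK : K.PosDef)
    {R S : Matrix (Fin p) (Fin p) ℝ} (hR : Rᵀ = R) (hS : K * S + S * K = R) : Sᵀ = S := by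
  refine sub_eq_zero.1 (lyapunov_injective hK hK ?_)
  have h := congrArg Matrix.transpose hS
  rw [Matrix.transpose_add, Matrix.transpose_mul, Matrix.transpose_mul, hR, hK.isSymm] at h
  rw [Matrix.mul_sub, Matrix.sub_mul, sub_add_sub_comm, hS, add_comm, h, sub_self]

end LinearAlgebra

/-! ## Projections, gradients and retractions -/

section Blocks

variable {d p : ℕ} {B M : Matrix (Fin d) (Fin d) ℝ} {Z : Matrix (Fin d) (Fin p) ℝ}

theorem trace_skew_mul_symm {W S : Matrix (Fin p) (Fin p) ℝ} (hW : W + Wᵀ = 0) (hS : Sᵀ = S) :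
    (W * S).trace = 0 := by
  have h : Wᵀ = -W := by rw [← sub_eq_zero, sub_neg_eq_add, add_comm, hW]
  have := Matrix.trace_transpose (W * S)
  rw [Matrix.transpose_mul, hS, h, Matrix.mul_neg, Matrix.trace_neg, Matrix.trace_mul_comm] at this
  linarith

theorem skew_of_tangent (hB : Bᵀ = B) {ζ : Matrix (Fin d) (Fin p) ℝ}
    (h : ζᵀ * B * Z + Zᵀ * B * ζ = 0) : ζᵀ * B * Z + (ζᵀ * B * Z)ᵀ = 0 := by
  rw [← h]
  simp [Matrix.mul_assoc, hB]

/-- The matrix `K = Zᵀ B M⁻¹ B Z` of the normal equations. -/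
def normalMat (B M : Matrix (Fin d) (Fin d) ℝ) (Z : Matrix (Fin d) (Fin p) ℝ) :
    Matrix (Fin p) (Fin p) ℝ := (B * Z)ᵀ * (M⁻¹ * (B * Z))

/-- The right-hand side `Zᵀ B ξ + ξᵀ B Z` of the normal equations. -/
def normalRhs (B : Matrix (Fin d) (Fin d) ℝ) (Z ξ : Matrix (Fin d) (Fin p) ℝ) :
    Matrix (Fin p) (Fin p) ℝ := (B * Z)ᵀ * ξ + ξᵀ * (B * Z)

theorem normalRhs_symm (B : Matrix (Fin d) (Fin d) ℝ) (Z ξ : Matrix (Fin d) (Fin p) ℝ) :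
    (normalRhs B Z ξ)ᵀ = normalRhs B Z ξ := by
  simp only [normalRhs, Matrix.transpose_add, Matrix.transpose_mul, Matrix.transpose_transpose]
  rw [add_comm]

/-- On the manifold `Zᵀ` is a left inverse of `B * Z`, so `B * Z` is injective and the congruence
preserves definiteness. -/
theorem normalMat_posDef (hM : M.PosDef) (hZ : Zᵀ * B * Z = 1) :
    (normalMat B M Z).PosDef := by
  have hinj : Function.Injective (B * Z).mulVec := fun x y h => by
    have := congrArg (Zᵀ).mulVec h
    simpa only [Matrix.mulVec_mulVec, ← Matrix.mul_assoc, hZ, Matrix.one_mulVec] using this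
  have := hM.inv.conjTranspose_mul_mul_same hinj
  simpa [normalMat, Matrix.mul_assoc] using this

/-- The vectors normal to the tangent space in the metric are the `M⁻¹ * (B * Z) * S` with `S`
symmetric. The Lyapunov equation is the condition that removing such a vector leaves a tangent one.
-/
theorem tangent_normal_solution (hB : Bᵀ = B) (hM : Mᵀ = M) {ξ : Matrix (Fin d) (Fin p) ℝ}
    {S : Matrix (Fin p) (Fin p) ℝ} (hS : Sᵀ = S)
    (h : normalMat B M Z * S + S * normalMat B M Z = normalRhs B Z ξ) :
    (ξ - M⁻¹ * (B * Z) * S)ᵀ * B * Z + Zᵀ * B * (ξ - M⁻¹ * (B * Z) * S) = 0 := by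
  have hMi : (M⁻¹)ᵀ = M⁻¹ := by rw [Matrix.transpose_nonsing_inv, hM]
  have e : (ξ - M⁻¹ * (B * Z) * S)ᵀ * B * Z + Zᵀ * B * (ξ - M⁻¹ * (B * Z) * S) =
      normalRhs B Z ξ - (normalMat B M Z * S + S * normalMat B M Z) := by
    simp only [normalRhs, normalMat, Matrix.transpose_sub, Matrix.transpose_mul, hB, hMi, hS,
      Matrix.sub_mul, Matrix.mul_sub, Matrix.mul_assoc]
    abel
  rw [e, h, sub_self]

/-- `M` cancels against `M⁻¹`, leaving the trace of the skew matrix `ζᵀ * B * Z` times the symmetric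
matrix `S`. -/
theorem normal_orthogonal (hB : Bᵀ = B) (hM : IsUnit M.det) {ζ : Matrix (Fin d) (Fin p) ℝ}
    (hζ : ζᵀ * B * Z + Zᵀ * B * ζ = 0) {S : Matrix (Fin p) (Fin p) ℝ} (hS : Sᵀ = S) :
    (ζᵀ * M * (M⁻¹ * (B * Z) * S)).trace = 0 := by
  have e : ζᵀ * M * (M⁻¹ * (B * Z) * S) = (ζᵀ * B * Z) * S := by
    calc _ = ζᵀ * (M * M⁻¹) * (B * Z) * S := by simp only [Matrix.mul_assoc]
      _ = _ := by rw [Matrix.mul_nonsing_inv _ hM]; simp only [Matrix.mul_one, Matrix.mul_assoc]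
  rw [e]
  exact trace_skew_mul_symm (skew_of_tangent hB hζ) hS

/-- The cross terms add up to the tangency condition. Hence the Gram matrix to be normalized by a
retraction is always positive definite. -/
theorem gram_of_tangent (hZ : Zᵀ * B * Z = 1) {ξ : Matrix (Fin d) (Fin p) ℝ}
    (hξ : ξᵀ * B * Z + Zᵀ * B * ξ = 0) :
    (Z + ξ)ᵀ * B * (Z + ξ) = 1 + ξᵀ * B * ξ := by
  simp only [Matrix.transpose_add, Matrix.add_mul, Matrix.mul_add, hZ]
  calc _ = 1 + (ξᵀ * B * Z + Zᵀ * B * ξ) + ξᵀ * B * ξ := by abel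
    _ = _ := by rw [hξ, add_zero]

theorem posDef_one_add (hB : B.PosDef) (ξ : Matrix (Fin d) (Fin p) ℝ) :
    (1 + ξᵀ * B * ξ).PosDef := by
  have := hB.posSemidef.conjTranspose_mul_mul_same ξ
  exact Matrix.PosDef.one.add_posSemidef (by simpa using this)

theorem qf_spec {A : Matrix (Fin d) (Fin p) ℝ} (hA : (Aᵀ * A).PosDef) :
    (qf A)ᵀ * qf A = 1 ∧ ∃ R : Matrix (Fin p) (Fin p) ℝ, IsPosUpper R ∧ A = qf A * R := by
  obtain ⟨R₀, hR₀, hR₀'⟩ := exists_cholesky hA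
  refine Classical.epsilon_spec (p := fun Q : Matrix (Fin d) (Fin p) ℝ => Qᵀ * Q = 1 ∧
    ∃ R : Matrix (Fin p) (Fin p) ℝ, IsPosUpper R ∧ A = Q * R) ⟨A * R₀⁻¹, ?_, R₀, hR₀, ?_⟩
  · calc _ = (R₀⁻¹)ᵀ * (Aᵀ * A) * R₀⁻¹ := by
          rw [Matrix.transpose_mul]; simp only [Matrix.mul_assoc]
      _ = (R₀ * R₀⁻¹)ᵀ * (R₀ * R₀⁻¹) := by
          rw [← hR₀', Matrix.transpose_mul]; simp only [Matrix.mul_assoc]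
      _ = 1 := by rw [Matrix.mul_nonsing_inv _ hR₀.isUnit]; simp
  · rw [Matrix.mul_assoc, Matrix.nonsing_inv_mul _ hR₀.isUnit, Matrix.mul_one]

/-- The square root of `B` disappears: `R` is the Cholesky factor of a `p × p` Gram matrix, and the
retraction is `(Z + ξ) * R⁻¹`. In this form it is cheap to compute. -/
theorem retractSt_qr_spec (hB : B.PosDef) {ξ : Matrix (Fin d) (Fin p) ℝ}
    (hC : ((Z + ξ)ᵀ * B * (Z + ξ)).PosDef) :
    ∃ R : Matrix (Fin p) (Fin p) ℝ, IsPosUpper R ∧ Rᵀ * R = (Z + ξ)ᵀ * B * (Z + ξ) ∧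
      retractSt .qr B Z ξ * R = Z + ξ := by
  obtain ⟨hQ, hQQ⟩ := spdSqrt_spec hB
  have hC' : (spdSqrt B * (Z + ξ))ᵀ * (spdSqrt B * (Z + ξ)) = (Z + ξ)ᵀ * B * (Z + ξ) := by
    calc _ = (Z + ξ)ᵀ * (spdSqrt B * spdSqrt B) * (Z + ξ) := by
          rw [Matrix.transpose_mul, hQ.isSymm]; simp only [Matrix.mul_assoc]
      _ = _ := by rw [hQQ]
  obtain ⟨h1, R, hR, h2⟩ := qf_spec (hC' ▸ hC)
  refine ⟨R, hR, ?_, ?_⟩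
  · calc Rᵀ * R = Rᵀ * ((qf (spdSqrt B * (Z + ξ)))ᵀ * qf (spdSqrt B * (Z + ξ))) * R := by
          rw [h1, Matrix.mul_one]
      _ = (spdSqrt B * (Z + ξ))ᵀ * (spdSqrt B * (Z + ξ)) := by
          conv_rhs => rw [h2]
          rw [Matrix.transpose_mul]; simp only [Matrix.mul_assoc]
      _ = _ := hC'
  · change (spdSqrt B)⁻¹ * qf (spdSqrt B * (Z + ξ)) * R = Z + ξ
    rw [Matrix.mul_assoc, ← h2, ← Matrix.mul_assoc, Matrix.nonsing_inv_mul _ hQ.isUnit_det,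
      Matrix.one_mul]

theorem retractSt_mem (k : RetractionKind) (hB : B.PosDef) (hZ : Zᵀ * B * Z = 1)
    {ξ : Matrix (Fin d) (Fin p) ℝ} (hξ : ξᵀ * B * Z + Zᵀ * B * ξ = 0) :
    (retractSt k B Z ξ)ᵀ * B * retractSt k B Z ξ = 1 := by
  have hG := gram_of_tangent hZ hξ
  have hA := posDef_one_add hB ξ
  cases k with
  | polar =>
    obtain ⟨hQ, hQQ⟩ := spdSqrt_spec hA
    simp only [retractSt]
    set Q := spdSqrt (1 + ξᵀ * B * ξ)
    calc _ = (Q⁻¹)ᵀ * ((Z + ξ)ᵀ * B * (Z + ξ)) * Q⁻¹ := by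
          rw [Matrix.transpose_mul]; simp only [Matrix.mul_assoc]
      _ = (Q⁻¹ * Q) * (Q * Q⁻¹) := by
          rw [hG, ← hQQ, Matrix.transpose_nonsing_inv, hQ.isSymm]; simp only [Matrix.mul_assoc]
      _ = 1 := by
          rw [Matrix.mul_nonsing_inv _ hQ.isUnit_det, Matrix.nonsing_inv_mul _ hQ.isUnit_det,
            Matrix.one_mul]
  | qr =>
    obtain ⟨R, hR, hRR, hY⟩ := retractSt_qr_spec hB (hG ▸ hA)
    have hY' : retractSt .qr B Z ξ = (Z + ξ) * R⁻¹ := by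
      rw [← hY, Matrix.mul_assoc, Matrix.mul_nonsing_inv _ hR.isUnit, Matrix.mul_one]
    rw [hY']
    calc _ = (R⁻¹)ᵀ * ((Z + ξ)ᵀ * B * (Z + ξ)) * R⁻¹ := by
          rw [Matrix.transpose_mul]; simp only [Matrix.mul_assoc]
      _ = (R * R⁻¹)ᵀ * (R * R⁻¹) := by
          rw [← hRR, Matrix.transpose_mul]; simp only [Matrix.mul_assoc]
      _ = 1 := by rw [Matrix.mul_nonsing_inv _ hR.isUnit]; simp

theorem tangent_smul {ξ : Matrix (Fin d) (Fin p) ℝ} (hξ : ξᵀ * B * Z + Zᵀ * B * ξ = 0) (t : ℝ) :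
    (t • ξ)ᵀ * B * Z + Zᵀ * B * (t • ξ) = 0 := by
  simp only [Matrix.transpose_smul, Matrix.smul_mul, Matrix.mul_smul, ← smul_add, hξ, smul_zero]

end Blocks

/-! ### Projection and Euclidean gradient on pairs of blocks. -/

section Pairs

variable {dx dy p : ℕ} {G : Geometry dx dy}

/-- Two candidates differ by a tangent vector orthogonal to itself. `Z` ranges over the whole
ambient space, because the Hessian differentiates the gradient along lines that leave the manifold.
-/
theorem Geometry.proj_eq_of (h1 : G.M1.PosDef) (h2 : G.M2.PosDef) {Z ξ η : Pt dx dy p}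
    (hη : η ∈ G.tangent Z) (ho : ∀ ζ ∈ G.tangent Z, G.inner ζ (ξ - η) = 0) :
    G.proj Z ξ = η := by
  obtain ⟨ht, ho'⟩ := Classical.epsilon_spec (p := fun η => η ∈ G.tangent Z ∧
    ∀ ζ ∈ G.tangent Z, G.inner ζ (ξ - η) = 0) ⟨η, hη, ho⟩
  change G.proj Z ξ ∈ _ at ht
  change ∀ ζ ∈ G.tangent Z, G.inner ζ (ξ - G.proj Z ξ) = 0 at ho'
  set π := G.proj Z ξ
  have hδ : π - η ∈ G.tangent Z := by
    refine ⟨?_, ?_⟩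
    · have e1 := ht.1
      have e2 := hη.1
      simp only [Prod.fst_sub, Matrix.transpose_sub, Matrix.sub_mul, Matrix.mul_sub]
      rw [sub_add_sub_comm, e1, e2, sub_zero]
    · have e1 := ht.2
      have e2 := hη.2
      simp only [Prod.snd_sub, Matrix.transpose_sub, Matrix.sub_mul, Matrix.mul_sub]
      rw [sub_add_sub_comm, e1, e2, sub_zero]
  have e : G.inner (π - η) (π - η) = 0 := by
    have a := ho _ hδ
    have b := ho' _ hδ
    have c : G.inner (π - η) (π - η) = G.inner (π - η) (ξ - η) - G.inner (π - η) (ξ - π) := by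
      simp only [Geometry.inner, Prod.fst_sub, Prod.snd_sub, Matrix.mul_sub, Matrix.trace_sub]
      ring
    rw [c, a, b, sub_zero]
  have n1 := trace_quadForm_nonneg h1 (π - η).1
  have n2 := trace_quadForm_nonneg h2 (π - η).2
  simp only [Geometry.inner] at e
  have z1 := eq_zero_of_trace_quadForm h1 (ξ := (π - η).1) (by linarith)
  have z2 := eq_zero_of_trace_quadForm h2 (ξ := (π - η).2) (by linarith)
  exact sub_eq_zero.1 (Prod.ext z1 z2)

theorem Geometry.proj_eq_of_normal (h1 : G.M1.PosDef) (h2 : G.M2.PosDef) (hB1 : G.B1ᵀ = G.B1)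
    (hB2 : G.B2ᵀ = G.B2) {Z ξ : Pt dx dy p} {S1 S2 : Matrix (Fin p) (Fin p) ℝ}
    (hS1 : S1ᵀ = S1) (hS2 : S2ᵀ = S2)
    (e1 : normalMat G.B1 G.M1 Z.1 * S1 + S1 * normalMat G.B1 G.M1 Z.1 = normalRhs G.B1 Z.1 ξ.1)
    (e2 : normalMat G.B2 G.M2 Z.2 * S2 + S2 * normalMat G.B2 G.M2 Z.2 = normalRhs G.B2 Z.2 ξ.2) :
    G.proj Z ξ = (ξ.1 - G.M1⁻¹ * (G.B1 * Z.1) * S1, ξ.2 - G.M2⁻¹ * (G.B2 * Z.2) * S2) := by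
  refine Geometry.proj_eq_of h1 h2 ⟨tangent_normal_solution hB1 h1.isSymm hS1 e1,
    tangent_normal_solution hB2 h2.isSymm hS2 e2⟩ fun ζ hζ => ?_
  simp only [Geometry.inner, Prod.fst_sub, Prod.snd_sub, sub_sub_cancel]
  rw [normal_orthogonal hB1 h1.isUnit_det hζ.1 hS1, normal_orthogonal hB2 h2.isUnit_det hζ.2 hS2,
    add_zero]

theorem CCAProblem.cost_eq {n : ℕ} (P : CCAProblem n dx dy p) (Z : Pt dx dy p) :
    P.cost Z = -(Z.1ᵀ * (P.Sxy * Z.2 * P.N)).trace := by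
  have h : (Z.2ᵀ * P.Sxyᵀ * Z.1 * P.N).trace = (Z.1ᵀ * (P.Sxy * Z.2 * P.N)).trace := by
    rw [← Matrix.trace_transpose]
    simp only [Matrix.transpose_mul, Matrix.transpose_transpose, CCAProblem.N,
      Matrix.diagonal_transpose]
    rw [Matrix.trace_mul_comm]
    simp only [Matrix.mul_assoc]
  rw [CCAProblem.cost, Matrix.add_mul, Matrix.trace_add, h]
  simp only [Matrix.mul_assoc]
  ring

/-- Together with `cost_eq` this exhibits the cost as linear in each block separately, so its
partial derivatives are slopes of affine functions. -/
theorem CCAProblem.cost_eq' {n : ℕ} (P : CCAProblem n dx dy p) (Z : Pt dx dy p) :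
    P.cost Z = -(Z.2ᵀ * (P.Sxyᵀ * Z.1 * P.N)).trace := by
  rw [P.cost_eq, ← Matrix.trace_transpose]
  simp only [Matrix.transpose_mul, Matrix.transpose_transpose, CCAProblem.N,
    Matrix.diagonal_transpose]
  rw [Matrix.mul_assoc, Matrix.trace_mul_comm]
  simp only [Matrix.mul_assoc]

theorem trace_single_transpose_mul {d : ℕ} (A : Matrix (Fin d) (Fin p) ℝ) (i : Fin d) (j : Fin p) :
    ((Matrix.single i j (1 : ℝ))ᵀ * A).trace = A i j := by
  simp [Matrix.trace_single_mul]

theorem deriv_trace_affine {d : ℕ} (U A : Matrix (Fin d) (Fin p) ℝ) (i : Fin d) (j : Fin p) :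
    deriv (fun t : ℝ => -((U + t • Matrix.single i j (1 : ℝ))ᵀ * A).trace) 0 = -(A i j) := by
  have : (fun t : ℝ => -((U + t • Matrix.single i j (1 : ℝ))ᵀ * A).trace) =
      fun t => -((Uᵀ * A).trace + t * A i j) := by
    ext t
    rw [Matrix.transpose_add, Matrix.add_mul, Matrix.trace_add, Matrix.transpose_smul,
      Matrix.smul_mul, Matrix.trace_smul, trace_single_transpose_mul, smul_eq_mul]
  rw [this]
  simp

theorem CCAProblem.euclGrad_cost {n : ℕ} (P : CCAProblem n dx dy p) (Z : Pt dx dy p) :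
    Geometry.euclGrad P.cost Z = (-(P.Sxy * Z.2 * P.N), -(P.Sxyᵀ * Z.1 * P.N)) := by
  refine Prod.ext ?_ ?_
  · ext i j
    simp only [Geometry.euclGrad, Matrix.of_apply, P.cost_eq, Matrix.neg_apply]
    exact deriv_trace_affine _ _ i j
  · ext i j
    simp only [Geometry.euclGrad, Matrix.of_apply, P.cost_eq', Matrix.neg_apply]
    exact deriv_trace_affine _ _ i j

end Pairs

/-! ## Costs in multiples of a budget -/

section Budget

variable {D ι : Type} {inp : D → ι → ℝ} {S : Set (EigSolver × D → ℝ)} {W a b c d e : ℕ}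

theorem Derives.le {T : Set (EigSolver × D → ℝ)} (h : Derives inp S T a) (hab : a ≤ b) :
    Derives inp S T b := h.mono subset_rfl subset_rfl hab

/-- The matrix can be computed at cost `a * W`. -/
abbrev MatWithin (inp : D → ι → ℝ) (S : Set (EigSolver × D → ℝ)) (W : ℕ) {m n : Type*}
    (A : EigSolver × D → Matrix m n ℝ) (a : ℕ) : Prop := Derives inp S (entries A) (a * W)

/-- The number can be computed at cost `a * W`. -/
abbrev NumWithin (inp : D → ι → ℝ) (S : Set (EigSolver × D → ℝ)) (W : ℕ)
    (f : EigSolver × D → ℝ) (a : ℕ) : Prop := Computes inp S f (a * W)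

theorem MatWithin.of_subset {m n : Type*} {A : EigSolver × D → Matrix m n ℝ}
    (h : entries A ⊆ S) : MatWithin inp S W A 0 := (Derives.of_subset h).le (by simp)

theorem NumWithin.of_mem {f : EigSolver × D → ℝ} (h : f ∈ S) : NumWithin inp S W f 0 :=
  (Computes.of_mem h).le (by simp)

section Mat

variable {k m n : Type*} [Fintype k] [Fintype m] [Fintype n]

theorem MatWithin.mul {A : EigSolver × D → Matrix m k ℝ} {B : EigSolver × D → Matrix k n ℝ}
    (hA : MatWithin inp S W A a) (hB : MatWithin inp S W B b)
    (h : Fintype.card m * Fintype.card n * Fintype.card k ≤ W) :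
    MatWithin inp S W (fun ω => A ω * B ω) (a + b + 2) :=
  (Derives.entries_mul hA hB).le (by rw [← mul_assoc]; nlinarith)

theorem MatWithin.add {A B : EigSolver × D → Matrix m n ℝ}
    (hA : MatWithin inp S W A a) (hB : MatWithin inp S W B b)
    (h : Fintype.card m * Fintype.card n ≤ W) :
    MatWithin inp S W (fun ω => A ω + B ω) (a + b + 1) :=
  (Derives.entries_add hA hB).le (by nlinarith)

theorem MatWithin.sub {A B : EigSolver × D → Matrix m n ℝ}
    (hA : MatWithin inp S W A a) (hB : MatWithin inp S W B b)
    (h : Fintype.card m * Fintype.card n ≤ W) :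
    MatWithin inp S W (fun ω => A ω - B ω) (a + b + 1) :=
  (Derives.entries_sub hA hB).le (by nlinarith)

theorem MatWithin.smul {f : EigSolver × D → ℝ} {A : EigSolver × D → Matrix m n ℝ}
    (hf : NumWithin inp S W f a) (hA : MatWithin inp S W A b)
    (h : Fintype.card m * Fintype.card n ≤ W) :
    MatWithin inp S W (fun ω => f ω • A ω) (a + b + 1) :=
  (Derives.entries_smul hf hA).le (by nlinarith)

theorem NumWithin.trace {A B : EigSolver × D → Matrix m n ℝ}
    (hA : MatWithin inp S W A a) (hB : MatWithin inp S W B b)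
    (h : Fintype.card m * Fintype.card n ≤ W) :
    NumWithin inp S W (fun ω => ((A ω)ᵀ * B ω).trace) (a + b + 2) :=
  (Computes.trace_transpose_mul hA hB).le (by nlinarith)

theorem MatWithin.sparse_mul {A : EigSolver × D → Matrix m k ℝ} {B : EigSolver × D → Matrix k n ℝ}
    (pat : Finset (m × k)) (hpat : ∀ ω i j, (i, j) ∉ pat → A ω i j = 0)
    (hA : entriesOn pat A ⊆ S) (hB : MatWithin inp S W B b)
    (h : Fintype.card n * pat.card ≤ W) :
    MatWithin inp S W (fun ω => A ω * B ω) (b + 2) :=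
  (Derives.sparse_mul pat hpat (Derives.of_subset hA) hB).le (by nlinarith)

theorem MatWithin.sparse_transpose_mul {A : EigSolver × D → Matrix k m ℝ}
    {B : EigSolver × D → Matrix k n ℝ} (pat : Finset (k × m))
    (hpat : ∀ ω i j, (i, j) ∉ pat → A ω i j = 0)
    (hA : entriesOn pat A ⊆ S) (hB : MatWithin inp S W B b)
    (h : Fintype.card n * pat.card ≤ W) :
    MatWithin inp S W (fun ω => (A ω)ᵀ * B ω) (b + 2) :=
  MatWithin.sparse_mul (pat.map (Equiv.prodComm k m).toEmbedding)
    (fun ω i j hij => hpat ω j i fun h' => hij (by simpa using h'))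
    ((entriesOn_swap pat A).trans hA) hB (by simpa using h)

end Mat

/-- The `11` budgets are one for the spectral decomposition, two for each of the four products and
two for the entrywise division. -/
theorem MatWithin.lyapunov {p : ℕ} {K R : EigSolver × D → Matrix (Fin p) (Fin p) ℝ} (hK : MatWithin inp S W K a)
    (hR : MatWithin inp S W R b)
    (hpp : p * p ≤ W) (hppp : p * p * p ≤ W) :
    MatWithin inp S W (fun ω => lyapunovSol (ω.1.vec p (K ω)) (ω.1.val p (K ω)) (R ω))
      (a + b + 11) := by
  refine (Derives.trans (Derives.eig hK) (b := (b + 10) * W) ?_).le ?_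
  · have hV : MatWithin inp (S ∪ ((entries fun ω : EigSolver × D => ω.1.vec p (K ω)) ∪
        Set.range fun (i : Fin p) (ω : EigSolver × D) => ω.1.val p (K ω) i)) W
        (fun ω => ω.1.vec p (K ω)) 0 := MatWithin.of_subset fun f hf => Or.inr (Or.inl hf)
    have hR' := Derives.mono hR (Set.subset_union_left (t := ((entries fun ω : EigSolver × D =>
      ω.1.vec p (K ω)) ∪ Set.range fun (i : Fin p) (ω : EigSolver × D) => ω.1.val p (K ω) i)))
      subset_rfl le_rfl
    have h1 := (MatWithin.mul (MatWithin.mul hV.entries_transpose hR' (by simpa using hppp)) hV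
      (by simpa using hppp))
    have h2 : MatWithin inp (S ∪ ((entries fun ω : EigSolver × D => ω.1.vec p (K ω)) ∪
        Set.range fun (i : Fin p) (ω : EigSolver × D) => ω.1.val p (K ω) i)) W (fun ω => (Matrix.of fun i j =>
        ((ω.1.vec p (K ω))ᵀ * R ω * ω.1.vec p (K ω)) i j /
          (ω.1.val p (K ω) i + ω.1.val p (K ω) j) : Matrix (Fin p) (Fin p) ℝ)) (b + 6) := by
      refine (Derives.trans h1 (Derives.entries_of_const (c := 2) fun i j => ?_)).le ?_
      · refine ((Computes.of_mem (Or.inr (mem_entries _ i j))).div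
          (((Computes.of_mem (Or.inl (Or.inr (Or.inr ⟨i, rfl⟩)))).add
            (Computes.of_mem (Or.inl (Or.inr (Or.inr ⟨j, rfl⟩))))))).le (by simp)
      · simp only [Fintype.card_fin]; nlinarith
    exact (MatWithin.mul (MatWithin.mul hV h2 (by simpa using hppp)) hV.entries_transpose
      (by simpa using hppp)).le (Nat.mul_le_mul_right _ (by omega))
  · have : p ^ 3 ≤ W := by rw [pow_succ, pow_two]; exact hppp
    nlinarith

variable {f g u v : EigSolver × D → ℝ}

theorem NumWithin.add (hW : 1 ≤ W) (hf : NumWithin inp S W f a) (hg : NumWithin inp S W g b) :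
    NumWithin inp S W (fun ω => f ω + g ω) (a + b + 1) := (Computes.add hf hg).le (by nlinarith)

theorem NumWithin.mul (hW : 1 ≤ W) (hf : NumWithin inp S W f a) (hg : NumWithin inp S W g b) :
    NumWithin inp S W (fun ω => f ω * g ω) (a + b + 1) := (Computes.mul hf hg).le (by nlinarith)

theorem NumWithin.div (hW : 1 ≤ W) (hf : NumWithin inp S W f a) (hg : NumWithin inp S W g b) :
    NumWithin inp S W (fun ω => f ω / g ω) (a + b + 1) := (Computes.div hf hg).le (by nlinarith)

theorem NumWithin.select (hW : 1 ≤ W) (hf : NumWithin inp S W f a) (hg : NumWithin inp S W g b)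
    (hu : NumWithin inp S W u c) (hv : NumWithin inp S W v d) :
    NumWithin inp S W (fun ω => if f ω ≤ g ω then u ω else v ω) (a + b + (c + d) + 1) :=
  (Computes.select hf hg hu hv).le (by nlinarith)

end Budget

/-! ## Operations on one factor of the product manifold -/

/-- The data of one factor: a sparse matrix `X`, a regularization parameter and a triangular factor
`R` of the metric matrix are available, and the budget `W` covers the basic matrix operations. -/
structure Block {D ι : Type} (inp : D → ι → ℝ) (S : Set (EigSolver × D → ℝ)) (W n d p : ℕ) where
  X : EigSolver × D → Matrix (Fin n) (Fin d) ℝ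
  lam : EigSolver × D → ℝ
  R : EigSolver × D → Matrix (Fin d) (Fin d) ℝ
  pat : Finset (Fin n × Fin d)
  supp : ∀ ω i j, (i, j) ∉ pat → X ω i j = 0
  posUpper : ∀ ω, IsPosUpper (R ω)
  posB : ∀ ω, (regGram (X ω) (lam ω)).PosDef
  X_mem : entriesOn pat X ⊆ S
  lam_mem : lam ∈ S
  R_mem : entries R ⊆ S
  one_le : 1 ≤ W
  le_nnz : p * pat.card ≤ W
  le_dp : d * p ≤ W
  le_ddp : d * p * d ≤ W
  le_dpp : d * p * p ≤ W
  le_pp : p * p ≤ W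
  le_ppp : p * p * p ≤ W

namespace Block

variable {D ι : Type} {inp : D → ι → ℝ} {S : Set (EigSolver × D → ℝ)} {W n d p a b c : ℕ}

/-- The constraint matrix. -/
def B (Q : Block inp S W n d p) (ω : EigSolver × D) : Matrix (Fin d) (Fin d) ℝ :=
  regGram (Q.X ω) (Q.lam ω)

/-- The metric matrix. -/
def M (Q : Block inp S W n d p) (ω : EigSolver × D) : Matrix (Fin d) (Fin d) ℝ :=
  (Q.R ω)ᵀ * Q.R ω

variable (Q : Block inp S W n d p) {V Z ξ : EigSolver × D → Matrix (Fin d) (Fin p) ℝ}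

theorem M_posDef (ω : EigSolver × D) : (Q.M ω).PosDef :=
  posDef_of_isUnit_det (Q.posUpper ω).isUnit

theorem B_symm (ω : EigSolver × D) : (Q.B ω)ᵀ = Q.B ω := (Q.posB ω).isSymm

/-- The product is evaluated as `Xᵀ * (X * V) + lam • V`, so the Gram matrix is never formed and two
sparse products suffice. The cost of `V` is counted once per summand. -/
theorem apply_B (hV : MatWithin inp S W V a) :
    MatWithin inp S W (fun ω => Q.B ω * V ω) (2 * a + 6) := by
  have h1 := (hV.sparse_mul Q.pat Q.supp Q.X_mem (by simpa using Q.le_nnz)).sparse_transpose_mul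
    Q.pat Q.supp Q.X_mem (by simpa using Q.le_nnz)
  have h2 := (NumWithin.of_mem (inp := inp) (W := W) Q.lam_mem)
  have h3 := MatWithin.smul h2 hV (by simpa using Q.le_dp)
  refine ((h1.add h3 (by simpa using Q.le_dp)).entries_congr fun ω => ?_).le
    (Nat.mul_le_mul_right _ (by omega))
  simp [B, regGram, Matrix.add_mul, Matrix.mul_assoc]

theorem apply_R (hV : MatWithin inp S W V a) :
    MatWithin inp S W (fun ω => Q.R ω * V ω) (a + 2) :=
  ((MatWithin.of_subset Q.R_mem).mul hV (by simpa using Q.le_ddp)).le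
    (Nat.mul_le_mul_right _ (by omega))

/-- One forward and one backward substitution with the triangular factor, at most four budgets each.
-/
theorem apply_M_inv (hV : MatWithin inp S W V a) :
    MatWithin inp S W (fun ω => (Q.M ω)⁻¹ * V ω) (a + 8) := by
  have hcost : d * (Fintype.card (Fin p) * (d * 2 + 2)) ≤ 4 * W := by
    have h1 := Q.le_dp
    have h2 := Q.le_ddp
    rw [Fintype.card_fin]
    calc d * (p * (d * 2 + 2)) = 2 * (d * p * d) + 2 * (d * p) := by ring
      _ ≤ 4 * W := by omega
  have h1 := Derives.forward_solve (W := fun ω => Q.R ω * ((Q.M ω)⁻¹ * V ω)) Q.posUpper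
    (fun ω => by
      rw [← Matrix.mul_assoc, ← Matrix.mul_assoc]
      change Q.M ω * (Q.M ω)⁻¹ * V ω = V ω
      rw [Matrix.mul_nonsing_inv _ (Q.M_posDef ω).isUnit_det, Matrix.one_mul])
    (Derives.of_subset Q.R_mem) hV
  have h2 := Derives.backward_solve (W := fun ω => (Q.M ω)⁻¹ * V ω) Q.posUpper
    (fun ω => rfl) (Derives.of_subset Q.R_mem) h1
  exact h2.le (by rw [add_mul]; omega)

/-- The multiplier of the orthogonal projection. -/
def multiplier (Z ξ : EigSolver × D → Matrix (Fin d) (Fin p) ℝ) (ω : EigSolver × D) :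
    Matrix (Fin p) (Fin p) ℝ :=
  lyapunovSol (ω.1.vec p (normalMat (Q.B ω) (Q.M ω) (Z ω)))
    (ω.1.val p (normalMat (Q.B ω) (Q.M ω) (Z ω))) (normalRhs (Q.B ω) (Z ω) (ξ ω))

/-- Any orthogonal diagonalization of the positive definite `normalMat` will do, so the outcome does
not depend on the solver. -/
theorem multiplier_spec {ω : EigSolver × D} (hZ : (Z ω)ᵀ * Q.B ω * Z ω = 1) :
    normalMat (Q.B ω) (Q.M ω) (Z ω) * Q.multiplier Z ξ ω +
      Q.multiplier Z ξ ω * normalMat (Q.B ω) (Q.M ω) (Z ω) = normalRhs (Q.B ω) (Z ω) (ξ ω) ∧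
    (Q.multiplier Z ξ ω)ᵀ = Q.multiplier Z ξ ω := by
  have hK := normalMat_posDef (Q.M_posDef ω) hZ
  have hV := ω.1.orthogonal p _ hK.isSymm
  have hs := ω.1.spectral p _ hK.isSymm
  have hw := hs ▸ hK
  rw [← hs] at hw
  have hw' := (posDef_diagonalize hV).1 (hs ▸ hK)
  have h := lyapunovSol_spec hV hw' (normalRhs (Q.B ω) (Z ω) (ξ ω))
  rw [← hs] at h
  exact ⟨h, lyapunov_symm hK (normalRhs_symm _ _ _) h⟩

theorem projection (hZ : MatWithin inp S W Z a) (hξ : MatWithin inp S W ξ b) :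
    MatWithin inp S W (fun ω => ξ ω - (Q.M ω)⁻¹ * (Q.B ω * Z ω) * Q.multiplier Z ξ ω)
      (10 * a + 3 * b + 70) := by
  have hdp : Fintype.card (Fin d) * Fintype.card (Fin p) ≤ W := by simpa using Q.le_dp
  have hdpp : Fintype.card (Fin d) * Fintype.card (Fin p) * Fintype.card (Fin p) ≤ W := by
    simpa using Q.le_dpp
  have hppd : Fintype.card (Fin p) * Fintype.card (Fin p) * Fintype.card (Fin d) ≤ W := by
    have := Q.le_dpp
    simp only [Fintype.card_fin]; linarith [mul_comm (p * p) d, mul_assoc d p p]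
  have hpp : Fintype.card (Fin p) * Fintype.card (Fin p) ≤ W := by simpa using Q.le_pp
  have hBZ := Q.apply_B hZ
  have hN := Q.apply_M_inv hBZ
  have hK : MatWithin inp S W (fun ω => normalMat (Q.B ω) (Q.M ω) (Z ω)) _ :=
    MatWithin.mul hBZ.entries_transpose hN hppd
  have hR : MatWithin inp S W (fun ω => normalRhs (Q.B ω) (Z ω) (ξ ω)) _ :=
    MatWithin.add (MatWithin.mul hBZ.entries_transpose hξ hppd)
      (MatWithin.mul hξ.entries_transpose hBZ hppd) hpp
  have hS := MatWithin.lyapunov hK hR Q.le_pp Q.le_ppp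
  exact (MatWithin.sub hξ (MatWithin.mul hN hS hdpp) hdp).le (Nat.mul_le_mul_right _ (by omega))

theorem inner (hZ : MatWithin inp S W Z a) (hξ : MatWithin inp S W ξ b) :
    NumWithin inp S W (fun ω => ((Z ω)ᵀ * Q.M ω * ξ ω).trace) (a + b + 6) := by
  refine ((NumWithin.trace (Q.apply_R hZ) (Q.apply_R hξ) (by simpa using Q.le_dp)).congr
    fun ω => ?_).le (Nat.mul_le_mul_right _ (by omega))
  simp [M, Matrix.mul_assoc]

/-- The inverse square root is that of a `p × p` matrix and comes from its spectral decomposition.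
-/
theorem retract_polar (hZ : MatWithin inp S W Z a) (hξ : MatWithin inp S W ξ b) :
    MatWithin inp S W (fun ω => retractSt .polar (Q.B ω) (Z ω) (ξ ω)) (a + 4 * b + 40) := by
  have hdp : Fintype.card (Fin d) * Fintype.card (Fin p) ≤ W := by simpa using Q.le_dp
  have hdpp : Fintype.card (Fin d) * Fintype.card (Fin p) * Fintype.card (Fin p) ≤ W := by
    simpa using Q.le_dpp
  have hppd : Fintype.card (Fin p) * Fintype.card (Fin p) * Fintype.card (Fin d) ≤ W := by
    have := Q.le_dpp
    simp only [Fintype.card_fin]; linarith [mul_comm (p * p) d, mul_assoc d p p]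
  have hpp := Q.le_pp
  have hppp := Q.le_ppp
  have hone : MatWithin inp S W (fun _ => (1 : Matrix (Fin p) (Fin p) ℝ)) 1 := by
    refine (Derives.entries_of_const (c := 1) fun i j =>
      (Computes.const (if i = j then 1 else 0)).congr fun ω => ?_).le (by simpa using hpp)
    rw [Matrix.one_apply]; split_ifs <;> simp
  have hA := MatWithin.add hone (MatWithin.mul hξ.entries_transpose (Q.apply_B hξ) hppd)
    (by simpa using hpp)
  set A : EigSolver × D → Matrix (Fin p) (Fin p) ℝ :=
    fun ω => 1 + (ξ ω)ᵀ * (Q.B ω * ξ ω) with hAdef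
  have hApos : ∀ ω, (A ω).PosDef := fun ω => by
    have := posDef_one_add (Q.posB ω) (ξ ω)
    rw [Matrix.mul_assoc] at this
    exact this
  have hinv : MatWithin inp S W (fun ω => (spdSqrt (A ω))⁻¹) (3 * b + 21) := by
    refine (Derives.trans (Derives.eig hA) (b := 7 * W) ?_).le ?_
    · have hV : MatWithin inp (S ∪ ((entries fun ω : EigSolver × D => ω.1.vec p (A ω)) ∪
          Set.range fun (i : Fin p) (ω : EigSolver × D) => ω.1.val p (A ω) i)) W
          (fun ω => ω.1.vec p (A ω)) 0 := MatWithin.of_subset fun f hf => Or.inr (Or.inl hf)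
      have h1 : MatWithin inp (S ∪ ((entries fun ω : EigSolver × D => ω.1.vec p (A ω)) ∪
          Set.range fun (i : Fin p) (ω : EigSolver × D) => ω.1.val p (A ω) i)) W (fun ω =>
          Matrix.diagonal fun i => 1 / √(ω.1.val p (A ω) i)) 3 := by
        refine (Derives.entries_of_const (c := 3) fun i j => ?_).le
          (by simp only [Fintype.card_fin]; omega)
        by_cases hij : i = j
        · subst hij
          exact (((Computes.const 1).div (Computes.of_mem
            (f := fun ω : EigSolver × D => ω.1.val p (A ω) i) (Or.inr (Or.inr ⟨i, rfl⟩))).sqrt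
            ).congr fun ω => by simp).le (by simp)
        · exact (Computes.zero.congr fun ω => by simp [hij]).le (by simp)
      refine (Derives.entries_congr (MatWithin.mul (MatWithin.mul hV h1 (by simpa using hppp))
        hV.entries_transpose (by simpa using hppp)) fun ω => ?_).le
        (Nat.mul_le_mul_right _ (by omega))
      have ho := ω.1.orthogonal p _ (hApos ω).isSymm
      have hs := ω.1.spectral p _ (hApos ω).isSymm
      conv_rhs => rw [hs]
      exact (spdSqrt_inv_diagonalize ho ((posDef_diagonalize ho).1 (hs ▸ hApos ω))).symm
    · have : p ^ 3 ≤ W := by rw [pow_succ, pow_two]; exact hppp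
      nlinarith
  refine (Derives.entries_congr (MatWithin.mul (MatWithin.add hZ hξ hdp) hinv hdpp)
    fun ω => ?_).le (Nat.mul_le_mul_right _ (by omega))
  simp only [retractSt, hAdef, Matrix.mul_assoc]

/-- With `Q` the new point, `Q * R = Z + ξ` transposes to the lower triangular system `Rᵀ * Qᵀ = (Z
+ ξ)ᵀ`, which forward substitution solves once the Cholesky factor `R` is known. -/
theorem retract_qr (hZ : MatWithin inp S W Z a) (hξ : MatWithin inp S W ξ b)
    (hC : ∀ ω, ((Z ω + ξ ω)ᵀ * Q.B ω * (Z ω + ξ ω)).PosDef) :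
    MatWithin inp S W (fun ω => retractSt .qr (Q.B ω) (Z ω) (ξ ω)) (4 * a + 4 * b + 40) := by
  have hdp : Fintype.card (Fin d) * Fintype.card (Fin p) ≤ W := by simpa using Q.le_dp
  have hppd : Fintype.card (Fin p) * Fintype.card (Fin p) * Fintype.card (Fin d) ≤ W := by
    have := Q.le_dpp
    simp only [Fintype.card_fin]; linarith [mul_comm (p * p) d, mul_assoc d p p]
  have hpp := Q.le_pp
  have hppp := Q.le_ppp
  have hdpp := Q.le_dpp
  have hdp' := Q.le_dp
  choose R hR hRR hY using fun ω => retractSt_qr_spec (Q.posB ω) (hC ω)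
  have h1 := MatWithin.add hZ hξ hdp
  have h2 := MatWithin.mul h1.entries_transpose (Q.apply_B h1) hppd
  have h3 : MatWithin inp S W R (3 * a + 3 * b + 19) := by
    refine (Derives.cholesky_factor hR (fun ω => ?_) h2).le ?_
    · rw [hRR, Matrix.mul_assoc]; rfl
    · have : p * (p * 2 + 2 + p * (p * 2 + 2)) ≤ 8 * W := by
        have : p ≤ p * p := Nat.le_mul_self p
        nlinarith
      nlinarith
  have h4 : MatWithin inp S W (fun ω => (retractSt .qr (Q.B ω) (Z ω) (ξ ω))ᵀ)
      (4 * a + 4 * b + 40) := by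
    refine (Derives.forward_solve hR (fun ω => ?_) h3 h1.entries_transpose).le ?_
    · rw [← Matrix.transpose_mul]
      exact congrArg Matrix.transpose (hY ω)
    · rw [Fintype.card_fin]
      have : p * (d * (p * 2 + 2)) = 2 * (d * p * p) + 2 * (d * p) := by ring
      nlinarith
  exact h4.entries_transpose.entries_congr fun ω => Matrix.transpose_transpose _

end Block

/-! ## One iteration of the conjugate gradient method -/

/-- A pair of matrices can be computed at cost `a * W` each. -/
def PairWithin {D ι : Type} (inp : D → ι → ℝ) (S : Set (EigSolver × D → ℝ)) (W : ℕ) {dx dy p : ℕ}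
    (Z : EigSolver × D → Pt dx dy p) (a : ℕ) : Prop :=
  MatWithin inp S W (fun ω => (Z ω).1) a ∧ MatWithin inp S W (fun ω => (Z ω).2) a

section Iteration

variable {D ι : Type} {inp : D → ι → ℝ} {S : Set (EigSolver × D → ℝ)}
  {W n dx dy p a b c : ℕ}

theorem NumWithin.weaken {f : EigSolver × D → ℝ} (h : NumWithin inp S W f a) (hab : a ≤ b) :
    NumWithin inp S W f b := h.le (Nat.mul_le_mul_right _ hab)

theorem PairWithin.le {Z : EigSolver × D → Pt dx dy p} (h : PairWithin inp S W Z a)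
    (hab : a ≤ b) : PairWithin inp S W Z b :=
  ⟨h.1.le (Nat.mul_le_mul_right _ hab), h.2.le (Nat.mul_le_mul_right _ hab)⟩

theorem PairWithin.congr {Z Z' : EigSolver × D → Pt dx dy p} (h : PairWithin inp S W Z a)
    (hZ : ∀ ω, Z ω = Z' ω) : PairWithin inp S W Z' a := by rwa [← funext hZ]

variable (QX : Block inp S W n dx p) (QY : Block inp S W n dy p) (mu : EigSolver × D → Fin p → ℝ)
  {Z ξ η : EigSolver × D → Pt dx dy p}

/-- The geometry given by two blocks. -/
def blockGeometry (ω : EigSolver × D) : Geometry dx dy := ⟨QX.B ω, QY.B ω, QX.M ω, QY.M ω⟩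

/-- The CCA problem given by two blocks. -/
def blockProblem (ω : EigSolver × D) : CCAProblem n dx dy p :=
  ⟨QX.X ω, QY.X ω, QX.lam ω, QY.lam ω, mu ω⟩

theorem PairWithin.add (QX : Block inp S W n dx p) (QY : Block inp S W n dy p)
    (h : PairWithin inp S W Z a) (h' : PairWithin inp S W ξ b) :
    PairWithin inp S W (fun ω => Z ω + ξ ω) (a + b + 1) :=
  ⟨MatWithin.add h.1 h'.1 (by simpa using QX.le_dp),
    MatWithin.add h.2 h'.2 (by simpa using QY.le_dp)⟩

theorem PairWithin.sub (QX : Block inp S W n dx p) (QY : Block inp S W n dy p)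
    (h : PairWithin inp S W Z a) (h' : PairWithin inp S W ξ b) :
    PairWithin inp S W (fun ω => Z ω - ξ ω) (a + b + 1) :=
  ⟨MatWithin.sub h.1 h'.1 (by simpa using QX.le_dp),
    MatWithin.sub h.2 h'.2 (by simpa using QY.le_dp)⟩

theorem PairWithin.smul (QX : Block inp S W n dx p) (QY : Block inp S W n dy p)
    {t : EigSolver × D → ℝ} (ht : NumWithin inp S W t a)
    (h : PairWithin inp S W Z b) : PairWithin inp S W (fun ω => t ω • Z ω) (a + b + 1) :=
  ⟨MatWithin.smul ht h.1 (by simpa using QX.le_dp),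
    MatWithin.smul ht h.2 (by simpa using QY.le_dp)⟩

theorem PairWithin.neg (QX : Block inp S W n dx p) (QY : Block inp S W n dy p)
    (h : PairWithin inp S W Z a) :
    PairWithin inp S W (fun ω => -Z ω) (a + 1) := by
  have hx := QX.le_dp
  have hy := QY.le_dp
  refine ⟨(Derives.trans h.1 (Derives.entries_of_const (c := 1) fun i j =>
      ((Computes.zero.sub (Computes.of_mem (Or.inr (mem_entries _ i j)))).congr
        fun ω => ?_).le (by simp))).le ?_,
    (Derives.trans h.2 (Derives.entries_of_const (c := 1) fun i j =>
      ((Computes.zero.sub (Computes.of_mem (Or.inr (mem_entries _ i j)))).congr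
        fun ω => ?_).le (by simp))).le ?_⟩
  · simp
  · simp only [Fintype.card_fin]; nlinarith
  · simp
  · simp only [Fintype.card_fin]; nlinarith

theorem MatWithin.neg_mul_diagonal {d : ℕ} {mu : EigSolver × D → Fin p → ℝ}
    (hmu : ∀ j, (fun ω => mu ω j) ∈ S)
    {A : EigSolver × D → Matrix (Fin d) (Fin p) ℝ} (hA : MatWithin inp S W A a)
    (h : d * p ≤ W) :
    MatWithin inp S W (fun ω => -(A ω * Matrix.diagonal (mu ω))) (a + 2) := by
  refine (Derives.trans hA (Derives.entries_of_const (c := 2) fun i j =>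
    ((Computes.zero.sub ((Computes.of_mem (Or.inr (mem_entries _ i j))).mul
      (Computes.of_mem (Or.inl (hmu j))))).congr fun ω => ?_).le (by simp))).le ?_
  · simp [Matrix.mul_diagonal]
  · simp only [Fintype.card_fin]; nlinarith

variable {mu}

theorem PairWithin.euclGrad (hmu : ∀ j, (fun ω => mu ω j) ∈ S)
    (h : PairWithin inp S W Z a) :
    PairWithin inp S W (fun ω => Geometry.euclGrad (blockProblem QX QY mu ω).cost (Z ω))
      (a + 6) := by
  have h1 := (h.2.sparse_mul QY.pat QY.supp QY.X_mem
    (by simpa using QY.le_nnz)).sparse_transpose_mul QX.pat QX.supp QX.X_mem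
    (by simpa using QX.le_nnz)
  have h2 := (h.1.sparse_mul QX.pat QX.supp QX.X_mem
    (by simpa using QX.le_nnz)).sparse_transpose_mul QY.pat QY.supp QY.X_mem
    (by simpa using QY.le_nnz)
  refine PairWithin.congr (Z := fun ω => (-((QX.X ω)ᵀ * (QY.X ω * (Z ω).2) *
      Matrix.diagonal (mu ω)), -((QY.X ω)ᵀ * (QX.X ω * (Z ω).1) * Matrix.diagonal (mu ω))))
    ⟨MatWithin.neg_mul_diagonal hmu h1 QX.le_dp, MatWithin.neg_mul_diagonal hmu h2 QY.le_dp⟩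
    fun ω => ?_
  rw [CCAProblem.euclGrad_cost]
  simp [CCAProblem.Sxy, CCAProblem.N, blockProblem, Matrix.mul_assoc]

/-- The cost is linear in the first block, hence equals the pairing of that block with its own
partial gradient. -/
theorem NumWithin.cost (hmu : ∀ j, (fun ω => mu ω j) ∈ S)
    (h : PairWithin inp S W Z a) :
    NumWithin inp S W (fun ω => (blockProblem QX QY mu ω).cost (Z ω)) (2 * a + 8) := by
  refine NumWithin.weaken ((NumWithin.trace h.1 (PairWithin.euclGrad QX QY hmu h).1
    (by simpa using QX.le_dp)).congr fun ω => ?_) (by omega)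
  beta_reduce
  rw [CCAProblem.euclGrad_cost, CCAProblem.cost_eq, Matrix.mul_neg, Matrix.trace_neg]

theorem NumWithin.inner (h : PairWithin inp S W Z a) (h' : PairWithin inp S W ξ b) :
    NumWithin inp S W (fun ω => (blockGeometry QX QY ω).inner (Z ω) (ξ ω))
      (2 * a + 2 * b + 13) :=
  (NumWithin.add QX.one_le (QX.inner h.1 h'.1) (QY.inner h.2 h'.2)).weaken (by omega)

theorem PairWithin.proj (hZm : ∀ ω, Z ω ∈ (blockGeometry QX QY ω).manifold p)
    (h : PairWithin inp S W Z a) (h' : PairWithin inp S W ξ b) :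
    PairWithin inp S W (fun ω => (blockGeometry QX QY ω).proj (Z ω) (ξ ω))
      (10 * a + 3 * b + 70) := by
  refine PairWithin.congr (Z := fun ω => (_, _))
    ⟨QX.projection h.1 h'.1, QY.projection h.2 h'.2⟩ fun ω => ?_
  have hx := QX.multiplier_spec (Z := fun ω => (Z ω).1) (ξ := fun ω => (ξ ω).1) (hZm ω).1
  have hy := QY.multiplier_spec (Z := fun ω => (Z ω).2) (ξ := fun ω => (ξ ω).2) (hZm ω).2
  exact (Geometry.proj_eq_of_normal (G := blockGeometry QX QY ω) (QX.M_posDef ω) (QY.M_posDef ω)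
    (QX.B_symm ω) (QY.B_symm ω) hx.2 hy.2 hx.1 hy.1).symm

theorem PairWithin.grad (hmu : ∀ j, (fun ω => mu ω j) ∈ S)
    (hZm : ∀ ω, Z ω ∈ (blockGeometry QX QY ω).manifold p)
    (h : PairWithin inp S W Z a) :
    PairWithin inp S W (fun ω => (blockGeometry QX QY ω).grad (blockProblem QX QY mu ω).cost (Z ω))
      (13 * a + 112) := by
  have h1 := PairWithin.euclGrad QX QY hmu h
  refine (PairWithin.proj QX QY hZm h (ξ := fun ω => ((blockGeometry QX QY ω).M1⁻¹ *
    (Geometry.euclGrad (blockProblem QX QY mu ω).cost (Z ω)).1, (blockGeometry QX QY ω).M2⁻¹ *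
    (Geometry.euclGrad (blockProblem QX QY mu ω).cost (Z ω)).2))
    ⟨QX.apply_M_inv h1.1, QY.apply_M_inv h1.2⟩).le (by omega)

theorem PairWithin.retract (k : RetractionKind)
    (hZm : ∀ ω, Z ω ∈ (blockGeometry QX QY ω).manifold p)
    (hξ : ∀ ω, ξ ω ∈ (blockGeometry QX QY ω).tangent (Z ω))
    (h : PairWithin inp S W Z a) (h' : PairWithin inp S W ξ b) :
    PairWithin inp S W (fun ω => (blockGeometry QX QY ω).retract k (Z ω) (ξ ω))
      (4 * a + 4 * b + 40) := by
  cases k with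
  | polar =>
    exact ⟨(QX.retract_polar h.1 h'.1).le (Nat.mul_le_mul_right _ (by omega)),
      (QY.retract_polar h.2 h'.2).le (Nat.mul_le_mul_right _ (by omega))⟩
  | qr =>
    refine ⟨QX.retract_qr h.1 h'.1 fun ω => ?_, QY.retract_qr h.2 h'.2 fun ω => ?_⟩
    · have e : ((Z ω).1 + (ξ ω).1)ᵀ * QX.B ω * ((Z ω).1 + (ξ ω).1) = _ :=
        gram_of_tangent (hZm ω).1 (hξ ω).1
      rw [e]
      exact posDef_one_add (QX.posB ω) _
    · have e : ((Z ω).2 + (ξ ω).2)ᵀ * QY.B ω * ((Z ω).2 + (ξ ω).2) = _ :=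
        gram_of_tangent (hZm ω).2 (hξ ω).2
      rw [e]
      exact posDef_one_add (QY.posB ω) _

theorem retract_mem_manifold (k : RetractionKind) {ω : EigSolver × D} {Z ξ : Pt dx dy p}
    (hZm : Z ∈ (blockGeometry QX QY ω).manifold p)
    (hξ : ξ ∈ (blockGeometry QX QY ω).tangent Z) :
    (blockGeometry QX QY ω).retract k Z ξ ∈ (blockGeometry QX QY ω).manifold p :=
  ⟨retractSt_mem k (QX.posB ω) hZm.1 hξ.1, retractSt_mem k (QY.posB ω) hZm.2 hξ.2⟩

/-- Cost bound for a line search with at most `L` trial steps. -/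
def armijoCost : ℕ → ℕ → ℕ
  | 0, _ => 0
  | L + 1, a => 10 * a + 400 + armijoCost L (a + 1)

/-- The backtracking loop is unrolled into nested selections, so all `L` trials are evaluated. The
assumed budgets are those of the intended use: `8` for the cost at `Z`, `237 = 2 * 112 + 13` for the
slope, and `8 * a + 96 = 2 * (4 * a + 44) + 8` for the cost at a trial point. -/
theorem NumWithin.armijo (hW : 1 ≤ W) {φ : EigSolver × D → ℝ → ℝ}
    {f0 slope cc τ : EigSolver × D → ℝ}
    (hφ : ∀ (t : EigSolver × D → ℝ) (a : ℕ), NumWithin inp S W t a →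
      NumWithin inp S W (fun ω => φ ω (t ω)) (8 * a + 96))
    (hf0 : NumWithin inp S W f0 8) (hs : NumWithin inp S W slope 237)
    (hc : NumWithin inp S W cc 0) (hτ : NumWithin inp S W τ 0) (L : ℕ) :
    ∀ (t : EigSolver × D → ℝ) (a : ℕ), NumWithin inp S W t a →
      NumWithin inp S W (fun ω => SketchCCA.armijo (φ ω) (f0 ω) (slope ω) (cc ω) (τ ω) L (t ω))
        (armijoCost L a) := by
  induction L with
  | zero => exact fun t a _ => Computes.zero.le (by simp)
  | succ L ih =>
    intro t a ht
    have h1 := ih (fun ω => τ ω * t ω) (a + 1) ((hτ.mul hW ht).weaken (by omega))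
    refine (NumWithin.select hW (hφ t a ht) (hf0.add hW ((hc.mul hW ht).mul hW hs)) ht h1).weaken ?_
    simp only [armijoCost]
    omega

/-- Cost bound for the next iterate. -/
def nextCost (L : ℕ) : ℕ := 4 * armijoCost L 0 + 44

theorem tangent_smul_mem {G : Geometry dx dy} {Z ξ : Pt dx dy p} (h : ξ ∈ G.tangent Z) (t : ℝ) :
    t • ξ ∈ G.tangent Z := ⟨tangent_smul h.1 t, tangent_smul h.2 t⟩

theorem rcgStep_within (hmu : ∀ j, (fun ω => mu ω j) ∈ S)
    (k : RetractionKind) (rule : BetaRule) (L : ℕ)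
    {t0 τ cc : EigSolver × D → ℝ} (hZm : ∀ ω, Z ω ∈ (blockGeometry QX QY ω).manifold p)
    (hη : ∀ ω, η ω ∈ (blockGeometry QX QY ω).tangent (Z ω))
    (h : PairWithin inp S W Z 0) (h' : PairWithin inp S W η 0) (ht0 : NumWithin inp S W t0 0)
    (hτ : NumWithin inp S W τ 0) (hc : NumWithin inp S W cc 0) :
    PairWithin inp S W (fun ω => (rcgStep (blockGeometry QX QY ω) (blockProblem QX QY mu ω).cost
      k rule L (t0 ω) (τ ω) (cc ω) (Z ω) (η ω)).1) (nextCost L) ∧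
    PairWithin inp S W (fun ω => (rcgStep (blockGeometry QX QY ω) (blockProblem QX QY mu ω).cost
      k rule L (t0 ω) (τ ω) (cc ω) (Z ω) (η ω)).2) (300 * nextCost L + 6000) := by
  have hW := QX.one_le
  set G := blockGeometry QX QY with hG
  set f := fun ω => (blockProblem QX QY mu ω).cost with hf
  have hgr : PairWithin inp S W (fun ω => (G ω).grad (f ω) (Z ω)) 112 :=
    PairWithin.grad QX QY hmu hZm h
  have hf0 : NumWithin inp S W (fun ω => f ω (Z ω)) 8 := NumWithin.cost QX QY hmu h
  have hslope : NumWithin inp S W (fun ω => (G ω).inner ((G ω).grad (f ω) (Z ω)) (η ω)) 237 :=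
    NumWithin.inner QX QY hgr h'
  have hret : ∀ (t : EigSolver × D → ℝ) (a : ℕ), NumWithin inp S W t a →
      PairWithin inp S W (fun ω => (G ω).retract k (Z ω) (t ω • η ω)) (4 * a + 44) :=
    fun t a ht => (PairWithin.retract QX QY k hZm (fun ω => tangent_smul_mem (hη ω) (t ω)) h
      (PairWithin.smul QX QY ht h')).le (by omega)
  set α : EigSolver × D → ℝ := fun ω => armijo (fun t => f ω ((G ω).retract k (Z ω) (t • η ω)))
    (f ω (Z ω)) ((G ω).inner ((G ω).grad (f ω) (Z ω)) (η ω)) (cc ω) (τ ω) L (t0 ω) with hα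
  have hαc : NumWithin inp S W α (armijoCost L 0) :=
    NumWithin.armijo hW (fun t a ht => (NumWithin.cost QX QY hmu (hret t a ht)).weaken (by omega))
      hf0 hslope hc hτ L t0 0 ht0
  set Z' : EigSolver × D → Pt dx dy p := fun ω => (G ω).retract k (Z ω) (α ω • η ω) with hZ'
  have hZ'c : PairWithin inp S W Z' (nextCost L) := hret α _ hαc
  -- The new point must lie on the manifold, also when every trial is rejected and `α ω = 0`, since
  -- the projection there is computed from the normal equations.
  have hZ'm : ∀ ω, Z' ω ∈ (G ω).manifold p := fun ω =>
    retract_mem_manifold QX QY k (hZm ω) (tangent_smul_mem (hη ω) (α ω))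
  refine ⟨hZ'c, ?_⟩
  set B := nextCost L
  have hgr' := PairWithin.grad QX QY hmu hZ'm hZ'c
  have htrGr := PairWithin.proj QX QY hZ'm hZ'c hgr
  have htrEta := PairWithin.proj QX QY hZ'm hZ'c h'
  have hβ : NumWithin inp S W (fun ω => betaCoeff (G ω) rule ((G ω).grad (f ω) (Z ω))
      ((G ω).grad (f ω) (Z' ω)) ((G ω).proj (Z' ω) ((G ω).grad (f ω) (Z ω)))
      ((G ω).proj (Z' ω) (η ω))) (200 * B + 5000) := by
    have hd := PairWithin.sub QX QY hgr' htrGr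
    cases rule with
    | fletcherReeves =>
      exact ((NumWithin.inner QX QY hgr' hgr').div hW (NumWithin.inner QX QY hgr hgr)).weaken
        (by omega)
    | polakRibiere =>
      exact ((NumWithin.inner QX QY hgr' hd).div hW (NumWithin.inner QX QY hgr hgr)).weaken
        (by omega)
    | hestenesStiefel =>
      exact ((NumWithin.inner QX QY hgr' hd).div hW (NumWithin.inner QX QY htrEta hd)).weaken
        (by omega)
  exact (PairWithin.add QX QY (PairWithin.neg QX QY hgr') (PairWithin.smul QX QY hβ htrEta)).le
    (by omega)

end Iteration

/-! ### The three computational tasks: iteration, factorization, sketching. -/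

section Tasks

variable {n dx dy s p : ℕ} {PX : Finset (Fin n × Fin dx)} {PY : Finset (Fin n × Fin dy)}
  {h : Fin n → Fin s} {g : Fin n → ℤˣ}

theorem computable_of_matrices {D ι o : Type} {inp : D → ι → ℝ} {out : D → o → ℝ}
    {T : Set (EigSolver × D → ℝ)} {c : ℕ}
    (hd : Derives inp (Set.range fun i : ι => fun ω => inp ω.2 i) T c)
    (hT : ∀ j, (fun ω : EigSolver × D => out ω.2 j) ∈ T) : ComputableWithin inp out c :=
  ComputableWithin.of_derives (hd.mono subset_rfl (by rintro _ ⟨j, rfl⟩; exact hT j) le_rfl)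

theorem iteration_computable (k : RetractionKind) (rule : BetaRule) (L : ℕ) (hp : p ≤ dx + dy) :
    ComputableWithin (IterInput.read (p := p) (PX := PX) (PY := PY) (h := h) (g := g))
      (IterInput.result k rule L) ((2 * nextCost L + 2 * (300 * nextCost L + 6000)) *
        (p * (PX.card + PY.card) + (dx + dy) * p ^ 2 + (dx + dy) ^ 2 * p)) := by
  set W := p * (PX.card + PY.card) + (dx + dy) * p ^ 2 + (dx + dy) ^ 2 * p with hWdef
  set S : Set (EigSolver × IterInput p PX PY h g → ℝ) :=
    Set.range fun i => fun ω => IterInput.read ω.2 i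
  have hmem : ∀ i, (fun ω : EigSolver × IterInput p PX PY h g => ω.2.read i) ∈ S :=
    fun i => ⟨i, rfl⟩
  -- For `p = 0` the budget is zero, but there is nothing to output. For `p ≥ 1` the budget
  -- dominates lower-order terms such as `d * p` and `p * p`.
  rcases Nat.eq_zero_or_pos p with rfl | hp0
  · refine ComputableWithin.of_derives ((Derives.of_subset ?_).le (Nat.zero_le _))
    rintro _ ⟨⟨b, e | e⟩, rfl⟩ <;> exact e.2.elim0
  have hW1 : p * p ≤ p * p * p := Nat.le_mul_of_pos_right _ hp0
  have hppp : p * p * p ≤ W := by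
    have : p * p * p ≤ (dx + dy) * p ^ 2 := by
      rw [pow_two, mul_assoc]; exact Nat.mul_le_mul_right _ hp
    omega
  have hpp : p * p ≤ W := hW1.trans hppp
  have h1W : 1 ≤ W := le_trans (Nat.mul_pos hp0 hp0) hpp
  have hsq : ∀ d, d ≤ dx + dy → d * p ≤ W ∧ d * p * d ≤ W ∧ d * p * p ≤ W := fun d hd => by
    have e1 : d * p * p ≤ (dx + dy) * p ^ 2 := by
      rw [pow_two, mul_assoc]; exact Nat.mul_le_mul_right _ hd
    have e2 : d * p * d ≤ (dx + dy) ^ 2 * p := by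
      rw [mul_right_comm, ← pow_two]
      exact Nat.mul_le_mul_right _ (Nat.pow_le_pow_left hd 2)
    have e3 : d * p ≤ d * p * p := Nat.le_mul_of_pos_right _ hp0
    omega
  have hx := hsq dx (by omega)
  have hy := hsq dy (by omega)
  let QX : Block (IterInput.read (p := p) (PX := PX) (PY := PY) (h := h) (g := g)) S W n dx p :=
    { X := fun ω => ω.2.P.X
      lam := fun ω => ω.2.P.lamX
      R := fun ω => cholesky (sketchedGeometry ω.2.P h g).M1
      pat := PX
      supp := fun ω => ω.2.suppX
      posUpper := fun ω => (cholesky_spec ω.2.posMX).1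
      posB := fun ω => ω.2.posX
      X_mem := by rintro _ ⟨e, he, rfl⟩; exact hmem (.x ⟨e, he⟩)
      lam_mem := hmem .lamX
      R_mem := by rintro _ ⟨e, rfl⟩; exact hmem (.rx e.1 e.2)
      one_le := h1W
      le_nnz := by rw [hWdef, mul_add]; omega
      le_dp := hx.1
      le_ddp := hx.2.1
      le_dpp := hx.2.2
      le_pp := hpp
      le_ppp := hppp }
  let QY : Block (IterInput.read (p := p) (PX := PX) (PY := PY) (h := h) (g := g)) S W n dy p :=
    { X := fun ω => ω.2.P.Y
      lam := fun ω => ω.2.P.lamY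
      R := fun ω => cholesky (sketchedGeometry ω.2.P h g).M2
      pat := PY
      supp := fun ω => ω.2.suppY
      posUpper := fun ω => (cholesky_spec ω.2.posMY).1
      posB := fun ω => ω.2.posY
      X_mem := by rintro _ ⟨e, he, rfl⟩; exact hmem (.y ⟨e, he⟩)
      lam_mem := hmem .lamY
      R_mem := by rintro _ ⟨e, rfl⟩; exact hmem (.ry e.1 e.2)
      one_le := h1W
      le_nnz := by rw [hWdef, mul_add]; omega
      le_dp := hy.1
      le_ddp := hy.2.1
      le_dpp := hy.2.2
      le_pp := hpp
      le_ppp := hppp }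
  -- The program sees the metric only through its Cholesky factors, and `Rᵀ * R` gives it back.
  have hG : ∀ ω, blockGeometry QX QY ω = sketchedGeometry ω.2.P h g := fun ω => by
    have e1 : QX.M ω = (sketchedGeometry ω.2.P h g).M1 := (cholesky_spec ω.2.posMX).2
    have e2 : QY.M ω = (sketchedGeometry ω.2.P h g).M2 := (cholesky_spec ω.2.posMY).2
    rw [blockGeometry, e1, e2]
    rfl
  obtain ⟨⟨h1, h2⟩, h3, h4⟩ := rcgStep_within QX QY (mu := fun ω => ω.2.P.mu)
    (fun j => hmem (.mu j)) k rule L (Z := fun ω => ω.2.Z) (η := fun ω => ω.2.η)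
    (t0 := fun ω => ω.2.t0) (τ := fun ω => ω.2.τ) (cc := fun ω => ω.2.c)
    (fun ω => by rw [hG]; exact ω.2.Z_mem) (fun ω => by rw [hG]; exact ω.2.η_mem)
    ⟨MatWithin.of_subset (by rintro _ ⟨e, rfl⟩; exact hmem (.u e.1 e.2)),
      MatWithin.of_subset (by rintro _ ⟨e, rfl⟩; exact hmem (.v e.1 e.2))⟩
    ⟨MatWithin.of_subset (by rintro _ ⟨e, rfl⟩; exact hmem (.etaU e.1 e.2)),
      MatWithin.of_subset (by rintro _ ⟨e, rfl⟩; exact hmem (.etaV e.1 e.2))⟩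
    (NumWithin.of_mem (hmem .t0)) (NumWithin.of_mem (hmem .τ)) (NumWithin.of_mem (hmem .c))
  simp only [hG] at h1 h2 h3 h4
  refine computable_of_matrices (((h1.union h2).union (h3.union h4)).le (by
    rw [← add_mul, ← add_mul, ← add_mul]; exact Nat.mul_le_mul_right _ (by omega))) ?_
  rintro ⟨_ | _, e | e⟩
  · exact Or.inr (Or.inl ⟨e, rfl⟩)
  · exact Or.inr (Or.inr ⟨e, rfl⟩)
  · exact Or.inl (Or.inl ⟨e, rfl⟩)
  · exact Or.inl (Or.inr ⟨e, rfl⟩)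

theorem MatWithin.regGram {D ι : Type} {inp : D → ι → ℝ} {S : Set (EigSolver × D → ℝ)} {W d : ℕ}
    {A : EigSolver × D → Matrix (Fin s) (Fin d) ℝ} {lam : EigSolver × D → ℝ}
    (hA : entries A ⊆ S) (hl : lam ∈ S) (h1 : d * d ≤ W) (h2 : d * d * s ≤ W) :
    MatWithin inp S W (fun ω => SketchCCA.regGram (A ω) (lam ω)) 5 := by
  have hA' : MatWithin inp S W A 0 := MatWithin.of_subset hA
  have hone : MatWithin inp S W (fun _ => (1 : Matrix (Fin d) (Fin d) ℝ)) 1 := by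
    refine (Derives.entries_of_const (c := 1) fun i j =>
      (Computes.const (if i = j then 1 else 0)).congr fun ω => ?_).le (by simpa using h1)
    rw [Matrix.one_apply]; split_ifs <;> simp
  exact (MatWithin.add (MatWithin.mul hA'.entries_transpose hA' (by simpa using h2))
    (MatWithin.smul (NumWithin.of_mem hl) hone (by simpa using h1)) (by simpa using h1))

theorem MatWithin.cholesky {D ι : Type} {inp : D → ι → ℝ} {S : Set (EigSolver × D → ℝ)}
    {W d a : ℕ} {A : EigSolver × D → Matrix (Fin d) (Fin d) ℝ} (hA : MatWithin inp S W A a)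
    (hpos : ∀ ω, (A ω).PosDef) (h1 : d * d ≤ W) (h2 : d * d * d ≤ W) :
    MatWithin inp S W (fun ω => SketchCCA.cholesky (A ω)) (a + 8) := by
  refine (Derives.cholesky_factor (fun ω => (cholesky_spec (hpos ω)).1)
    (fun ω => (cholesky_spec (hpos ω)).2) hA).le ?_
  have : d ≤ d * d := Nat.le_mul_self d
  nlinarith

/-- `26 = 2 * (5 + 8)`: for each of the two matrices, forming the regularized Gram matrix and
factoring it. The factorization costs `d ^ 3`, which `d ≤ s` absorbs into `s * d ^ 2`. -/
theorem factorization_computable (hs : dx + dy ≤ s) :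
    ComputableWithin (FactorInput.read (s := s) (dx := dx) (dy := dy)) FactorInput.result
      (26 * (s * (dx + dy) ^ 2 + (dx + dy) ^ 2)) := by
  set W := s * (dx + dy) ^ 2 + (dx + dy) ^ 2 with hW
  have hb : ∀ d, d ≤ dx + dy → d * d ≤ W ∧ d * d * s ≤ W ∧ d * d * d ≤ W := fun d hd => by
    have e1 : d * d ≤ (dx + dy) ^ 2 := by rw [pow_two]; exact Nat.mul_le_mul hd hd
    have e2 : d * d * s ≤ s * (dx + dy) ^ 2 := by
      rw [mul_comm]; exact Nat.mul_le_mul_left _ e1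
    have e3 : d * d * d ≤ d * d * s := Nat.mul_le_mul_left _ (hd.trans hs)
    omega
  obtain ⟨x1, x2, x3⟩ := hb dx (by omega)
  obtain ⟨y1, y2, y3⟩ := hb dy (by omega)
  set S : Set (EigSolver × FactorInput s dx dy → ℝ) :=
    Set.range fun i => fun ω => FactorInput.read ω.2 i
  have hmem : ∀ i, (fun ω : EigSolver × FactorInput s dx dy => ω.2.read i) ∈ S :=
    fun i => ⟨i, rfl⟩
  have hx := MatWithin.cholesky (MatWithin.regGram (inp := FactorInput.read) (S := S)
    (A := fun ω => ω.2.XS) (lam := fun ω => ω.2.lamX)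
    (by rintro _ ⟨e, rfl⟩; exact hmem (.xs e.1 e.2)) (hmem .lamX) x1 x2) (fun ω => ω.2.posX) x1 x3
  have hy := MatWithin.cholesky (MatWithin.regGram (inp := FactorInput.read) (S := S)
    (A := fun ω => ω.2.YS) (lam := fun ω => ω.2.lamY)
    (by rintro _ ⟨e, rfl⟩; exact hmem (.ys e.1 e.2)) (hmem .lamY) y1 y2) (fun ω => ω.2.posY) y1 y3
  refine computable_of_matrices ((hx.union hy).le (by rw [← add_mul])) ?_
  rintro (e | e)
  · exact Or.inl ⟨e, rfl⟩
  · exact Or.inr ⟨e, rfl⟩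

/-- Every position `(r, j)` of the pattern contributes to exactly one entry of the product, namely
`(h r, j)`, and costs three operations there: loading the sign, a multiplication, an addition. -/
theorem Derives.countSketch_mul {D ι : Type} {inp : D → ι → ℝ} {S : Set (EigSolver × D → ℝ)}
    {d : ℕ} (pat : Finset (Fin n × Fin d)) {A : EigSolver × D → Matrix (Fin n) (Fin d) ℝ}
    (hpat : ∀ ω, SupportedOn pat (A ω)) (hA : entriesOn pat A ⊆ S) :
    Derives inp S (entries fun ω => countSketch h g * A ω) (3 * pat.card) := by
  have hcard : ∑ i, ∑ j, (Finset.univ.filter fun r => h r = i ∧ (r, j) ∈ pat).card =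
      pat.card := by
    rw [← Fintype.sum_prod_type' (f := fun i j =>
        (Finset.univ.filter fun r => h r = i ∧ (r, j) ∈ pat).card),
      Finset.card_eq_sum_card_fiberwise (f := fun e : Fin n × Fin d => (h e.1, e.2))
      (t := Finset.univ) (by simp)]
    refine Finset.sum_congr rfl fun ij _ => Finset.card_bij (fun r _ => (r, ij.2)) ?_ ?_ ?_
    · rintro r hr
      simp only [Finset.mem_filter, Finset.mem_univ, true_and] at hr ⊢
      exact ⟨hr.2, by rw [hr.1]⟩
    · simp
    · rintro ⟨r, j⟩ hr
      simp only [Finset.mem_filter] at hr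
      obtain ⟨h1, rfl⟩ := hr
      exact ⟨r, by simpa using h1, rfl⟩
  refine (Derives.entries_of (c := fun i j =>
    (Finset.univ.filter fun r => h r = i ∧ (r, j) ∈ pat).card * 3) fun i j => ?_).le ?_
  · refine (Computes.sum_const (Finset.univ.filter fun r => h r = i ∧ (r, j) ∈ pat) (c := 2)
      (F := fun r ω => (((g r : ℤ) : ℚ) : ℝ) * A ω r j) fun r hr => ?_).congr fun ω => ?_
    · exact ((Computes.const _).mul
        (Computes.of_mem (hA ⟨(r, j), by simp at hr; exact hr.2, rfl⟩))).le (by simp)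
    · rw [Matrix.mul_apply, Finset.sum_filter]
      refine Finset.sum_congr rfl fun r _ => ?_
      simp only [countSketch, Matrix.of_apply]
      by_cases h1 : h r = i
      · by_cases h2 : (r, j) ∈ pat
        · simp [h1, h2]
        · simp [h2, hpat ω r j h2]
      · simp [h1]
  · simp only [← Finset.sum_mul, hcard]; omega

theorem sketch_computable :
    ComputableWithin (SketchInput.read (PX := PX) (PY := PY)) (SketchInput.result h g)
      (3 * (PX.card + PY.card)) := by
  set S : Set (EigSolver × SketchInput PX PY → ℝ) :=
    Set.range fun i => fun ω => SketchInput.read ω.2 i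
  have hx := Derives.countSketch_mul (inp := SketchInput.read) (S := S) (h := h) (g := g) PX
    (A := fun ω => ω.2.X) (fun ω => ω.2.suppX)
    (by rintro _ ⟨e, he, rfl⟩; exact ⟨Sum.inl ⟨e, he⟩, rfl⟩)
  have hy := Derives.countSketch_mul (inp := SketchInput.read) (S := S) (h := h) (g := g) PY
    (A := fun ω => ω.2.Y) (fun ω => ω.2.suppY)
    (by rintro _ ⟨e, he, rfl⟩; exact ⟨Sum.inr ⟨e, he⟩, rfl⟩)
  refine computable_of_matrices ((hx.union hy).le (by omega)) ?_
  rintro (e | e)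
  · exact Or.inl ⟨e, rfl⟩
  · exact Or.inr ⟨e, rfl⟩

end Tasks

/-! ## The Riemannian Hessian at a critical point -/

section Hessian

open Filter Topology

variable {d p : ℕ}

/-- The Lyapunov operator. -/
def lyapunovOp (K : Matrix (Fin p) (Fin p) ℝ) :
    (Fin p → Fin p → ℝ) →ₗ[ℝ] (Fin p → Fin p → ℝ) where
  toFun S := Matrix.of.symm (K * Matrix.of S + Matrix.of S * K)
  map_add' S T := by
    change Matrix.of.symm (K * (Matrix.of S + Matrix.of T) + (Matrix.of S + Matrix.of T) * K) = _
    rw [Matrix.mul_add, Matrix.add_mul, add_add_add_comm]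
    rfl
  map_smul' c S := by
    change Matrix.of.symm (K * (c • Matrix.of S) + (c • Matrix.of S) * K) = _
    rw [Matrix.mul_smul, Matrix.smul_mul, ← smul_add]
    rfl

theorem lyapunovOp_quadratic (K₀ K₁ K₂ : Matrix (Fin p) (Fin p) ℝ) (t : ℝ) :
    (lyapunovOp (K₀ + t • K₁ + (t * t) • K₂)).toContinuousLinearMap =
      (lyapunovOp K₀).toContinuousLinearMap + t • (lyapunovOp K₁).toContinuousLinearMap +
        (t * t) • (lyapunovOp K₂).toContinuousLinearMap := by
  ext1 S
  change lyapunovOp (K₀ + t • K₁ + (t * t) • K₂) S = lyapunovOp K₀ S + t • lyapunovOp K₁ S +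
    (t * t) • lyapunovOp K₂ S
  have key : ∀ A : Matrix (Fin p) (Fin p) ℝ,
      (K₀ + t • K₁ + (t * t) • K₂) * A + A * (K₀ + t • K₁ + (t * t) • K₂) =
        (K₀ * A + A * K₀) + t • (K₁ * A + A * K₁) + (t * t) • (K₂ * A + A * K₂) := fun A => by
    rw [Matrix.add_mul, Matrix.add_mul, Matrix.mul_add, Matrix.mul_add,
      Matrix.smul_mul, Matrix.smul_mul, Matrix.mul_smul, Matrix.mul_smul, smul_add, smul_add]
    abel
  exact key (Matrix.of S)

theorem isUnit_lyapunovOp {K : Matrix (Fin p) (Fin p) ℝ} (hK : K.PosDef) :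
    IsUnit (lyapunovOp K).toContinuousLinearMap := by
  have hinj : Function.Injective (lyapunovOp K) := by
    rw [← LinearMap.ker_eq_bot, LinearMap.ker_eq_bot']
    exact fun S hS => lyapunov_injective (S := S) hK hK hS
  let e := (LinearEquiv.ofInjectiveEndo (lyapunovOp K) hinj).toContinuousLinearEquiv
  refine ⟨ContinuousLinearEquiv.toUnit e, ?_⟩
  ext1 S
  rfl

/-- Solutions of a family of Lyapunov equations whose data are quadratic in a parameter. -/
theorem exists_lyapunov_family {K₀ K₁ K₂ R₀ R₁ R₂ Λ : Matrix (Fin p) (Fin p) ℝ} (hK : K₀.PosDef)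
    (hKs : ∀ t : ℝ, (K₀ + t • K₁ + (t * t) • K₂)ᵀ = K₀ + t • K₁ + (t * t) • K₂)
    (hRs : ∀ t : ℝ, (R₀ + t • R₁ + (t * t) • R₂)ᵀ = R₀ + t • R₁ + (t * t) • R₂)
    (hΛ : K₀ * Λ + Λ * K₀ = R₀) :
    ∃ (S : ℝ → Matrix (Fin p) (Fin p) ℝ) (S' : Matrix (Fin p) (Fin p) ℝ), S 0 = Λ ∧ S'ᵀ = S' ∧
      (∀ i j, HasDerivAt (fun t => S t i j) (S' i j) 0) ∧
      ∀ᶠ t : ℝ in 𝓝 0, (S t)ᵀ = S t ∧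
        (K₀ + t • K₁ + (t * t) • K₂) * S t + S t * (K₀ + t • K₁ + (t * t) • K₂) =
          R₀ + t • R₁ + (t * t) • R₂ := by
  set K : ℝ → Matrix (Fin p) (Fin p) ℝ := fun t => K₀ + t • K₁ + (t * t) • K₂
  set R : ℝ → Fin p → Fin p → ℝ := fun t => Matrix.of.symm R₀ + t • Matrix.of.symm R₁ +
    (t * t) • Matrix.of.symm R₂
  have hR : ∀ t, R t = (R₀ + t • R₁ + (t * t) • R₂ : Matrix (Fin p) (Fin p) ℝ) := fun t => rfl
  set T : ℝ → (Fin p → Fin p → ℝ) →L[ℝ] (Fin p → Fin p → ℝ) :=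
    fun t => (lyapunovOp (K t)).toContinuousLinearMap
  have hTd : Differentiable ℝ T := by
    have : T = fun t => (lyapunovOp K₀).toContinuousLinearMap +
        t • (lyapunovOp K₁).toContinuousLinearMap +
        (t * t) • (lyapunovOp K₂).toContinuousLinearMap :=
      funext fun t => lyapunovOp_quadratic K₀ K₁ K₂ t
    rw [this]
    fun_prop
  have hRd : Differentiable ℝ R := by fun_prop
  have hT0 : T 0 = (lyapunovOp K₀).toContinuousLinearMap := by simp [T, K]
  have hu : IsUnit (T 0) := hT0 ▸ isUnit_lyapunovOp hK
  -- Inversion is differentiable at the unit `T 0`, and the units form an open set, so for small `t`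
  -- this is the unique solution and is differentiable at `0`.
  set S : ℝ → Fin p → Fin p → ℝ := fun t => Ring.inverse (T t) (R t)
  have hSd : DifferentiableAt ℝ S 0 := by
    have h1 : DifferentiableAt ℝ (fun t => Ring.inverse (T t)) 0 := by
      have h2 : DifferentiableAt ℝ Ring.inverse (T 0) := differentiableAt_inverse hu
      exact h2.comp (0 : ℝ) (hTd 0)
    exact h1.clm_apply (hRd 0)
  have hev : ∀ᶠ t in 𝓝 0, IsUnit (T t) :=
    hTd.continuous.continuousAt.eventually (Units.isOpen.mem_nhds hu)
  have hsolve : ∀ t, IsUnit (T t) → T t (S t) = R t := fun t ht => by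
    change (T t * Ring.inverse (T t)) (R t) = R t
    rw [Ring.mul_inverse_cancel _ ht]
    rfl
  have hinj : ∀ t, IsUnit (T t) → ∀ A A' : Fin p → Fin p → ℝ, T t A = T t A' → A = A' :=
    fun t ht A A' h => by
      have := congrArg (⇑(Ring.inverse (T t))) h
      change (Ring.inverse (T t) * T t) A = (Ring.inverse (T t) * T t) A' at this
      rwa [Ring.inverse_mul_cancel _ ht] at this
  have hsym : ∀ t, IsUnit (T t) → Matrix.transpose (S t) = S t := fun t ht => by
    refine hinj t ht _ _ ?_
    rw [hsolve t ht]
    have h := congrArg Matrix.transpose (hsolve t ht)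
    have h' : (K t * Matrix.of (S t) + Matrix.of (S t) * K t)ᵀ = (R₀ + t • R₁ + (t * t) • R₂)ᵀ := h
    rw [hRs, Matrix.transpose_add, Matrix.transpose_mul, Matrix.transpose_mul, hKs, add_comm] at h'
    exact h'
  have hder : ∀ i j, HasDerivAt (fun t => S t i j) (deriv S 0 i j) 0 := fun i j =>
    (hasDerivAt_pi.1 (hasDerivAt_pi.1 hSd.hasDerivAt i)) j
  refine ⟨fun t => Matrix.of (S t), Matrix.of (deriv S 0), ?_, ?_, hder, ?_⟩
  · refine hinj 0 hu _ _ ?_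
    refine (hsolve 0 hu).trans ?_
    have h0 : R 0 = R₀ := by rw [hR]; simp; rfl
    rw [h0, hT0]
    exact hΛ.symm
  · ext i j
    refine (hder j i).unique ?_
    refine (hder i j).congr_of_eventuallyEq ?_
    filter_upwards [hev] with t ht
    exact congrFun (congrFun (hsym t ht) i) j
  · filter_upwards [hev] with t ht
    exact ⟨hsym t ht, hsolve t ht⟩

/-- Near a point of the manifold, the multiplier of the projection of `M⁻¹ (g + t g')` is
differentiable along a line, if the projection vanishes at the point. -/
theorem exists_multiplier_family {B M : Matrix (Fin d) (Fin d) ℝ} {Z ξ g g' : Matrix (Fin d) (Fin p) ℝ}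
    {Λ : Matrix (Fin p) (Fin p) ℝ} (hM : M.PosDef) (hZ : Zᵀ * B * Z = 1)
    (hg : g = B * Z * Λ) (hΛ : Λᵀ = Λ) :
    ∃ (S : ℝ → Matrix (Fin p) (Fin p) ℝ) (S' : Matrix (Fin p) (Fin p) ℝ), S 0 = Λ ∧ S'ᵀ = S' ∧
      (∀ i j, HasDerivAt (fun t => S t i j) (S' i j) 0) ∧
      ∀ᶠ t : ℝ in 𝓝 0, (S t)ᵀ = S t ∧
        normalMat B M (Z + t • ξ) * S t + S t * normalMat B M (Z + t • ξ) =
          normalRhs B (Z + t • ξ) (M⁻¹ * (g + t • g')) := by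
  have hMi : (M⁻¹)ᵀ = M⁻¹ := by rw [Matrix.transpose_nonsing_inv, hM.isSymm]
  set c := B * Z
  set c' := B * ξ
  have hK : ∀ t : ℝ, normalMat B M (Z + t • ξ) = cᵀ * (M⁻¹ * c) +
      t • (cᵀ * (M⁻¹ * c') + c'ᵀ * (M⁻¹ * c)) + (t * t) • (c'ᵀ * (M⁻¹ * c')) := fun t => by
    simp only [normalMat, Matrix.mul_add, Matrix.mul_smul, Matrix.transpose_add,
      Matrix.transpose_smul, Matrix.add_mul, Matrix.smul_mul, smul_add, smul_smul]
    abel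
  have hR : ∀ t : ℝ, normalRhs B (Z + t • ξ) (M⁻¹ * (g + t • g')) =
      (cᵀ * (M⁻¹ * g) + (M⁻¹ * g)ᵀ * c) +
      t • (cᵀ * (M⁻¹ * g') + c'ᵀ * (M⁻¹ * g) + ((M⁻¹ * g')ᵀ * c + (M⁻¹ * g)ᵀ * c')) +
      (t * t) • (c'ᵀ * (M⁻¹ * g') + (M⁻¹ * g')ᵀ * c') := fun t => by
    simp only [normalRhs, Matrix.mul_add, Matrix.mul_smul, Matrix.transpose_add,
      Matrix.transpose_smul, Matrix.add_mul, Matrix.smul_mul, smul_add, smul_smul]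
    abel
  simp only [hK, hR]
  refine exists_lyapunov_family ?_ (fun t => ?_) (fun t => ?_) ?_
  · have := normalMat_posDef hM hZ
    exact this
  · rw [← hK]
    simp only [normalMat, Matrix.transpose_mul, Matrix.transpose_transpose, hMi, Matrix.mul_assoc]
  · rw [← hR]
    exact normalRhs_symm _ _ _
  -- At `t = 0`, criticality `g = B * Z * Λ` turns the right-hand side into `K₀ * Λ + Λ * K₀`, so
  -- the Lagrange multiplier is the initial solution.
  · rw [hg, Matrix.transpose_mul M⁻¹, Matrix.transpose_mul c Λ, hMi, hΛ]
    simp only [Matrix.mul_assoc]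

theorem hasDerivAt_affine_mul {k m n : ℕ} (C C' : Matrix (Fin k) (Fin m) ℝ)
    {S : ℝ → Matrix (Fin m) (Fin n) ℝ} {S' : Matrix (Fin m) (Fin n) ℝ}
    (hS : ∀ i j, HasDerivAt (fun t => S t i j) (S' i j) 0) (i : Fin k) (j : Fin n) :
    HasDerivAt (fun t : ℝ => ((C + t • C') * S t) i j) ((C' * S 0 + C * S') i j) 0 := by
  simp only [Matrix.mul_apply, Matrix.add_apply, Matrix.smul_apply, smul_eq_mul,
    ← Finset.sum_add_distrib]
  refine HasDerivAt.fun_sum fun r _ => ?_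
  have h1 : HasDerivAt (fun t : ℝ => C i r + t * C' i r) (C' i r) 0 := by
    simpa using ((hasDerivAt_id (0 : ℝ)).mul_const (C' i r)).const_add (C i r)
  exact (h1.fun_mul (hS r j)).congr_deriv (by simp)

variable {dx dy : ℕ} {G : Geometry dx dy}

theorem Geometry.proj_spec (h1 : G.M1.PosDef) (h2 : G.M2.PosDef) (hB1 : G.B1ᵀ = G.B1)
    (hB2 : G.B2ᵀ = G.B2) {Z : Pt dx dy p} (hZ : Z ∈ G.manifold p) (ξ : Pt dx dy p) :
    G.proj Z ξ ∈ G.tangent Z ∧ ∀ ζ ∈ G.tangent Z, G.inner ζ (ξ - G.proj Z ξ) = 0 := by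
  have hK1 := normalMat_posDef h1 hZ.1
  have hK2 := normalMat_posDef h2 hZ.2
  obtain ⟨S1, e1⟩ := exists_lyapunov hK1 (normalRhs G.B1 Z.1 ξ.1)
  obtain ⟨S2, e2⟩ := exists_lyapunov hK2 (normalRhs G.B2 Z.2 ξ.2)
  have s1 := lyapunov_symm hK1 (normalRhs_symm _ _ _) e1
  have s2 := lyapunov_symm hK2 (normalRhs_symm _ _ _) e2
  rw [G.proj_eq_of_normal h1 h2 hB1 hB2 s1 s2 e1 e2]
  refine ⟨⟨tangent_normal_solution hB1 h1.isSymm s1 e1,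
    tangent_normal_solution hB2 h2.isSymm s2 e2⟩, fun ζ hζ => ?_⟩
  simp only [Geometry.inner, Prod.fst_sub, Prod.snd_sub, sub_sub_cancel]
  rw [normal_orthogonal hB1 h1.isUnit_det hζ.1 s1, normal_orthogonal hB2 h2.isUnit_det hζ.2 s2,
    add_zero]

/-- Paired with a tangent vector, the normal part vanishes and the metric cancels. This is why the
Hessian form at a critical point does not depend on the preconditioner. -/
theorem trace_metric_cancel {M : Matrix (Fin d) (Fin d) ℝ} (hM : M.PosDef)
    {B : Matrix (Fin d) (Fin d) ℝ} (hB : Bᵀ = B) {Z ζ : Matrix (Fin d) (Fin p) ℝ}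
    (hζ : ζᵀ * B * Z + Zᵀ * B * ζ = 0) {S : Matrix (Fin p) (Fin p) ℝ} (hS : Sᵀ = S)
    (A : Matrix (Fin d) (Fin p) ℝ) :
    (ζᵀ * M * (M⁻¹ * A - M⁻¹ * (B * Z) * S)).trace = (ζᵀ * A).trace := by
  rw [Matrix.mul_sub, Matrix.trace_sub, normal_orthogonal hB hM.isUnit_det hζ hS, sub_zero,
    Matrix.mul_assoc, ← Matrix.mul_assoc M, Matrix.mul_nonsing_inv _ hM.isUnit_det, Matrix.one_mul]

/-- The Hessian of the CCA cost at a critical point, as a bilinear form. -/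
theorem inner_hess {n : ℕ} (P : CCAProblem n dx dy p) (h1 : G.M1.PosDef) (h2 : G.M2.PosDef)
    (hB1 : G.B1ᵀ = G.B1) (hB2 : G.B2ᵀ = G.B2) {Z : Pt dx dy p} (hZ : Z ∈ G.manifold p)
    {Λ1 Λ2 : Matrix (Fin p) (Fin p) ℝ} (hΛ1 : Λ1ᵀ = Λ1) (hΛ2 : Λ2ᵀ = Λ2)
    (hc1 : -(P.Sxy * Z.2 * P.N) = G.B1 * Z.1 * Λ1) (hc2 : -(P.Sxyᵀ * Z.1 * P.N) = G.B2 * Z.2 * Λ2)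
    (ξ : Pt dx dy p) {ζ : Pt dx dy p} (hζ : ζ ∈ G.tangent Z) :
    G.inner ζ (G.hess P.cost Z ξ) =
      (ζ.1ᵀ * (-(P.Sxy * ξ.2 * P.N) - G.B1 * ξ.1 * Λ1)).trace +
        (ζ.2ᵀ * (-(P.Sxyᵀ * ξ.1 * P.N) - G.B2 * ξ.2 * Λ2)).trace := by
  obtain ⟨S1, S1', s10, s1s, s1d, s1e⟩ := exists_multiplier_family (ξ := ξ.1)
    (g' := -(P.Sxy * ξ.2 * P.N)) h1 hZ.1 hc1 hΛ1
  obtain ⟨S2, S2', s20, s2s, s2d, s2e⟩ := exists_multiplier_family (ξ := ξ.2)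
    (g' := -(P.Sxyᵀ * ξ.1 * P.N)) h2 hZ.2 hc2 hΛ2
  -- The points `Z + t • ξ` leave the manifold, but for small `t` the normal equations remain
  -- solvable, which keeps the projection explicit.
  have hgrad : ∀ᶠ t : ℝ in 𝓝 0, G.grad P.cost (Z + t • ξ) =
      ((G.M1⁻¹ * -(P.Sxy * Z.2 * P.N) + t • (G.M1⁻¹ * -(P.Sxy * ξ.2 * P.N))) -
        (G.M1⁻¹ * (G.B1 * Z.1) + t • (G.M1⁻¹ * (G.B1 * ξ.1))) * S1 t,
      (G.M2⁻¹ * -(P.Sxyᵀ * Z.1 * P.N) + t • (G.M2⁻¹ * -(P.Sxyᵀ * ξ.1 * P.N))) -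
        (G.M2⁻¹ * (G.B2 * Z.2) + t • (G.M2⁻¹ * (G.B2 * ξ.2))) * S2 t) := by
    filter_upwards [s1e, s2e] with t e1 e2
    have g1 : (Geometry.euclGrad P.cost (Z + t • ξ)).1 =
        -(P.Sxy * Z.2 * P.N) + t • -(P.Sxy * ξ.2 * P.N) := by
      rw [P.euclGrad_cost]
      simp only [Prod.snd_add, Prod.smul_snd, Matrix.mul_add, Matrix.add_mul, Matrix.mul_smul,
        Matrix.smul_mul, neg_add, smul_neg]
    have g2 : (Geometry.euclGrad P.cost (Z + t • ξ)).2 =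
        -(P.Sxyᵀ * Z.1 * P.N) + t • -(P.Sxyᵀ * ξ.1 * P.N) := by
      rw [P.euclGrad_cost]
      simp only [Prod.fst_add, Prod.smul_fst, Matrix.mul_add, Matrix.add_mul, Matrix.mul_smul,
        Matrix.smul_mul, neg_add, smul_neg]
    rw [Geometry.grad, g1, g2, G.proj_eq_of_normal (Z := Z + t • ξ) h1 h2 hB1 hB2 e1.1 e2.1
      e1.2 e2.2]
    simp only [Prod.fst_add, Prod.snd_add, Prod.smul_fst, Prod.smul_snd, Matrix.mul_add,
      Matrix.mul_smul]
  have haff : ∀ {d : ℕ} (C C' : Matrix (Fin d) (Fin p) ℝ) (i : Fin d) (j : Fin p),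
      HasDerivAt (fun t : ℝ => (C + t • C') i j) (C' i j) 0 := fun C C' i j => by
    simpa using ((hasDerivAt_id (0 : ℝ)).mul_const (C' i j)).const_add (C i j)
  -- The derivatives `S1'`, `S2'` of the multipliers enter only through normal vectors with
  -- symmetric coefficients, so their values never matter.
  have hD : Geometry.dirDeriv (G.grad P.cost) Z ξ =
      (G.M1⁻¹ * (-(P.Sxy * ξ.2 * P.N) - G.B1 * ξ.1 * Λ1) - G.M1⁻¹ * (G.B1 * Z.1) * S1',
      G.M2⁻¹ * (-(P.Sxyᵀ * ξ.1 * P.N) - G.B2 * ξ.2 * Λ2) - G.M2⁻¹ * (G.B2 * Z.2) * S2') := by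
    refine Prod.ext ?_ ?_
    · ext i j
      refine HasDerivAt.deriv (HasDerivAt.congr_of_eventuallyEq (f := fun t => _) ?_
        (hgrad.mono fun t ht => congrFun (congrFun (congrArg Prod.fst ht) i) j))
      refine ((haff _ _ i j).sub (hasDerivAt_affine_mul _ _ s1d i j)).congr_deriv ?_
      rw [s10, ← Matrix.sub_apply]
      simp only [Matrix.mul_sub, Matrix.mul_assoc, sub_sub]
    · ext i j
      refine HasDerivAt.deriv (HasDerivAt.congr_of_eventuallyEq (f := fun t => _) ?_
        (hgrad.mono fun t ht => congrFun (congrFun (congrArg Prod.snd ht) i) j))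
      refine ((haff _ _ i j).sub (hasDerivAt_affine_mul _ _ s2d i j)).congr_deriv ?_
      rw [s20, ← Matrix.sub_apply]
      simp only [Matrix.mul_sub, Matrix.mul_assoc, sub_sub]
  have ho := (G.proj_spec h1 h2 hB1 hB2 hZ (Geometry.dirDeriv (G.grad P.cost) Z ξ)).2 ζ hζ
  have hi : G.inner ζ (G.hess P.cost Z ξ) = G.inner ζ (Geometry.dirDeriv (G.grad P.cost) Z ξ) := by
    rw [Geometry.hess]
    simp only [Geometry.inner, Prod.fst_sub, Prod.snd_sub, Matrix.mul_sub, Matrix.trace_sub] at ho ⊢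
    linarith
  rw [hi, hD, Geometry.inner, trace_metric_cancel h1 hB1 hζ.1 s1s,
    trace_metric_cancel h2 hB2 hζ.2 s2s]

end Hessian

/-! ## Canonical bases -/

section Canonical

/-- Only the columns indexed by `s` are kept. For singular value decompositions, vectors belonging
to zero singular values are not determined by the matrix and have to be supplied. -/
theorem exists_orthogonal_extension {n q : ℕ} (hqn : q ≤ n) (C : Matrix (Fin n) (Fin q) ℝ)
    (s : Set (Fin q)) (hs : ∀ k ∈ s, ∀ l ∈ s, (Cᵀ * C) k l = (1 : Matrix (Fin q) (Fin q) ℝ) k l) :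
    ∃ O : Matrix (Fin n) (Fin n) ℝ, Oᵀ * O = 1 ∧ ∀ k ∈ s, ∀ i, O i (Fin.castLE hqn k) = C i k := by
  let v : Fin n → EuclideanSpace ℝ (Fin n) := fun j =>
    if h : (j : ℕ) < q then WithLp.toLp 2 fun i => C i ⟨j, h⟩ else 0
  let t : Set (Fin n) := Fin.castLE hqn '' s
  have hv : ∀ k, v (Fin.castLE hqn k) = WithLp.toLp 2 fun i => C i k := fun k => by simp [v]
  have ho : Orthonormal ℝ (t.domRestrict v) := by
    rw [orthonormal_iff_ite]
    rintro ⟨_, k, hk, rfl⟩ ⟨_, l, hl, rfl⟩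
    have h := hs k hk l hl
    simp only [Matrix.mul_apply, Matrix.transpose_apply, Matrix.one_apply] at h
    have e : inner ℝ (v (Fin.castLE hqn k)) (v (Fin.castLE hqn l)) = if k = l then (1 : ℝ) else 0 := by
      rw [← h, hv, hv]
      simp [PiLp.inner_apply, mul_comm]
    refine e.trans ?_
    by_cases hkl : k = l
    · subst hkl; simp
    · rw [if_neg hkl, if_neg fun h' => hkl (by simpa using congrArg Subtype.val h')]
  obtain ⟨b, hb⟩ := ho.exists_orthonormalBasis_extension_of_card_eq (by simp)
  refine ⟨Matrix.of fun i j => b j i, ?_, fun k hk i => ?_⟩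
  · ext j l
    have h := orthonormal_iff_ite.1 b.orthonormal j l
    rw [Matrix.one_apply, ← h]
    simp [Matrix.mul_apply, PiLp.inner_apply, mul_comm]
  · rw [Matrix.of_apply, hb _ ⟨k, hk, rfl⟩, hv]

/-- With `Q` diagonalizing `A * Aᵀ`, the rows of `Qᵀ * A` are orthogonal with squared norms `w`. The
nonzero rows are normalized, and an orthonormal basis containing them supplies the right singular
vectors. -/
theorem exists_thin_svd_of_le {m n : ℕ} (hmn : m ≤ n) (A : Matrix (Fin m) (Fin n) ℝ) :
    ∃ (a : Matrix (Fin m) (Fin m) ℝ) (b : Matrix (Fin n) (Fin m) ℝ) (τ : Fin m → ℝ),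
      aᵀ * a = 1 ∧ bᵀ * b = 1 ∧ (∀ k, 0 ≤ τ k) ∧ A = a * Matrix.diagonal τ * bᵀ := by
  obtain ⟨Q, w, hQ, hw⟩ := exists_spectral (A := A * Aᵀ) (by simp)
  set r : Matrix (Fin m) (Fin n) ℝ := Qᵀ * A with hr
  have hrr : r * rᵀ = Matrix.diagonal w := by
    calc r * rᵀ = Qᵀ * (A * Aᵀ) * Q := by
          rw [hr, Matrix.transpose_mul, Matrix.transpose_transpose]; simp only [Matrix.mul_assoc]
      _ = (Qᵀ * Q) * Matrix.diagonal w * (Qᵀ * Q) := by rw [hw]; simp only [Matrix.mul_assoc]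
      _ = _ := by rw [hQ, Matrix.one_mul, Matrix.mul_one]
  have hnorm : ∀ k, ∑ i, r k i * r k i = w k := fun k => by
    have := congrFun (congrFun hrr k) k
    simpa [Matrix.mul_apply] using this
  have hw0 : ∀ k, 0 ≤ w k := fun k => by
    rw [← hnorm]; exact Finset.sum_nonneg fun i _ => mul_self_nonneg _
  have hr0 : ∀ k, w k = 0 → ∀ i, r k i = 0 := fun k hk i => by
    have := (Finset.sum_eq_zero_iff_of_nonneg fun i _ => mul_self_nonneg (r k i)).1
      ((hnorm k).trans hk) i (Finset.mem_univ _)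
    exact mul_self_eq_zero.1 this
  obtain ⟨O, hO, hOs⟩ := exists_orthogonal_extension hmn
    (rᵀ * Matrix.diagonal fun k => (√(w k))⁻¹) {k | 0 < w k} (fun k hk l hl => by
      have e : (rᵀ * Matrix.diagonal fun k => (√(w k))⁻¹)ᵀ * (rᵀ * Matrix.diagonal fun k =>
          (√(w k))⁻¹) = Matrix.diagonal fun k => (√(w k))⁻¹ * w k * (√(w k))⁻¹ := by
        calc _ = Matrix.diagonal (fun k => (√(w k))⁻¹) * (r * rᵀ) *
              Matrix.diagonal (fun k => (√(w k))⁻¹) := by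
              simp only [Matrix.transpose_mul, Matrix.diagonal_transpose,
                Matrix.transpose_transpose, Matrix.mul_assoc]
          _ = _ := by rw [hrr, Matrix.diagonal_mul_diagonal, Matrix.diagonal_mul_diagonal]
      rw [e, Matrix.diagonal_apply, Matrix.one_apply]
      split_ifs with hkl
      · have hs : √(w k) ≠ 0 := (Real.sqrt_pos.2 hk).ne'
        have : w k = √(w k) * √(w k) := (Real.mul_self_sqrt (hw0 k)).symm
        conv_lhs => rw [this]
        simp [← this]
        field_simp
        exact this.symm ▸ by simp [pow_two, ← this]
      · rfl)
  refine ⟨Q, O.submatrix id (Fin.castLE hmn), fun k => √(w k), hQ, ?_, fun k => Real.sqrt_nonneg _,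
    ?_⟩
  · rw [Matrix.transpose_submatrix, ← Matrix.submatrix_mul _ _ _ _ _ Function.bijective_id, hO]
    ext i j
    simp [Matrix.one_apply]
  · have h : Matrix.diagonal (fun k => √(w k)) * (O.submatrix id (Fin.castLE hmn))ᵀ = r := by
      ext k i
      rw [Matrix.diagonal_mul, Matrix.transpose_apply, Matrix.submatrix_apply]
      rcases (hw0 k).eq_or_lt with h0 | h0
      · rw [← h0, hr0 k h0.symm]; simp
      · rw [hOs k h0, Matrix.mul_diagonal, Matrix.transpose_apply, id]
        have : √(w k) ≠ 0 := (Real.sqrt_pos.2 h0).ne'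
        field_simp
    rw [Matrix.mul_assoc, h, hr, ← Matrix.mul_assoc, mul_eq_one_comm.1 hQ, Matrix.one_mul]

theorem exists_thin_svd {m n q : ℕ} (hq : q = min m n) (A : Matrix (Fin m) (Fin n) ℝ) :
    ∃ (a : Matrix (Fin m) (Fin q) ℝ) (b : Matrix (Fin n) (Fin q) ℝ) (τ : Fin q → ℝ),
      aᵀ * a = 1 ∧ bᵀ * b = 1 ∧ (∀ k, 0 ≤ τ k) ∧ A = a * Matrix.diagonal τ * bᵀ := by
  rcases le_total m n with h | h
  · obtain rfl : q = m := by omega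
    exact exists_thin_svd_of_le h A
  · obtain rfl : q = n := by omega
    obtain ⟨a, b, τ, ha, hb, hτ, hA⟩ := exists_thin_svd_of_le h Aᵀ
    refine ⟨b, a, τ, hb, ha, hτ, ?_⟩
    rw [← Matrix.transpose_transpose A, hA]
    simp only [Matrix.transpose_mul, Matrix.transpose_transpose, Matrix.diagonal_transpose,
      Matrix.mul_assoc]

/-- A diagonalization by orthonormal systems with maximal trace extends to a full singular value
decomposition. -/
theorem exists_full_svd_of_maximal {m n q : ℕ} (hq : q = min m n) {A : Matrix (Fin m) (Fin n) ℝ}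
    {u : Matrix (Fin m) (Fin q) ℝ} {v : Matrix (Fin n) (Fin q) ℝ} {σ : Fin q → ℝ}
    (hu : uᵀ * u = 1) (hv : vᵀ * v = 1) (hσ : uᵀ * A * v = Matrix.diagonal σ)
    (hmax : ∀ (u' : Matrix (Fin m) (Fin q) ℝ) (v' : Matrix (Fin n) (Fin q) ℝ) (σ' : Fin q → ℝ),
      u'ᵀ * u' = 1 → v'ᵀ * v' = 1 → u'ᵀ * A * v' = Matrix.diagonal σ' → Antitone σ' →
      ∑ i, σ' i ≤ ∑ i, σ i) :
    (∀ i, 0 ≤ σ i) ∧ ∃ (O : Matrix (Fin m) (Fin m) ℝ) (O' : Matrix (Fin n) (Fin n) ℝ),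
      Oᵀ * O = 1 ∧ O'ᵀ * O' = 1 ∧
      ∀ k l, (Oᵀ * A * O') k l = if (k : ℕ) = l then ext0 σ k else 0 := by
  have hqm : q ≤ m := by omega
  have hqn : q ≤ n := by omega
  obtain ⟨a, b, τ, ha, hb, hτ, hA⟩ := exists_thin_svd hq A
  -- Singular vectors sorted by decreasing singular value form an admissible competitor.
  have hle : ∑ i, τ i ≤ ∑ i, σ i := by
    let π := Tuple.sort fun i => -τ i
    have hanti : Antitone (τ ∘ π) := fun i j hij => by
      have := Tuple.monotone_sort (fun i => -τ i) hij
      simpa [π] using this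
    have h1 : ∀ {d : ℕ} {c : Matrix (Fin d) (Fin q) ℝ}, cᵀ * c = 1 →
        (c.submatrix id π)ᵀ * c.submatrix id π = 1 := fun hc => by
      rw [Matrix.transpose_submatrix, ← Matrix.submatrix_mul _ _ _ _ _ Function.bijective_id, hc]
      ext i j; simp [Matrix.one_apply]
    refine le_trans (Equiv.sum_comp π τ).ge (hmax _ _ (τ ∘ π) (h1 ha) (h1 hb) ?_ hanti)
    calc (a.submatrix id π)ᵀ * A * b.submatrix id π = (aᵀ * A * b).submatrix π π := by
          ext i j; simp [Matrix.mul_apply]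
      _ = ((aᵀ * a) * Matrix.diagonal τ * (bᵀ * b)).submatrix π π := by
          rw [hA]; simp only [Matrix.mul_assoc]
      _ = Matrix.diagonal (τ ∘ π) := by
          rw [ha, hb, Matrix.one_mul, Matrix.mul_one, Matrix.submatrix_diagonal_equiv]
  obtain ⟨O, hO, hOu⟩ := exists_orthogonal_extension hqm u Set.univ fun k _ l _ => by rw [hu]
  obtain ⟨O', hO', hOv⟩ := exists_orthogonal_extension hqn v Set.univ fun k _ l _ => by rw [hv]
  have hOO := mul_eq_one_comm.1 hO
  have hOO' := mul_eq_one_comm.1 hO'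
  set c : Matrix (Fin q) (Fin m) ℝ := aᵀ * O
  set e : Matrix (Fin q) (Fin n) ℝ := bᵀ * O'
  have hentry : ∀ i j, (Oᵀ * A * O') i j = ∑ k, τ k * c k i * e k j := fun i j => by
    have : Oᵀ * A * O' = cᵀ * Matrix.diagonal τ * e := by
      rw [hA]; simp only [c, e, Matrix.transpose_mul, Matrix.transpose_transpose, Matrix.mul_assoc]
    rw [this, Matrix.mul_apply]
    refine Finset.sum_congr rfl fun k _ => ?_
    rw [Matrix.mul_diagonal, Matrix.transpose_apply]; ring
  have hdiag : ∀ i j : Fin q, (Oᵀ * A * O') (Fin.castLE hqm i) (Fin.castLE hqn j) =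
      Matrix.diagonal σ i j := fun i j => by
    rw [← hσ]
    simp only [Matrix.mul_apply, Matrix.transpose_apply, hOu _ (Set.mem_univ _),
      hOv _ (Set.mem_univ _)]
  have hrow : ∀ {d : ℕ} (hqd : q ≤ d) (w : Matrix (Fin q) (Fin d) ℝ), w * wᵀ = 1 → ∀ k,
      ∑ i : Fin q, w k (Fin.castLE hqd i) ^ 2 + ∑ i ∈ Finset.univ.filter (fun i : Fin d => q ≤ (i : ℕ)), w k i ^ 2 = 1 :=
    fun {d} hqd w hw k => by
      have h1 : ∑ i, w k i ^ 2 = 1 := by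
        have := congrFun (congrFun hw k) k
        simpa [Matrix.mul_apply, pow_two] using this
      rw [← h1, ← Finset.sum_filter_add_sum_filter_not Finset.univ (fun i : Fin d => q ≤ (i : ℕ)),
        add_comm]
      congr 1
      refine Finset.sum_bij (fun i _ => Fin.castLE hqd i) ?_ ?_ ?_ ?_
      · intro i _; simp
      · intro i _ j _ h; simpa using h
      · intro i hi; exact ⟨⟨i, by simpa using hi⟩, Finset.mem_univ _, rfl⟩
      · intro i _; rfl
  have hc1 : c * cᵀ = 1 := by
    calc c * cᵀ = aᵀ * (O * Oᵀ) * a := by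
          simp only [c, Matrix.transpose_mul, Matrix.transpose_transpose, Matrix.mul_assoc]
      _ = 1 := by rw [hOO, Matrix.mul_one, ha]
  have he1 : e * eᵀ = 1 := by
    calc e * eᵀ = bᵀ * (O' * O'ᵀ) * b := by
          simp only [e, Matrix.transpose_mul, Matrix.transpose_transpose, Matrix.mul_assoc]
      _ = 1 := by rw [hOO', Matrix.mul_one, hb]
  set rc : Fin q → ℝ := fun k => ∑ i ∈ Finset.univ.filter (fun i : Fin m => q ≤ (i : ℕ)), c k i ^ 2
  set re : Fin q → ℝ := fun k => ∑ i ∈ Finset.univ.filter (fun i : Fin n => q ≤ (i : ℕ)), e k i ^ 2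
  set df : Fin q → ℝ := fun k => ∑ i : Fin q, (c k (Fin.castLE hqm i) - e k (Fin.castLE hqn i)) ^ 2
  have hrc : ∀ k, 0 ≤ rc k := fun k => Finset.sum_nonneg fun i _ => sq_nonneg _
  have hre : ∀ k, 0 ≤ re k := fun k => Finset.sum_nonneg fun i _ => sq_nonneg _
  have hdf : ∀ k, 0 ≤ df k := fun k => Finset.sum_nonneg fun i _ => sq_nonneg _
  -- The rows of `c` and `e` are unit vectors; `rc`, `re` are their squared mass beyond the first
  -- `q` coordinates and `df` is their squared distance within. The three add up to the
  -- Cauchy–Schwarz deficit `2 - 2 * ∑ c * e`. Maximality makes the right side nonpositive, so all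
  -- three vanish wherever `τ k` does not.
  have hsum : ∑ k, τ k * (rc k + re k + df k) = 2 * (∑ k, τ k - ∑ i, σ i) := by
    have h1 : ∑ i, σ i = ∑ k, τ k * ∑ i : Fin q, c k (Fin.castLE hqm i) * e k (Fin.castLE hqn i) := by
      simp only [Finset.mul_sum]
      rw [Finset.sum_comm]
      refine Finset.sum_congr rfl fun i _ => ?_
      have := hdiag i i
      rw [hentry, Matrix.diagonal_apply_eq] at this
      rw [← this]
      exact Finset.sum_congr rfl fun k _ => by ring
    rw [h1, ← Finset.sum_sub_distrib, Finset.mul_sum]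
    refine Finset.sum_congr rfl fun k _ => ?_
    have h2 := hrow hqm c hc1 k
    have h3 := hrow hqn e he1 k
    have h4 : df k = ∑ i : Fin q, c k (Fin.castLE hqm i) ^ 2 +
        ∑ i : Fin q, e k (Fin.castLE hqn i) ^ 2 -
        2 * ∑ i : Fin q, c k (Fin.castLE hqm i) * e k (Fin.castLE hqn i) := by
      rw [Finset.mul_sum, ← Finset.sum_add_distrib, ← Finset.sum_sub_distrib]
      exact Finset.sum_congr rfl fun i _ => by ring
    have h5 : rc k + re k + df k = 2 - 2 * ∑ i : Fin q, c k (Fin.castLE hqm i) *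
        e k (Fin.castLE hqn i) := by rw [h4]; simp only [rc, re]; linarith
    rw [h5]; ring
  have hzero : ∀ k, τ k * (rc k + re k + df k) = 0 := by
    have hnn : ∀ k ∈ Finset.univ, 0 ≤ τ k * (rc k + re k + df k) := fun k _ =>
      mul_nonneg (hτ k) (by have := hrc k; have := hre k; have := hdf k; linarith)
    have h0 : ∑ k, τ k * (rc k + re k + df k) = 0 :=
      le_antisymm (by rw [hsum]; linarith) (Finset.sum_nonneg hnn)
    exact fun k => (Finset.sum_eq_zero_iff_of_nonneg hnn).1 h0 k (Finset.mem_univ _)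
  have hall : ∀ k, τ k = 0 ∨ (rc k = 0 ∧ re k = 0 ∧ df k = 0) := fun k => by
    rcases mul_eq_zero.1 (hzero k) with h | h
    · exact Or.inl h
    · have := hrc k; have := hre k; have := hdf k
      exact Or.inr ⟨by linarith, by linarith, by linarith⟩
  have hczero : ∀ k (i : Fin m), q ≤ (i : ℕ) → τ k * c k i = 0 := fun k i hi => by
    rcases hall k with h | ⟨h, -, -⟩
    · rw [h, zero_mul]
    · have := (Finset.sum_eq_zero_iff_of_nonneg fun i _ => sq_nonneg (c k i)).1 h i (by simpa using hi)
      rw [pow_eq_zero_iff two_ne_zero] at this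
      rw [this, mul_zero]
  have hezero : ∀ k (i : Fin n), q ≤ (i : ℕ) → τ k * e k i = 0 := fun k i hi => by
    rcases hall k with h | ⟨-, h, -⟩
    · rw [h, zero_mul]
    · have := (Finset.sum_eq_zero_iff_of_nonneg fun i _ => sq_nonneg (e k i)).1 h i (by simpa using hi)
      rw [pow_eq_zero_iff two_ne_zero] at this
      rw [this, mul_zero]
  -- Where `τ k ≠ 0` the rows agree, so a diagonal entry is `∑ τ k * c k i ^ 2 ≥ 0`. Outside the
  -- leading `q × q` block each summand vanishes.
  refine ⟨fun i => ?_, O, O', hO, hO', fun k l => ?_⟩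
  · have := hdiag i i
    rw [hentry, Matrix.diagonal_apply_eq] at this
    rw [← this]
    refine Finset.sum_nonneg fun k _ => ?_
    rcases hall k with h | ⟨-, -, h⟩
    · rw [h]; simp
    · have := (Finset.sum_eq_zero_iff_of_nonneg fun i _ => sq_nonneg
        (c k (Fin.castLE hqm i) - e k (Fin.castLE hqn i))).1 h i (Finset.mem_univ _)
      rw [pow_eq_zero_iff two_ne_zero, sub_eq_zero] at this
      rw [this, mul_assoc]
      exact mul_nonneg (hτ k) (mul_self_nonneg _)
  · by_cases hk : (k : ℕ) < q
    · by_cases hl : (l : ℕ) < q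
      · have := hdiag ⟨k, hk⟩ ⟨l, hl⟩
        refine this.trans ?_
        simp [Matrix.diagonal_apply, ext0, hk]
      · rw [hentry, if_neg (by omega)]
        refine Finset.sum_eq_zero fun r _ => ?_
        rw [mul_right_comm, hezero r l (by omega), zero_mul]
    · have hkl : (k : ℕ) ≠ l := by have := k.2; have := l.2; omega
      rw [hentry, if_neg hkl]
      refine Finset.sum_eq_zero fun r _ => ?_
      rw [hczero r k (by omega), zero_mul]

/-- Multiplication by the Cholesky factors turns the constraints into orthonormality and the cross
matrix into `A = (R⁻¹)ᵀ * Sxy * T⁻¹`, whose singular values are the canonical correlations. -/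
theorem exists_canonical_basis {n dx dy p : ℕ} {P : CCAProblem n dx dy p} (hx : P.Sxx.PosDef)
    (hy : P.Syy.PosDef) {σ : Fin (min dx dy) → ℝ} (h : IsCanonicalCorrelations P σ) :
    (∀ i, 0 ≤ σ i) ∧ ∃ (U : Matrix (Fin dx) (Fin dx) ℝ) (V : Matrix (Fin dy) (Fin dy) ℝ),
      Uᵀ * P.Sxx * U = 1 ∧ Vᵀ * P.Syy * V = 1 ∧
      ∀ k l, (Uᵀ * P.Sxy * V) k l = if (k : ℕ) = l then ext0 σ k else 0 := by
  obtain ⟨U, V, ⟨hU, hV, hUV, hanti⟩, hmax⟩ := h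
  obtain ⟨R, hR, hRx⟩ := exists_cholesky hx
  obtain ⟨T, hT, hTy⟩ := exists_cholesky hy
  have gram : ∀ {d k : ℕ} {R B : Matrix (Fin d) (Fin d) ℝ} (_ : Rᵀ * R = B)
      (U : Matrix (Fin d) (Fin k) ℝ), (R * U)ᵀ * (R * U) = Uᵀ * B * U := fun h U => by
    rw [← h, Matrix.transpose_mul]; simp only [Matrix.mul_assoc]
  have gram' : ∀ {d k : ℕ} {R B : Matrix (Fin d) (Fin d) ℝ} (_ : IsPosUpper R) (_ : Rᵀ * R = B)
      (U : Matrix (Fin d) (Fin k) ℝ), (R⁻¹ * U)ᵀ * B * (R⁻¹ * U) = Uᵀ * U := fun {d k R B} hR h U => by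
    refine (gram h (R⁻¹ * U)).symm.trans ?_
    have e : R * (R⁻¹ * U) = U := by
      rw [← Matrix.mul_assoc, Matrix.mul_nonsing_inv _ hR.isUnit, Matrix.one_mul]
    rw [e]
  set A := (R⁻¹)ᵀ * P.Sxy * T⁻¹
  have hA : ∀ {k l : ℕ} (U : Matrix (Fin dx) (Fin k) ℝ) (V : Matrix (Fin dy) (Fin l) ℝ),
      (R⁻¹ * U)ᵀ * P.Sxy * (T⁻¹ * V) = Uᵀ * A * V := fun U V => by
    rw [Matrix.transpose_mul]; simp only [A, Matrix.mul_assoc]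
  have hback : ∀ {d k : ℕ} {R : Matrix (Fin d) (Fin d) ℝ} (_ : IsPosUpper R)
      (U : Matrix (Fin d) (Fin k) ℝ), R⁻¹ * (R * U) = U := fun hR U => by
    rw [← Matrix.mul_assoc, Matrix.nonsing_inv_mul _ hR.isUnit, Matrix.one_mul]
  obtain ⟨h0, O, O', hO, hO', hOO⟩ := exists_full_svd_of_maximal (q := min dx dy) rfl (A := A)
    (u := R * U) (v := T * V) (σ := σ) (by rw [gram hRx, hU]) (by rw [gram hTy, hV])
    (by rw [← hA, hback hR, hback hT, hUV]) (fun u' v' σ' hu hv huv hσ' => by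
      have := hmax (R⁻¹ * u') (T⁻¹ * v') σ' ⟨by rw [gram' hR hRx, hu], by rw [gram' hT hTy, hv],
        by rw [hA, huv], hσ'⟩
      rwa [hA, huv, hUV, Matrix.trace_diagonal, Matrix.trace_diagonal] at this)
  exact ⟨h0, R⁻¹ * O, T⁻¹ * O', by rw [gram' hR hRx, hO], by rw [gram' hT hTy, hO'],
    fun k l => by rw [hA, hOO]⟩

end Canonical

/-! ## The scalar inequalities behind the optimality and Hessian bounds -/

section Scalars

variable {p D : ℕ} {s m : ℕ → ℝ}

theorem strictAnti_of_succ_lt (hs : ∀ i < p, s (i + 1) < s i) {i j : ℕ} (hij : i < j) (hj : j ≤ p) :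
    s j < s i := by
  induction j, hij using Nat.le_induction with
  | base => exact hs i (by omega)
  | succ j hij ih => exact (hs j (by omega)).trans (ih (by omega))

theorem anti_of_succ_lt (hs : ∀ i < p, s (i + 1) < s i) {i j : ℕ} (hij : i ≤ j) (hj : j ≤ p) :
    s j ≤ s i := by
  rcases hij.eq_or_lt with rfl | h
  · exact le_rfl
  · exact (strictAnti_of_succ_lt hs h hj).le

/-- The dual potential of the assignment problem with weights `m j * s k`. -/
def potential (p : ℕ) (m s : ℕ → ℝ) (k : ℕ) : ℝ :=
  ∑ i ∈ Finset.Ico k p, 1 / 2 * (m i + m (i + 1)) * (s i - s (i + 1))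

theorem potential_sub (m s : ℕ → ℝ) {j k : ℕ} (hjk : j ≤ k) (hk : k ≤ p) :
    potential p m s j - potential p m s k =
      ∑ i ∈ Finset.Ico j k, 1 / 2 * (m i + m (i + 1)) * (s i - s (i + 1)) := by
  rw [potential, potential, ← Finset.sum_Ico_consecutive _ hjk hk, add_sub_cancel_right]

theorem sum_Ico_mul_sub (c : ℝ) (s : ℕ → ℝ) {j k : ℕ} (hjk : j ≤ k) :
    ∑ i ∈ Finset.Ico j k, c * (s i - s (i + 1)) = c * (s j - s k) := by
  rw [← Finset.mul_sum]
  congr 1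
  induction k, hjk using Nat.le_induction with
  | base => simp
  | succ k hjk ih => rw [Finset.sum_Ico_succ_top hjk, ih]; ring

/-- The potential accumulates the decrements of `s`, weighted by averages of neighbouring `m`. As
`m` strictly decreases, `m j` exceeds the averages to the right of `j` and is below those to the
left, so both directions are strict. Beyond `p` the potential is zero and `s k ≤ s p`. -/
theorem potential_slack (hs : ∀ i < p, s (i + 1) < s i) (hsp : ∀ k, p ≤ k → s k ≤ s p)
    (hm : ∀ i < p, m (i + 1) < m i) (hmp : 0 ≤ m p) {j k : ℕ} (hj : j < p) (hjk : j ≠ k) :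
    m j * s k < m j * s j - potential p m s j + potential p m s k := by
  have hmid : ∀ k, j < k → k ≤ p →
      m j * s k < m j * s j - potential p m s j + potential p m s k := fun k hjk hk => by
    have h1 := potential_sub m s hjk.le hk
    have h2 := sum_Ico_mul_sub (m j) s hjk.le
    have h3 : ∑ i ∈ Finset.Ico j k, 1 / 2 * (m i + m (i + 1)) * (s i - s (i + 1)) <
        ∑ i ∈ Finset.Ico j k, m j * (s i - s (i + 1)) := by
      refine Finset.sum_lt_sum_of_nonempty (by simpa using hjk) fun i hi => ?_
      rw [Finset.mem_Ico] at hi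
      refine mul_lt_mul_of_pos_right ?_ (sub_pos.2 (hs i (by omega)))
      have e1 := anti_of_succ_lt hm hi.1 (by omega)
      have e2 := hm i (by omega)
      linarith
    linarith
  rcases lt_or_gt_of_ne hjk with h | h
  · rcases le_total k p with hk | hk
    · exact hmid k h hk
    · have h1 := hmid p hj le_rfl
      have h2 : potential p m s k = 0 := by rw [potential, Finset.Ico_eq_empty (by omega)]; rfl
      have h3 : potential p m s p = 0 := by rw [potential, Finset.Ico_self]; rfl
      have h4 : m j * s k ≤ m j * s p :=
        mul_le_mul_of_nonneg_left (hsp k hk) (hmp.trans (anti_of_succ_lt hm hj.le le_rfl))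
      linarith
  · have h1 := potential_sub m s h.le hj.le
    have h2 := sum_Ico_mul_sub (m j) s h.le
    have h3 : ∑ i ∈ Finset.Ico k j, m j * (s i - s (i + 1)) <
        ∑ i ∈ Finset.Ico k j, 1 / 2 * (m i + m (i + 1)) * (s i - s (i + 1)) := by
      refine Finset.sum_lt_sum_of_nonempty (by simpa using h) fun i hi => ?_
      rw [Finset.mem_Ico] at hi
      refine mul_lt_mul_of_pos_right ?_ (sub_pos.2 (hs i (by omega)))
      have e1 := strictAnti_of_succ_lt hm hi.2 hj.le
      have e2 : m j ≤ m (i + 1) := anti_of_succ_lt hm hi.2 hj.le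
      linarith
    linarith

/-- Complementary slackness: by the column sums and the row bounds, the objective is at most the
diagonal value minus `∑ c k j * d k j`. Optimality makes that sum vanish, and the reduced costs `c`
are strictly positive off the diagonal. -/
theorem assignment_unique (hpD : p ≤ D) (hs : ∀ i < p, s (i + 1) < s i)
    (hsp : ∀ k, p ≤ k → s k ≤ s p)
    (hm : ∀ i < p, m (i + 1) < m i) (hmp : 0 ≤ m p) {d : ℕ → ℕ → ℝ} (hd : ∀ k j, 0 ≤ d k j)
    (hcol : ∀ j < p, ∑ k ∈ Finset.range D, d k j = 1)
    (hrow : ∀ k < D, ∑ j ∈ Finset.range p, d k j ≤ 1)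
    (hopt : ∑ j ∈ Finset.range p, m j * s j ≤
      ∑ j ∈ Finset.range p, ∑ k ∈ Finset.range D, m j * s k * d k j) {j k : ℕ} (hj : j < p)
    (hk : k < D) (hjk : k ≠ j) : d k j = 0 := by
  set b := potential p m s
  set c : ℕ → ℕ → ℝ := fun k j => m j * s j - b j + b k - m j * s k
  have hc : ∀ j < p, ∀ k, 0 ≤ c k j := fun j hj k => by
    rcases eq_or_ne j k with rfl | h
    · simp [c]
    · exact (sub_pos.2 (potential_slack hs hsp hm hmp hj h)).le
  have hb : ∀ k, 0 ≤ b k := fun k => Finset.sum_nonneg fun i hi => by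
    rw [Finset.mem_Ico] at hi
    have e1 := hs i hi.2
    have e2 : m p ≤ m (i + 1) := anti_of_succ_lt hm (by omega) le_rfl
    have e3 := hm i hi.2
    exact mul_nonneg (by linarith) (by linarith)
  have hbsum : ∑ k ∈ Finset.range D, b k = ∑ k ∈ Finset.range p, b k := by
    refine (Finset.sum_subset (by simpa using hpD) fun k _ hk => ?_).symm
    simp only [Finset.mem_range, not_lt] at hk
    simp only [b, potential, Finset.Ico_eq_empty (by omega : ¬ k < p), Finset.sum_empty]
  have e1 : ∑ j ∈ Finset.range p, ∑ k ∈ Finset.range D, m j * s k * d k j =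
      ∑ j ∈ Finset.range p, (m j * s j - b j) + ∑ k ∈ Finset.range D, b k *
        ∑ j ∈ Finset.range p, d k j -
        ∑ j ∈ Finset.range p, ∑ k ∈ Finset.range D, c k j * d k j := by
    have h1 : ∑ j ∈ Finset.range p, (m j * s j - b j) =
        ∑ j ∈ Finset.range p, ∑ k ∈ Finset.range D, (m j * s j - b j) * d k j :=
      Finset.sum_congr rfl fun j hj => by
        rw [← Finset.mul_sum, hcol j (Finset.mem_range.1 hj), mul_one]
    have h2 : ∑ k ∈ Finset.range D, b k * ∑ j ∈ Finset.range p, d k j =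
        ∑ j ∈ Finset.range p, ∑ k ∈ Finset.range D, b k * d k j := by
      rw [Finset.sum_comm]; simp only [Finset.mul_sum]
    rw [h1, h2]
    simp only [← Finset.sum_add_distrib, ← Finset.sum_sub_distrib]
    refine Finset.sum_congr rfl fun j _ => Finset.sum_congr rfl fun k _ => ?_
    simp only [c]; ring
  have e2 : ∑ k ∈ Finset.range D, b k * ∑ j ∈ Finset.range p, d k j ≤
      ∑ k ∈ Finset.range D, b k := Finset.sum_le_sum fun k hk =>
    mul_le_of_le_one_right (hb k) (hrow k (Finset.mem_range.1 hk))
  have e3 : ∑ j ∈ Finset.range p, (m j * s j - b j) + ∑ k ∈ Finset.range p, b k =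
      ∑ j ∈ Finset.range p, m j * s j := by
    rw [← Finset.sum_add_distrib]; simp
  have hnn : ∀ j ∈ Finset.range p, 0 ≤ ∑ k ∈ Finset.range D, c k j * d k j := fun j hj =>
    Finset.sum_nonneg fun k _ => mul_nonneg (hc j (Finset.mem_range.1 hj) k) (hd k j)
  have h0 : ∑ j ∈ Finset.range p, ∑ k ∈ Finset.range D, c k j * d k j = 0 :=
    le_antisymm (by linarith) (Finset.sum_nonneg hnn)
  have h1 := (Finset.sum_eq_zero_iff_of_nonneg hnn).1 h0 j (Finset.mem_range.2 hj)
  have h2 := (Finset.sum_eq_zero_iff_of_nonneg fun k _ => mul_nonneg (hc j hj k) (hd k j)).1 h1 k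
    (Finset.mem_range.2 hk)
  exact (mul_eq_zero.1 h2).resolve_left
    (sub_pos.2 (potential_slack hs hsp hm hmp hj hjk.symm)).ne'

/-- Coordinates of an optimal pair of orthonormal systems. -/
theorem optimal_coordinates (hpD : p ≤ D) (hs : ∀ i < p, s (i + 1) < s i)
    (hsp : ∀ k, p ≤ k → s k ≤ s p) (hs0 : ∀ k, 0 ≤ s k)
    (hm : ∀ i < p, m (i + 1) < m i) (hmp : 0 ≤ m p) {x y : ℕ → ℕ → ℝ}
    (hxcol : ∀ j < p, ∑ k ∈ Finset.range D, x k j ^ 2 = 1)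
    (hycol : ∀ j < p, ∑ k ∈ Finset.range D, y k j ^ 2 = 1)
    (hxrow : ∀ k < D, ∑ j ∈ Finset.range p, x k j ^ 2 ≤ 1)
    (hyrow : ∀ k < D, ∑ j ∈ Finset.range p, y k j ^ 2 ≤ 1)
    (hopt : ∑ j ∈ Finset.range p, m j * s j ≤
      ∑ j ∈ Finset.range p, ∑ k ∈ Finset.range D, m j * s k * (x k j * y k j)) :
    (∀ j < p, ∀ k < D, k ≠ j → x k j = 0 ∧ y k j = 0) ∧ ∀ j < p, x j j ^ 2 = 1 ∧ y j j = x j j := by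
  have hm0 : ∀ j < p, 0 < m j := fun j hj =>
    hmp.trans_lt (strictAnti_of_succ_lt hm hj le_rfl)
  have hoff : ∀ j < p, ∀ k < D, k ≠ j → x k j = 0 ∧ y k j = 0 := fun j hj k hk hkj => by
    -- The averaged squares satisfy the column and row conditions and dominate `x k j * y k j`, so
    -- they too are optimal for the assignment problem.
    have h := assignment_unique (d := fun k j => (x k j ^ 2 + y k j ^ 2) / 2) hpD hs hsp hm hmp
      (fun k j => by positivity)
      (fun j hj => by
        rw [← Finset.sum_div, Finset.sum_add_distrib, hxcol j hj, hycol j hj]; norm_num)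
      (fun k hk => by
        have h1 := hxrow k hk
        have h2 := hyrow k hk
        rw [← Finset.sum_div, Finset.sum_add_distrib]; linarith)
      (hopt.trans (Finset.sum_le_sum fun j hj => Finset.sum_le_sum fun k _ =>
        mul_le_mul_of_nonneg_left (by nlinarith [sq_nonneg (x k j - y k j)])
          (mul_nonneg (hm0 j (Finset.mem_range.1 hj)).le (hs0 k)))) hj hk hkj
    have h1 : x k j ^ 2 = 0 := by nlinarith [sq_nonneg (x k j), sq_nonneg (y k j)]
    have h2 : y k j ^ 2 = 0 := by nlinarith [sq_nonneg (x k j), sq_nonneg (y k j)]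
    exact ⟨pow_eq_zero_iff two_ne_zero |>.1 h1, pow_eq_zero_iff two_ne_zero |>.1 h2⟩
  have hsingle : ∀ j < p, ∀ F : ℕ → ℝ, (∀ k < D, k ≠ j → F k = 0) →
      ∑ k ∈ Finset.range D, F k = F j := fun j hj F hF =>
    Finset.sum_eq_single_of_mem j (Finset.mem_range.2 (hj.trans_le hpD))
      fun k hk hkj => hF k (Finset.mem_range.1 hk) hkj
  have hx1 : ∀ j < p, x j j ^ 2 = 1 := fun j hj => by
    rw [← hxcol j hj]
    exact (hsingle j hj (fun k => x k j ^ 2) fun k hk hkj => by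
      simp [(hoff j hj k hk hkj).1]).symm
  have hy1 : ∀ j < p, y j j ^ 2 = 1 := fun j hj => by
    rw [← hycol j hj]
    exact (hsingle j hj (fun k => y k j ^ 2) fun k hk hkj => by
      simp [(hoff j hj k hk hkj).2]).symm
  refine ⟨hoff, fun j hj => ⟨hx1 j hj, ?_⟩⟩
  have h1 : ∑ j ∈ Finset.range p, ∑ k ∈ Finset.range D, m j * s k * (x k j * y k j) =
      ∑ j ∈ Finset.range p, m j * s j * (x j j * y j j) := Finset.sum_congr rfl fun j hj =>
    hsingle j (Finset.mem_range.1 hj) _ fun k hk hkj => by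
      rw [(hoff j (Finset.mem_range.1 hj) k hk hkj).1]; ring
  have hpos : ∀ j < p, 0 < m j * s j := fun j hj => mul_pos (hm0 j hj)
    ((hs0 p).trans_lt (strictAnti_of_succ_lt hs hj le_rfl))
  have hnn : ∀ j ∈ Finset.range p, 0 ≤ m j * s j * (1 - x j j * y j j) := fun j hj => by
    have hj' := Finset.mem_range.1 hj
    exact mul_nonneg (hpos j hj').le
      (by nlinarith [hx1 j hj', hy1 j hj', sq_nonneg (x j j - y j j)])
  have h2 : ∑ j ∈ Finset.range p, m j * s j * (1 - x j j * y j j) = 0 := by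
    refine le_antisymm ?_ (Finset.sum_nonneg hnn)
    simp only [mul_sub, mul_one, Finset.sum_sub_distrib]
    linarith
  have h3 := (Finset.sum_eq_zero_iff_of_nonneg hnn).1 h2 j (Finset.mem_range.2 hj)
  have h4 : 1 - x j j * y j j = 0 := (mul_eq_zero.1 h3).resolve_left (hpos j hj).ne'
  have h5 : (y j j - x j j) ^ 2 = 0 := by nlinarith [hx1 j hj, hy1 j hj]
  exact sub_eq_zero.1 (pow_eq_zero_iff two_ne_zero |>.1 h5)

theorem kappaDen_pos (hp : 1 ≤ p) (hs : ∀ i < p, s (i + 1) < s i)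
    (hm : ∀ i < p, m (i + 1) < m i) (hmp : 0 ≤ m p) : 0 < kappaDen p m s := by
  rw [kappaDen, Finset.lt_fold_min]
  have e1 := hs (p - 1) (by omega)
  have e2 := hm (p - 1) (by omega)
  rw [Nat.sub_add_cancel hp] at e1 e2
  refine ⟨mul_pos (hmp.trans_lt e2) (sub_pos.2 e1), fun j hj => ?_⟩
  rw [Finset.mem_range] at hj
  exact mul_pos (mul_pos one_half_pos (sub_pos.2 (hm j (by omega)))) (sub_pos.2 (hs j (by omega)))

theorem kappaDen_le_last : kappaDen p m s ≤ m (p - 1) * (s (p - 1) - s p) :=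
  (Finset.fold_min_le _).2 (Or.inl le_rfl)

theorem kappaDen_le_gap {j : ℕ} (hj : j < p - 1) :
    kappaDen p m s ≤ 1 / 2 * (m j - m (j + 1)) * (s j - s (j + 1)) :=
  (Finset.fold_min_le _).2 (Or.inr ⟨j, Finset.mem_range.2 hj, le_rfl⟩)

theorem last_le_kappaNum : m 0 * (s 0 + s p) ≤ kappaNum p m s := by
  rw [kappaNum]; split_ifs
  · exact le_max_left _ _
  · exact le_rfl

theorem pair_le_kappaNum (hp : 2 ≤ p) :
    1 / 2 * (m 0 + m 1) * (s 0 + s 1) ≤ kappaNum p m s := by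
  rw [kappaNum, if_pos hp]; exact le_max_right _ _

/-- Bounds for the Hessian quadratic form in canonical coordinates. -/
theorem hessian_form_bounds (hp : 1 ≤ p) (hpD : p ≤ D) (hs : ∀ i < p, s (i + 1) < s i)
    (hsp : ∀ k, p ≤ k → s k ≤ s p) (hs0 : ∀ k, 0 ≤ s k)
    (hm : ∀ i < p, m (i + 1) < m i) (hmp : 0 ≤ m p) {A C : ℕ → ℕ → ℝ}
    (hA : ∀ k j, 0 ≤ A k j) (hC : ∀ k j, |2 * C k j| ≤ A k j)
    (hAs : ∀ j < p, ∀ k < p, A k j = A j k) (hCs : ∀ j < p, ∀ k < p, C k j = C j k)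
    (hAd : ∀ j < p, A j j = 0) :
    kappaDen p m s * ∑ j ∈ Finset.range p, ∑ k ∈ Finset.range D, A k j ≤
      ∑ j ∈ Finset.range p, ∑ k ∈ Finset.range D, m j * (s j * A k j - s k * (2 * C k j)) ∧
    ∑ j ∈ Finset.range p, ∑ k ∈ Finset.range D, m j * (s j * A k j - s k * (2 * C k j)) ≤
      kappaNum p m s * ∑ j ∈ Finset.range p, ∑ k ∈ Finset.range D, A k j := by
  have hm0 : ∀ j, j ≤ p → 0 ≤ m j := fun j hj => hmp.trans (anti_of_succ_lt hm hj le_rfl)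
  set t : ℕ → ℕ → ℝ := fun j k => m j * (s j * A k j - s k * (2 * C k j))
  -- In the leading `p × p` block the symmetry of `A` and `C` ties `(j, k)` to `(k, j)`, so only the
  -- sum of the two terms can be bounded. Indices `k ≥ p` are free and are bounded one by one.
  have hsplit : ∀ F : ℕ → ℕ → ℝ, ∑ j ∈ Finset.range p, ∑ k ∈ Finset.range D, F j k =
      1 / 2 * ∑ j ∈ Finset.range p, ∑ k ∈ Finset.range p, (F j k + F k j) +
        ∑ j ∈ Finset.range p, ∑ k ∈ Finset.Ico p D, F j k := fun F => by
    have h1 : ∑ j ∈ Finset.range p, ∑ k ∈ Finset.range p, F k j =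
      ∑ j ∈ Finset.range p, ∑ k ∈ Finset.range p, F j k := Finset.sum_comm
    simp only [Finset.sum_add_distrib, h1]
    simp only [← Finset.sum_range_add_sum_Ico _ hpD, Finset.sum_add_distrib]
    ring
  have hin : ∀ j < p, ∀ k < p, kappaDen p m s * (A k j + A j k) ≤ t j k + t k j ∧
      t j k + t k j ≤ kappaNum p m s * (A k j + A j k) := by
    have main : ∀ j < p, ∀ k < p, j < k → kappaDen p m s * (A k j + A j k) ≤ t j k + t k j ∧
        t j k + t k j ≤ kappaNum p m s * (A k j + A j k) := fun j hj k hk hjk => by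
      have e : t j k + t k j = (m j * s j + m k * s k) * A k j -
          (m j * s k + m k * s j) * (2 * C k j) := by
        simp only [t, hAs k hk j hj, hCs k hk j hj]; ring
      have hc := abs_le.1 (hC k j)
      have hA0 := hA k j
      have hw : 0 ≤ m j * s k + m k * s j :=
        add_nonneg (mul_nonneg (hm0 j hj.le) (hs0 k)) (mul_nonneg (hm0 k hk.le) (hs0 j))
      have h1 := mul_le_mul_of_nonneg_left hc.1 hw
      have h2 := mul_le_mul_of_nonneg_left hc.2 hw
      rw [e, ← hAs j hj k hk]
      constructor
      · have g1 : m (j + 1) ≥ m k := anti_of_succ_lt hm hjk hk.le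
        have g2 : s (j + 1) ≥ s k := anti_of_succ_lt hs hjk hk.le
        have g3 := hm j hj
        have g4 := hs j hj
        -- Consecutive gaps suffice: by monotonicity the product of gaps from `j` to `k` is at least
        -- the one from `j` to `j + 1`.
        have h3 : kappaDen p m s ≤ 1 / 2 * (m j - m k) * (s j - s k) :=
          (kappaDen_le_gap (j := j) (by omega)).trans
            (mul_le_mul (by linarith) (by linarith) (by linarith) (by linarith))
        have h4 := mul_le_mul_of_nonneg_right h3 hA0
        linarith
      · have g1 : m j ≤ m 0 := anti_of_succ_lt hm (Nat.zero_le _) hj.le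
        have g2 : s j ≤ s 0 := anti_of_succ_lt hs (Nat.zero_le _) hj.le
        have g3 : m k ≤ m 1 := anti_of_succ_lt hm (by omega) hk.le
        have g4 : s k ≤ s 1 := anti_of_succ_lt hs (by omega) hk.le
        have g5 := hm0 j hj.le
        have g6 := hm0 k hk.le
        have h3 : 1 / 2 * (m j + m k) * (s j + s k) ≤ kappaNum p m s :=
          le_trans (mul_le_mul (by linarith) (by linarith) (add_nonneg (hs0 _) (hs0 _))
            (by linarith)) (pair_le_kappaNum (by omega))
        have h4 := mul_le_mul_of_nonneg_right h3 hA0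
        linarith
    intro j hj k hk
    rcases lt_trichotomy j k with h | rfl | h
    · exact main j hj k hk h
    · have hc : C j j = 0 := by
        have := hC j j
        rw [hAd j hj] at this
        have := abs_eq_zero.1 (le_antisymm this (abs_nonneg _))
        linarith
      simp [t, hAd j hj, hc]
    · have := main k hk j hj h
      rw [add_comm (A k j), add_comm (t j k)]
      exact this
  have hout : ∀ j < p, ∀ k, p ≤ k → kappaDen p m s * A k j ≤ t j k ∧
      t j k ≤ kappaNum p m s * A k j := fun j hj k hk => by
    have hc := abs_le.1 (hC k j)
    have hA0 := hA k j
    have hw : 0 ≤ m j * s k := mul_nonneg (hm0 j hj.le) (hs0 k)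
    have h1 := mul_le_mul_of_nonneg_left hc.1 hw
    have h2 := mul_le_mul_of_nonneg_left hc.2 hw
    have hk' := hsp k hk
    have e : t j k = m j * s j * A k j - m j * s k * (2 * C k j) := by simp only [t]; ring
    rw [e]
    constructor
    · have g1 : m (p - 1) ≤ m j := anti_of_succ_lt hm (by omega) (by omega)
      have g2 : s (p - 1) ≤ s j := anti_of_succ_lt hs (by omega) (by omega)
      have g3 : s p ≤ s (p - 1) := anti_of_succ_lt hs (by omega) le_rfl
      have h3 : kappaDen p m s ≤ m j * (s j - s k) := kappaDen_le_last.trans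
        (mul_le_mul g1 (by linarith) (by linarith) (hm0 j hj.le))
      have h4 := mul_le_mul_of_nonneg_right h3 hA0
      linarith
    · have g1 : m j ≤ m 0 := anti_of_succ_lt hm (Nat.zero_le _) hj.le
      have g2 : s j ≤ s 0 := anti_of_succ_lt hs (Nat.zero_le _) hj.le
      have h3 : m j * (s j + s k) ≤ kappaNum p m s := le_trans
        (mul_le_mul g1 (by linarith) (add_nonneg (hs0 _) (hs0 _)) (hm0 0 (by omega)))
        last_le_kappaNum
      have h4 := mul_le_mul_of_nonneg_right h3 hA0
      linarith
  rw [hsplit t, hsplit fun j k => A k j]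
  constructor
  · have h1 : kappaDen p m s * ∑ j ∈ Finset.range p, ∑ k ∈ Finset.range p, (A k j + A j k) ≤
        ∑ j ∈ Finset.range p, ∑ k ∈ Finset.range p, (t j k + t k j) := by
      simp only [Finset.mul_sum]
      exact Finset.sum_le_sum fun j hj => Finset.sum_le_sum fun k hk =>
        (hin j (Finset.mem_range.1 hj) k (Finset.mem_range.1 hk)).1
    have h2 : kappaDen p m s * ∑ j ∈ Finset.range p, ∑ k ∈ Finset.Ico p D, A k j ≤
        ∑ j ∈ Finset.range p, ∑ k ∈ Finset.Ico p D, t j k := by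
      simp only [Finset.mul_sum]
      exact Finset.sum_le_sum fun j hj => Finset.sum_le_sum fun k hk =>
        (hout j (Finset.mem_range.1 hj) k (Finset.mem_Ico.1 hk).1).1
    linarith
  · have h1 : ∑ j ∈ Finset.range p, ∑ k ∈ Finset.range p, (t j k + t k j) ≤
        kappaNum p m s * ∑ j ∈ Finset.range p, ∑ k ∈ Finset.range p, (A k j + A j k) := by
      simp only [Finset.mul_sum]
      exact Finset.sum_le_sum fun j hj => Finset.sum_le_sum fun k hk =>
        (hin j (Finset.mem_range.1 hj) k (Finset.mem_range.1 hk)).2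
    have h2 : ∑ j ∈ Finset.range p, ∑ k ∈ Finset.Ico p D, t j k ≤
        kappaNum p m s * ∑ j ∈ Finset.range p, ∑ k ∈ Finset.Ico p D, A k j := by
      simp only [Finset.mul_sum]
      exact Finset.sum_le_sum fun j hj => Finset.sum_le_sum fun k hk =>
        (hout j (Finset.mem_range.1 hj) k (Finset.mem_Ico.1 hk).1).2
    linarith

end Scalars

/-! ## Canonical coordinates -/

/-- Extension of a matrix by zero. -/
def ext2 {d p : ℕ} (x : Matrix (Fin d) (Fin p) ℝ) (k j : ℕ) : ℝ :=
  if h : k < d ∧ j < p then x ⟨k, h.1⟩ ⟨j, h.2⟩ else 0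

/-- The rectangular diagonal matrix with diagonal entries `s 0, s 1, …`. -/
def rectDiag (d e : ℕ) (s : ℕ → ℝ) : Matrix (Fin d) (Fin e) ℝ :=
  Matrix.of fun k l => if (k : ℕ) = l then s k else 0

section Coordinates

variable {d e p D : ℕ}

@[simp] theorem ext2_fin (x : Matrix (Fin d) (Fin p) ℝ) (k : Fin d) (j : Fin p) :
    ext2 x k j = x k j := by simp [ext2]

@[simp] theorem ext0_fin (v : Fin p → ℝ) (j : Fin p) : ext0 v j = v j := by simp [ext0]

theorem ext2_of_le (x : Matrix (Fin d) (Fin p) ℝ) {k : ℕ} (hk : d ≤ k) (j : ℕ) : ext2 x k j = 0 :=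
  dif_neg (by omega)

/-- Padding by zeros lets coordinates of the two factors, of different dimensions, be summed over
one common range. -/
theorem sum_range_ext2 (hd : d ≤ D) (x : Matrix (Fin d) (Fin p) ℝ) {F : ℕ → ℕ → ℝ}
    (hF : ∀ k j, ext2 x k j = 0 → F k j = 0) :
    ∑ j ∈ Finset.range p, ∑ k ∈ Finset.range D, F k j = ∑ j : Fin p, ∑ k : Fin d, F k j := by
  rw [Finset.sum_range]
  refine Finset.sum_congr rfl fun j _ => ?_
  rw [← Finset.sum_range (fun k => F k j)]
  refine (Finset.sum_subset (Finset.range_subset_range.2 hd) fun k _ hk => ?_).symm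
  exact hF _ _ (ext2_of_le x (by simpa using hk) _)

theorem rectDiag_transpose (s : ℕ → ℝ) : (rectDiag d e s)ᵀ = rectDiag e d s := by
  ext k l
  simp only [rectDiag, transpose_apply, of_apply]
  split_ifs with h1 h2 h2
  · rw [h1]
  · exact absurd h1.symm h2
  · exact absurd h2.symm h1
  · rfl

theorem rectDiag_mul_apply (s : ℕ → ℝ) (b : Matrix (Fin e) (Fin p) ℝ) (k : Fin d) (j : Fin p) :
    (rectDiag d e s * b) k j = s k * ext2 b k j := by
  simp only [rectDiag, mul_apply, of_apply, ite_mul, zero_mul]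
  by_cases h : (k : ℕ) < e
  · rw [Finset.sum_eq_single_of_mem (⟨k, h⟩ : Fin e) (Finset.mem_univ _)]
    · simp [ext2, h]
    · intro l _ hl
      exact if_neg fun h' => hl (Fin.ext h'.symm)
  · rw [ext2_of_le b (not_lt.1 h), mul_zero]
    exact Finset.sum_eq_zero fun l _ => if_neg fun h' : (k : ℕ) = l => h (h' ▸ l.2)

theorem trace_rectDiag (hd : d ≤ D) (s : ℕ → ℝ) (w : Fin p → ℝ) (a : Matrix (Fin d) (Fin p) ℝ)
    (b : Matrix (Fin e) (Fin p) ℝ) :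
    (aᵀ * (rectDiag d e s * b * diagonal w)).trace =
      ∑ j ∈ Finset.range p, ∑ k ∈ Finset.range D, ext0 w j * s k * (ext2 a k j * ext2 b k j) := by
  rw [sum_range_ext2 hd a fun k j h => by rw [h]; ring]
  refine Finset.sum_congr rfl fun j _ => ?_
  rw [diag_apply, mul_apply]
  refine Finset.sum_congr rfl fun k _ => ?_
  rw [mul_diagonal, rectDiag_mul_apply, transpose_apply, ext2_fin, ext0_fin]
  ring

theorem trace_mul_diagonal (hd : d ≤ D) (w : Fin p → ℝ) (a b : Matrix (Fin d) (Fin p) ℝ) :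
    (aᵀ * (b * diagonal w)).trace =
      ∑ j ∈ Finset.range p, ∑ k ∈ Finset.range D, ext0 w j * (ext2 a k j * ext2 b k j) := by
  rw [sum_range_ext2 hd a fun k j h => by rw [h]; ring]
  refine Finset.sum_congr rfl fun j _ => ?_
  rw [diag_apply, mul_apply]
  refine Finset.sum_congr rfl fun k _ => ?_
  rw [mul_diagonal, transpose_apply, ext2_fin, ext2_fin, ext0_fin]
  ring

theorem trace_transpose_mul_self_eq (hd : d ≤ D) (a : Matrix (Fin d) (Fin p) ℝ) :
    (aᵀ * a).trace = ∑ j ∈ Finset.range p, ∑ k ∈ Finset.range D, ext2 a k j ^ 2 := by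
  rw [sum_range_ext2 hd a fun k j h => by rw [h]; ring]
  refine Finset.sum_congr rfl fun j _ => ?_
  rw [diag_apply, mul_apply]
  refine Finset.sum_congr rfl fun k _ => ?_
  rw [transpose_apply, ext2_fin, sq]

theorem sum_sq_column (hd : d ≤ D) {x : Matrix (Fin d) (Fin p) ℝ} (hx : xᵀ * x = 1) {j : ℕ}
    (hj : j < p) : ∑ k ∈ Finset.range D, ext2 x k j ^ 2 = 1 := by
  have h := congrFun (congrFun hx ⟨j, hj⟩) ⟨j, hj⟩
  rw [mul_apply, one_apply_eq] at h
  rw [← h, ← Finset.sum_subset (Finset.range_subset_range.2 hd) fun k _ hk => by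
    rw [ext2_of_le x (by simpa using hk)]; ring, Finset.sum_range]
  exact Finset.sum_congr rfl fun k _ => by
    rw [transpose_apply, sq, ← ext2_fin x k ⟨j, hj⟩]

/-- The sum is a diagonal entry `q` of the orthogonal projection `x * xᵀ`, and idempotence gives `q
^ 2 ≤ q`. -/
theorem sum_sq_row_le {x : Matrix (Fin d) (Fin p) ℝ} (hx : xᵀ * x = 1) (k : ℕ) :
    ∑ j ∈ Finset.range p, ext2 x k j ^ 2 ≤ 1 := by
  by_cases hk : k < d
  · set K : Fin d := ⟨k, hk⟩
    set Q := x * xᵀ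
    have hQ : Q * Q = Q := by
      simp only [Q]
      rw [Matrix.mul_assoc, ← Matrix.mul_assoc xᵀ, hx, Matrix.one_mul]
    have hQs : ∀ l, Q l K = Q K l := fun l => by
      have : Qᵀ = Q := by simp [Q, transpose_mul]
      exact congrFun (congrFun this K) l
    have h1 : ∑ j ∈ Finset.range p, ext2 x k j ^ 2 = Q K K := by
      change _ = (x * xᵀ) K K
      rw [Finset.sum_range, mul_apply]
      exact Finset.sum_congr rfl fun j _ => by
        rw [transpose_apply, sq, ← ext2_fin x K j]
    have h2 : Q K K ^ 2 ≤ Q K K := by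
      conv_rhs => rw [← hQ, mul_apply]
      calc Q K K ^ 2 = Q K K * Q K K := sq _
        _ ≤ _ := Finset.single_le_sum (f := fun l => Q K l * Q l K)
          (fun l _ => by rw [hQs]; exact mul_self_nonneg _) (Finset.mem_univ K)
    rw [h1]
    nlinarith
  · simp [ext2_of_le x (not_lt.1 hk)]

theorem ext0_succ_lt {w : Fin p → ℝ} (hw : StrictAnti w) (hw0 : ∀ i, 0 < w i) {i : ℕ} (hi : i < p) :
    ext0 w (i + 1) < ext0 w i := by
  unfold ext0
  rw [dif_pos hi]
  split_ifs with h
  · exact hw (by simp)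
  · exact hw0 _

theorem ext0_self (w : Fin p → ℝ) : ext0 w p = 0 := dif_neg (lt_irrefl p)

theorem ext0_anti {w : Fin p → ℝ} (hw : Antitone w) (hw0 : ∀ i, 0 ≤ w i) {i j : ℕ} (hij : i ≤ j) :
    ext0 w j ≤ ext0 w i := by
  unfold ext0
  split_ifs with h1 h2 h2
  · exact hw hij
  · omega
  · exact hw0 _
  · exact le_rfl

theorem ext0_nonneg {w : Fin p → ℝ} (hw0 : ∀ i, 0 ≤ w i) (i : ℕ) : 0 ≤ ext0 w i := by
  unfold ext0
  split_ifs
  · exact hw0 _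
  · exact le_rfl

/-- Tangent vectors at a diagonal point. -/
theorem tangent_coordinates {ε : ℕ → ℝ} {a : Matrix (Fin d) (Fin p) ℝ}
    (ha : aᵀ * rectDiag d p ε + (rectDiag d p ε)ᵀ * a = 0) {l j : ℕ} (hl : l < p) (hj : j < p) :
    ε j * ext2 a j l + ε l * ext2 a l j = 0 := by
  have key : ∀ (l j : Fin p), ((rectDiag d p ε)ᵀ * a) l j = ε l * ext2 a l j := fun l j => by
    rw [rectDiag_transpose, rectDiag_mul_apply]
  have h := congrFun (congrFun ha ⟨l, hl⟩) ⟨j, hj⟩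
  have e : aᵀ * rectDiag d p ε = ((rectDiag d p ε)ᵀ * a)ᵀ := by simp [transpose_mul]
  rw [Matrix.add_apply, e, transpose_apply, key, key] at h
  exact h

end Coordinates

/-! ## Minimizers and the Hessian in canonical coordinates -/

/-- Bases in which both Gram matrices are the identity and `XᵀY` is diagonal with entries `s`. -/
structure IsCanonicalBasis {n dx dy p : ℕ} (P : CCAProblem n dx dy p) (s : ℕ → ℝ)
    (U : Matrix (Fin dx) (Fin dx) ℝ) (V : Matrix (Fin dy) (Fin dy) ℝ) : Prop where
  gram_left : Uᵀ * P.Sxx * U = 1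
  gram_right : Vᵀ * P.Syy * V = 1
  cross : Uᵀ * P.Sxy * V = rectDiag dx dy s

theorem exists_coordinates {d p : ℕ} {B U : Matrix (Fin d) (Fin d) ℝ} (h : Uᵀ * B * U = 1)
    (z : Matrix (Fin d) (Fin p) ℝ) : ∃ x : Matrix (Fin d) (Fin p) ℝ, z = U * x :=
  ⟨Uᵀ * B * z, by rw [← Matrix.mul_assoc, mul_eq_one_comm.1 h, Matrix.one_mul]⟩

theorem gram_coordinates {d p q : ℕ} {B U : Matrix (Fin d) (Fin d) ℝ} (h : Uᵀ * B * U = 1)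
    (a : Matrix (Fin d) (Fin p) ℝ) (b : Matrix (Fin d) (Fin q) ℝ) :
    (U * a)ᵀ * B * (U * b) = aᵀ * b := by
  calc (U * a)ᵀ * B * (U * b) = aᵀ * (Uᵀ * B * U) * b := by
        rw [transpose_mul]; simp only [Matrix.mul_assoc]
    _ = aᵀ * b := by rw [h, Matrix.mul_one]

namespace IsCanonicalBasis

variable {n dx dy p D : ℕ} {P : CCAProblem n dx dy p} {s : ℕ → ℝ}
  {U : Matrix (Fin dx) (Fin dx) ℝ} {V : Matrix (Fin dy) (Fin dy) ℝ}

theorem sxy_mul (h : IsCanonicalBasis P s U V) :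
    P.Sxy * V = P.Sxx * U * rectDiag dx dy s := by
  have e : P.Sxx * U * Uᵀ = 1 := mul_eq_one_comm.1 (by rw [← Matrix.mul_assoc]; exact h.gram_left)
  rw [← h.cross, ← Matrix.mul_assoc, ← Matrix.mul_assoc, e, Matrix.one_mul]

theorem sxy_transpose_mul (h : IsCanonicalBasis P s U V) :
    P.Sxyᵀ * U = P.Syy * V * rectDiag dy dx s := by
  have e : P.Syy * V * Vᵀ = 1 := mul_eq_one_comm.1 (by rw [← Matrix.mul_assoc]; exact h.gram_right)
  rw [← rectDiag_transpose, ← h.cross, transpose_mul, transpose_mul, transpose_transpose,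
    ← Matrix.mul_assoc, e, Matrix.one_mul]

theorem trace_cross (h : IsCanonicalBasis P s U V) (hD : dx ≤ D) (a : Matrix (Fin dx) (Fin p) ℝ)
    (b : Matrix (Fin dy) (Fin p) ℝ) : ((U * a)ᵀ * (P.Sxy * (V * b) * P.N)).trace =
      ∑ j ∈ Finset.range p, ∑ k ∈ Finset.range D,
        ext0 P.mu j * s k * (ext2 a k j * ext2 b k j) := by
  rw [← trace_rectDiag hD, ← h.cross, CCAProblem.N, transpose_mul]
  simp only [Matrix.mul_assoc]

theorem trace_cross' (h : IsCanonicalBasis P s U V) (hD : dy ≤ D) (a : Matrix (Fin dx) (Fin p) ℝ)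
    (b : Matrix (Fin dy) (Fin p) ℝ) : ((V * b)ᵀ * (P.Sxyᵀ * (U * a) * P.N)).trace =
      ∑ j ∈ Finset.range p, ∑ k ∈ Finset.range D,
        ext0 P.mu j * s k * (ext2 b k j * ext2 a k j) := by
  rw [← trace_rectDiag hD, ← rectDiag_transpose, ← h.cross, CCAProblem.N]
  simp only [transpose_mul, transpose_transpose, Matrix.mul_assoc]

/-- Comparison with the diagonal point with all signs `1` makes the coordinates optimal in the sense
of `optimal_coordinates`. The same signs `ε` occur in both blocks, which the Hessian bound relies
on. -/
theorem minimizer_eq (h : IsCanonicalBasis P s U V) (hpx : p ≤ dx) (hpy : p ≤ dy)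
    (hs : ∀ i < p, s (i + 1) < s i) (hsp : ∀ k, p ≤ k → s k ≤ s p) (hs0 : ∀ k, 0 ≤ s k)
    (hm : StrictAnti P.mu) (hm0 : ∀ i, 0 < P.mu i) {G : Geometry dx dy} (hB1 : G.B1 = P.Sxx)
    (hB2 : G.B2 = P.Syy) {Z : Pt dx dy p} (hZ : Z ∈ G.manifold p)
    (hmin : IsMinOn P.cost (G.manifold p) Z) :
    ∃ ε : ℕ → ℝ, (∀ j < p, ε j ^ 2 = 1) ∧ Z = (U * rectDiag dx p ε, V * rectDiag dy p ε) := by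
  obtain ⟨z1, z2⟩ := Z
  obtain ⟨x, rfl⟩ := exists_coordinates h.gram_left z1
  obtain ⟨y, rfl⟩ := exists_coordinates h.gram_right z2
  have hx : xᵀ * x = 1 := by
    rw [← gram_coordinates h.gram_left, ← hB1]; exact hZ.1
  have hy : yᵀ * y = 1 := by
    rw [← gram_coordinates h.gram_right, ← hB2]; exact hZ.2
  have hone : ∀ {d : ℕ}, p ≤ d → (rectDiag d p fun _ => 1)ᵀ * rectDiag d p (fun _ => 1) = 1 := by
    intro d hd
    ext i j
    have hi : (i : ℕ) < d := i.2.trans_le hd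
    rw [rectDiag_transpose, rectDiag_mul_apply, one_apply, ext2, dif_pos ⟨hi, j.2⟩]
    simp [rectDiag, Fin.ext_iff]
  set D := max dx dy
  have hDx : dx ≤ D := le_max_left _ _
  have hDy : dy ≤ D := le_max_right _ _
  have hpD : p ≤ D := hpx.trans hDx
  have hstar : ∑ j ∈ Finset.range p, ∑ k ∈ Finset.range D, ext0 P.mu j * s k *
      (ext2 (rectDiag dx p fun _ => 1) k j * ext2 (rectDiag dy p fun _ => 1) k j) =
      ∑ j ∈ Finset.range p, ext0 P.mu j * s j := by
    refine Finset.sum_congr rfl fun j hj => ?_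
    rw [Finset.mem_range] at hj
    rw [Finset.sum_eq_single_of_mem j (Finset.mem_range.2 (hj.trans_le hpD)) fun k _ hk => by
      simp [ext2, rectDiag, hk]]
    rw [ext2, ext2, dif_pos ⟨hj.trans_le hpx, hj⟩, dif_pos ⟨hj.trans_le hpy, hj⟩]
    simp [rectDiag]
  have hle := isMinOn_iff.1 hmin (U * rectDiag dx p fun _ => 1, V * rectDiag dy p fun _ => 1) (by
    constructor
    · simp only
      rw [hB1, gram_coordinates h.gram_left, hone hpx]
    · simp only
      rw [hB2, gram_coordinates h.gram_right, hone hpy])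
  rw [P.cost_eq, P.cost_eq, h.trace_cross hDx, h.trace_cross hDx, hstar, neg_le_neg_iff] at hle
  obtain ⟨hoff, hdiag⟩ := optimal_coordinates hpD hs hsp hs0
    (fun i hi => ext0_succ_lt hm hm0 hi) (ext0_self _).ge
    (fun j hj => sum_sq_column hDx hx hj) (fun j hj => sum_sq_column hDy hy hj)
    (fun k _ => sum_sq_row_le hx k) (fun k _ => sum_sq_row_le hy k) hle
  refine ⟨fun j => ext2 x j j, fun j hj => (hdiag j hj).1, ?_⟩
  congr 2
  · ext k j
    simp only [rectDiag, of_apply]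
    split_ifs with hkj
    · rw [← ext2_fin x k j, hkj]
    · rw [← ext2_fin x k j, (hoff j j.2 k (k.2.trans_le hDx) hkj).1]
  · ext k j
    simp only [rectDiag, of_apply]
    split_ifs with hkj
    · rw [← ext2_fin y k j, hkj, (hdiag j j.2).2]
    · rw [← ext2_fin y k j, (hoff j j.2 k (k.2.trans_le hDy) hkj).2]

/-- The critical point equation in coordinates: it identifies the Lagrange multiplier of both
constraints, independently of the signs `ε`. -/
theorem _root_.SketchCCA.rectDiag_mul_critical {d e p : ℕ} (hpe : p ≤ e) (s ε : ℕ → ℝ) (w : Fin p → ℝ) :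
    -(rectDiag d e s * rectDiag e p ε * diagonal w) =
      rectDiag d p ε * diagonal fun j => -(w j * s j) := by
  ext k j
  have hj : (j : ℕ) < e := j.2.trans_le hpe
  rw [Matrix.neg_apply, mul_diagonal, mul_diagonal, rectDiag_mul_apply]
  by_cases hkj : (k : ℕ) = j
  · simp only [ext2, rectDiag, of_apply, hkj, dif_pos (And.intro hj j.2), if_true]
    ring
  · simp [ext2, rectDiag, hkj]

/-- Bounds on the Hessian at a minimizer by the canonical quadratic form. -/
theorem hess_bounds (h : IsCanonicalBasis P s U V) (hp : 1 ≤ p) (hpx : p ≤ dx) (hpy : p ≤ dy)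
    (hs : ∀ i < p, s (i + 1) < s i) (hsp : ∀ k, p ≤ k → s k ≤ s p) (hs0 : ∀ k, 0 ≤ s k)
    (hm : StrictAnti P.mu) (hm0 : ∀ i, 0 < P.mu i) (hx : P.Sxx.PosDef) (hy : P.Syy.PosDef)
    {G : Geometry dx dy} (hB1 : G.B1 = P.Sxx) (hB2 : G.B2 = P.Syy) (h1 : G.M1.PosDef)
    (h2 : G.M2.PosDef) {Z : Pt dx dy p} (hZ : Z ∈ G.manifold p)
    (hmin : IsMinOn P.cost (G.manifold p) Z) {ξ : Pt dx dy p} (hξ : ξ ∈ G.tangent Z) :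
    kappaDen p (ext0 P.mu) s * ((ξ.1ᵀ * P.Sxx * ξ.1).trace + (ξ.2ᵀ * P.Syy * ξ.2).trace) ≤
      G.inner ξ (G.hess P.cost Z ξ) ∧
    G.inner ξ (G.hess P.cost Z ξ) ≤
      kappaNum p (ext0 P.mu) s * ((ξ.1ᵀ * P.Sxx * ξ.1).trace + (ξ.2ᵀ * P.Syy * ξ.2).trace) := by
  obtain ⟨ε, hε, hZε⟩ := h.minimizer_eq hpx hpy hs hsp hs0 hm hm0 hB1 hB2 hZ hmin
  obtain ⟨ξ1, ξ2⟩ := ξ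
  obtain ⟨a, rfl⟩ := exists_coordinates h.gram_left ξ1
  obtain ⟨b, rfl⟩ := exists_coordinates h.gram_right ξ2
  set D := max dx dy
  have hDx : dx ≤ D := le_max_left _ _
  have hDy : dy ≤ D := le_max_right _ _
  set Λ : Matrix (Fin p) (Fin p) ℝ := diagonal fun j => -(P.mu j * s j)
  have hH := inner_hess P h1 h2 (by rw [hB1]; exact hx.isSymm) (by rw [hB2]; exact hy.isSymm) hZ
    (Λ1 := Λ) (Λ2 := Λ) (diagonal_transpose _) (diagonal_transpose _)
    (by
      rw [hZε, hB1, CCAProblem.N]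
      simp only [← Matrix.mul_assoc]
      rw [h.sxy_mul, Matrix.mul_assoc (P.Sxx * U), Matrix.mul_assoc (P.Sxx * U), ← Matrix.mul_neg,
        rectDiag_mul_critical hpy, ← Matrix.mul_assoc])
    (by
      rw [hZε, hB2, CCAProblem.N]
      simp only [← Matrix.mul_assoc]
      rw [h.sxy_transpose_mul, Matrix.mul_assoc (P.Syy * V), Matrix.mul_assoc (P.Syy * V),
        ← Matrix.mul_neg, rectDiag_mul_critical hpx, ← Matrix.mul_assoc]) (U * a, V * b) hξ
  have hΛ : ∀ j < p, ext0 (fun j : Fin p => -(P.mu j * s j)) j = -(ext0 P.mu j * s j) :=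
    fun j hj => by simp [ext0, hj]
  have hH' : G.inner (U * a, V * b) (G.hess P.cost Z (U * a, V * b)) =
      ∑ j ∈ Finset.range p, ∑ k ∈ Finset.range D, ext0 P.mu j *
        (s j * (ext2 a k j ^ 2 + ext2 b k j ^ 2) - s k * (2 * (ext2 a k j * ext2 b k j))) := by
    have e1 : ((U * a)ᵀ * (P.Sxx * (U * a) * Λ)).trace = (aᵀ * (a * Λ)).trace := by
      simp only [← Matrix.mul_assoc]
      rw [Matrix.mul_assoc (_ * P.Sxx), gram_coordinates h.gram_left]
    have e2 : ((V * b)ᵀ * (P.Syy * (V * b) * Λ)).trace = (bᵀ * (b * Λ)).trace := by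
      simp only [← Matrix.mul_assoc]
      rw [Matrix.mul_assoc (_ * P.Syy), gram_coordinates h.gram_right]
    rw [hH]
    simp only [Matrix.mul_sub, Matrix.mul_neg, trace_sub, trace_neg]
    rw [hB1, hB2, e1, e2, h.trace_cross hDx, h.trace_cross' hDy, trace_mul_diagonal hDx,
      trace_mul_diagonal hDy]
    simp only [← Finset.sum_neg_distrib, ← Finset.sum_sub_distrib, ← Finset.sum_add_distrib]
    refine Finset.sum_congr rfl fun j hj => Finset.sum_congr rfl fun k _ => ?_
    rw [hΛ j (Finset.mem_range.1 hj)]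
    ring
  have hT : ((U * a)ᵀ * P.Sxx * (U * a)).trace + ((V * b)ᵀ * P.Syy * (V * b)).trace =
      ∑ j ∈ Finset.range p, ∑ k ∈ Finset.range D, (ext2 a k j ^ 2 + ext2 b k j ^ 2) := by
    rw [gram_coordinates h.gram_left, gram_coordinates h.gram_right,
      trace_transpose_mul_self_eq hDx, trace_transpose_mul_self_eq hDy]
    simp only [← Finset.sum_add_distrib]
  have ha : ∀ j < p, ∀ k < p, ε k * ext2 a k j + ε j * ext2 a j k = 0 := fun j hj k hk => by
    refine tangent_coordinates ?_ hj hk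
    rw [← gram_coordinates h.gram_left a, ← gram_coordinates h.gram_left _ a, ← hB1]
    simpa only [hZε] using hξ.1
  have hb : ∀ j < p, ∀ k < p, ε k * ext2 b k j + ε j * ext2 b j k = 0 := fun j hj k hk => by
    refine tangent_coordinates ?_ hj hk
    rw [← gram_coordinates h.gram_right b, ← gram_coordinates h.gram_right _ b, ← hB2]
    simpa only [hZε] using hξ.2
  -- Tangency means `u k j = -(ε j * ε k) * u j k`, with the same sign for both blocks, so products
  -- of two such entries are symmetric in `j` and `k`.
  have hprod : ∀ {u v : ℕ → ℕ → ℝ}, (∀ j < p, ∀ k < p, ε k * u k j + ε j * u j k = 0) →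
      (∀ j < p, ∀ k < p, ε k * v k j + ε j * v j k = 0) → ∀ j < p, ∀ k < p,
      u k j * v k j = u j k * v j k := fun {u v} hu hv j hj k hk => by
    have e1 : ε k * u k j = -(ε j * u j k) := eq_neg_of_add_eq_zero_left (hu j hj k hk)
    have e2 : ε k * v k j = -(ε j * v j k) := eq_neg_of_add_eq_zero_left (hv j hj k hk)
    calc u k j * v k j = ε k ^ 2 * (u k j * v k j) := by rw [hε k hk, one_mul]
      _ = (ε k * u k j) * (ε k * v k j) := by ring
      _ = ε j ^ 2 * (u j k * v j k) := by rw [e1, e2]; ring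
      _ = u j k * v j k := by rw [hε j hj, one_mul]
  have hzero : ∀ {u : ℕ → ℕ → ℝ}, (∀ j < p, ∀ k < p, ε k * u k j + ε j * u j k = 0) →
      ∀ j < p, u j j = 0 := fun {u} hu j hj => by
    have e1 := hu j hj j hj
    have e2 : ε j ≠ 0 := fun h0 => by have := hε j hj; rw [h0] at this; norm_num at this
    exact (mul_eq_zero.1 (by linarith : ε j * u j j = 0)).resolve_left e2
  rw [hH', hT]
  refine hessian_form_bounds hp (hpx.trans hDx) hs hsp hs0 (fun i hi => ext0_succ_lt hm hm0 hi)
    (ext0_self _).ge (A := fun k j => ext2 a k j ^ 2 + ext2 b k j ^ 2)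
    (C := fun k j => ext2 a k j * ext2 b k j) (fun k j => by positivity)
    (fun k j => abs_le.2 ⟨?_, ?_⟩) (fun j hj k hk => ?_) (fun j hj k hk => hprod ha hb j hj k hk)
    fun j hj => by simp [hzero ha j hj, hzero hb j hj]
  · nlinarith [sq_nonneg (ext2 a k j + ext2 b k j)]
  · nlinarith [sq_nonneg (ext2 a k j - ext2 b k j)]
  · simp only [sq]
    rw [hprod ha ha j hj k hk, hprod hb hb j hj k hk]

end IsCanonicalBasis

/-! ## The condition number for a metric close to the canonical one -/

theorem sSup_div_sInf_abs_le {S : Set ℝ} {l u : ℝ} (hl : 0 < l) (hu : 0 ≤ u)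
    (hS : ∀ c ∈ S, l ≤ c ∧ c ≤ u) : sSup (abs '' S) / sInf (abs '' S) ≤ u / l := by
  -- The tangent space may be zero, for instance when `p = dx = dy = 1`; the supremum is then zero
  -- by convention, and so is the quotient.
  rcases S.eq_empty_or_nonempty with rfl | hne
  · simp only [Set.image_empty, Real.sSup_empty, zero_div]
    positivity
  · have habs : ∀ c ∈ abs '' S, l ≤ c ∧ c ≤ u := by
      rintro _ ⟨c, hc, rfl⟩
      rw [abs_of_nonneg (hl.le.trans (hS c hc).1)]
      exact hS c hc
    exact div_le_div₀ hu (Real.sSup_le (fun c hc => (habs c hc).2) hu) hl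
      (le_csInf (hne.image _) fun c hc => (habs c hc).1)

theorem Geometry.inner_smul_right {dx dy p : ℕ} (G : Geometry dx dy) (ξ η : Pt dx dy p) (c : ℝ) :
    G.inner ξ (c • η) = c * G.inner ξ η := by
  simp only [Geometry.inner, Prod.smul_fst, Prod.smul_snd, Matrix.mul_smul, trace_smul, smul_eq_mul]
  ring

theorem kappaNum_nonneg {p : ℕ} {m s : ℕ → ℝ} (hm : 0 ≤ m 0) (hs : ∀ k, 0 ≤ s k) :
    0 ≤ kappaNum p m s :=
  (mul_nonneg hm (add_nonneg (hs _) (hs _))).trans last_le_kappaNum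

/-- An eigenvalue `c` satisfies `c * G.inner ξ ξ = q`, where `q` lies between `lo * T` and `hi * T`
for the canonical squared norm `T`. Since `G.inner ξ ξ` is between `T / 2` and `3 * T / 2`, one gets
`2 / 3 * lo ≤ c ≤ 2 * hi`, and the quotient of these bounds is `3 * (hi / lo)`. -/
theorem hessCond_le {n dx dy p : ℕ} {P : CCAProblem n dx dy p} {s : ℕ → ℝ}
    {U : Matrix (Fin dx) (Fin dx) ℝ} {V : Matrix (Fin dy) (Fin dy) ℝ}
    (h : IsCanonicalBasis P s U V) (hp : 1 ≤ p) (hpx : p ≤ dx) (hpy : p ≤ dy)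
    (hs : ∀ i < p, s (i + 1) < s i) (hsp : ∀ k, p ≤ k → s k ≤ s p) (hs0 : ∀ k, 0 ≤ s k)
    (hm : StrictAnti P.mu) (hm0 : ∀ i, 0 < P.mu i) (hx : P.Sxx.PosDef) (hy : P.Syy.PosDef)
    {G : Geometry dx dy} (hB1 : G.B1 = P.Sxx) (hB2 : G.B2 = P.Syy) (h1 : G.M1.PosDef)
    (h2 : G.M2.PosDef)
    (hc1 : ∀ ξ : Matrix (Fin dx) (Fin p) ℝ, |(ξᵀ * G.M1 * ξ).trace - (ξᵀ * P.Sxx * ξ).trace| ≤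
      1 / 2 * (ξᵀ * P.Sxx * ξ).trace)
    (hc2 : ∀ ξ : Matrix (Fin dy) (Fin p) ℝ, |(ξᵀ * G.M2 * ξ).trace - (ξᵀ * P.Syy * ξ).trace| ≤
      1 / 2 * (ξᵀ * P.Syy * ξ).trace)
    {Z : Pt dx dy p} (hZ : Z ∈ G.manifold p) (hmin : IsMinOn P.cost (G.manifold p) Z) :
    0 ∉ G.hessEigenvalues P.cost Z ∧
      G.hessCond P.cost Z ≤ 3 * kappaStar p (ext0 P.mu) s := by
  set lo := kappaDen p (ext0 P.mu) s
  set hi := kappaNum p (ext0 P.mu) s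
  have hlo : 0 < lo := kappaDen_pos hp hs (fun i hi => ext0_succ_lt hm hm0 hi) (ext0_self _).ge
  have hhi : 0 ≤ hi := kappaNum_nonneg (ext0_nonneg (fun i => (hm0 i).le) 0) hs0
  have hS : ∀ c ∈ G.hessEigenvalues P.cost Z, 2 / 3 * lo ≤ c ∧ c ≤ 2 * hi := by
    rintro c ⟨ξ, hξ, hne, heq⟩
    obtain ⟨b1, b2⟩ :=
      h.hess_bounds hp hpx hpy hs hsp hs0 hm hm0 hx hy hB1 hB2 h1 h2 hZ hmin hξ
    rw [heq, Geometry.inner_smul_right] at b1 b2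
    have t1 := trace_quadForm_nonneg hx ξ.1
    have t2 := trace_quadForm_nonneg hy ξ.2
    have hT : 0 < (ξ.1ᵀ * P.Sxx * ξ.1).trace + (ξ.2ᵀ * P.Syy * ξ.2).trace := by
      refine lt_of_le_of_ne (add_nonneg t1 t2) fun h0 => hne ?_
      exact Prod.ext (eq_zero_of_trace_quadForm hx (by linarith))
        (eq_zero_of_trace_quadForm hy (by linarith))
    have hI : G.inner ξ ξ = (ξ.1ᵀ * G.M1 * ξ.1).trace + (ξ.2ᵀ * G.M2 * ξ.2).trace := rfl
    have c1 := abs_le.1 (hc1 ξ.1)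
    have c2 := abs_le.1 (hc2 ξ.2)
    set T := (ξ.1ᵀ * P.Sxx * ξ.1).trace + (ξ.2ᵀ * P.Syy * ξ.2).trace
    have i1 : 1 / 2 * T ≤ G.inner ξ ξ := by rw [hI]; simp only [T]; linarith
    have i2 : G.inner ξ ξ ≤ 3 / 2 * T := by rw [hI]; simp only [T]; linarith
    have hpos : 0 < c := by
      by_contra hc
      have := mul_nonneg (neg_nonneg.2 (not_lt.1 hc)) (by linarith : 0 ≤ G.inner ξ ξ)
      have := mul_pos hlo hT
      linarith
    have j1 := mul_le_mul_of_nonneg_left i1 hpos.le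
    have j2 := mul_le_mul_of_nonneg_left i2 hpos.le
    exact ⟨le_of_mul_le_mul_right (by linarith) hT, le_of_mul_le_mul_right (by linarith) hT⟩
  refine ⟨fun h0 => ?_, ?_⟩
  · have := (hS 0 h0).1
    linarith
  · refine (sSup_div_sInf_abs_le (by positivity) (by positivity) hS).trans_eq ?_
    change 2 * hi / (2 / 3 * lo) = 3 * (hi / lo)
    field_simp

/-! ## Second moment of CountSketch -/

section Signs

variable {n : ℕ}

/-- Flipping the sign at one index. -/
def flipAt (i : Fin n) : (Fin n → ℤˣ) ≃ (Fin n → ℤˣ) :=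
  Function.Involutive.toPerm (fun g => Function.update g i (-g i)) fun g => by simp

theorem sum_signs_eq_zero (i : Fin n) {F : (Fin n → ℤˣ) → ℝ}
    (hF : ∀ g, F (Function.update g i (-g i)) = -F g) : ∑ g, F g = 0 := by
  have h : ∑ g, F g = ∑ g, -F g := by
    rw [← Equiv.sum_comp (flipAt i) F]
    exact Finset.sum_congr rfl fun g _ => hF g
  rw [Finset.sum_neg_distrib] at h
  linarith

/-- The real value of a sign. -/
def sgn (g : Fin n → ℤˣ) (i : Fin n) : ℝ := ((g i : ℤ) : ℝ)

theorem sgn_mul_self (g : Fin n → ℤˣ) (i : Fin n) : sgn g i * sgn g i = 1 := by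
  rcases Int.units_eq_one_or (g i) with h | h <;> simp [sgn, h]

theorem sgn_flip_self (g : Fin n → ℤˣ) (i : Fin n) :
    sgn (Function.update g i (-g i)) i = -sgn g i := by simp [sgn]

theorem sgn_flip_of_ne (g : Fin n → ℤˣ) {i j : Fin n} (h : j ≠ i) :
    sgn (Function.update g i (-g i)) j = sgn g j := by simp [sgn, h]

/-- An index that occurs only once can be flipped, which kills the sum. What survives is `{k, l} =
{i, j}`, where the signs square away. -/
theorem sum_sgn_four {i j k l : Fin n} (hij : i ≠ j) (hkl : k ≠ l) :
    ∑ g : Fin n → ℤˣ, sgn g i * sgn g j * (sgn g k * sgn g l) =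
      (if k = i ∧ l = j then (2 : ℝ) ^ n else 0) + if k = j ∧ l = i then (2 : ℝ) ^ n else 0 := by
  have hcard : ∑ _g : Fin n → ℤˣ, (1 : ℝ) = 2 ^ n := by simp
  have one : ∀ (g : Fin n → ℤˣ) (i j : Fin n), sgn g i * sgn g j * (sgn g i * sgn g j) = 1 :=
    fun g i j => by
      rw [mul_mul_mul_comm, sgn_mul_self, sgn_mul_self, one_mul]
  by_cases h1 : k = i
  · subst h1
    by_cases h2 : l = j
    · subst h2
      simp [one, hkl]
    · rw [sum_signs_eq_zero j fun g => by
        rw [sgn_flip_self, sgn_flip_of_ne g hij, sgn_flip_of_ne g h2]; ring]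
      simp [h2, hij]
  · by_cases h2 : l = i
    · subst h2
      by_cases h3 : k = j
      · subst h3
        simp only [hij, hkl, if_false, and_self, if_true, zero_add]
        rw [← hcard]
        exact Finset.sum_congr rfl fun g _ => by rw [mul_comm (sgn g k), one]
      · rw [sum_signs_eq_zero j fun g => by
          rw [sgn_flip_self, sgn_flip_of_ne g hij, sgn_flip_of_ne g h3]; ring]
        simp [h1, h3]
    · rw [sum_signs_eq_zero i fun g => by
        rw [sgn_flip_self, sgn_flip_of_ne g hij.symm, sgn_flip_of_ne g h1, sgn_flip_of_ne g h2]; ring]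
      simp [h1, h2]

/-- Second moment of a Rademacher chaos of order two. -/
theorem sum_sq_chaos_le {c : Fin n → Fin n → ℝ} (hc : ∀ i, c i i = 0) :
    ∑ g : Fin n → ℤˣ, (∑ i, ∑ j, sgn g i * sgn g j * c i j) ^ 2 ≤
      2 * 2 ^ n * ∑ i, ∑ j, c i j ^ 2 := by
  have hterm : ∀ i j k l : Fin n,
      ∑ g : Fin n → ℤˣ, (sgn g i * sgn g j * c i j) * (sgn g k * sgn g l * c k l) =
        (if k = i then if l = j then 2 ^ n * (c i j * c i j) else 0 else 0) +
        if k = j then if l = i then 2 ^ n * (c i j * c j i) else 0 else 0 := fun i j k l => by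
    have e : ∀ g : Fin n → ℤˣ, (sgn g i * sgn g j * c i j) * (sgn g k * sgn g l * c k l) =
        c i j * c k l * (sgn g i * sgn g j * (sgn g k * sgn g l)) := fun g => by ring
    simp only [e, ← Finset.mul_sum]
    by_cases hij : i = j
    · subst hij; simp [hc]
    by_cases hkl : k = l
    · subst hkl
      have h1 : ¬ (k = i ∧ k = j) := fun h => hij (h.1.symm.trans h.2)
      have h2 : ¬ (k = j ∧ k = i) := fun h => hij (h.2.symm.trans h.1)
      simp only [hc, mul_zero, zero_mul, ← ite_and, h1, h2, if_false, add_zero]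
    rw [sum_sgn_four hij hkl, mul_add, ← ite_and, ← ite_and]
    congr 1
    · split_ifs with h
      · rw [h.1, h.2]; ring
      · ring
    · split_ifs with h
      · rw [h.1, h.2]; ring
      · ring
  have hexp : ∑ g : Fin n → ℤˣ, (∑ i, ∑ j, sgn g i * sgn g j * c i j) ^ 2 =
      ∑ i, ∑ j, 2 ^ n * (c i j * c i j + c i j * c j i) := by
    calc ∑ g : Fin n → ℤˣ, (∑ i, ∑ j, sgn g i * sgn g j * c i j) ^ 2
        = ∑ g : Fin n → ℤˣ, ∑ i, ∑ j, ∑ k, ∑ l,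
            (sgn g i * sgn g j * c i j) * (sgn g k * sgn g l * c k l) := by
          refine Finset.sum_congr rfl fun g _ => ?_
          simp only [sq, Finset.sum_mul, Finset.mul_sum]
          exact Finset.sum_congr rfl fun i _ => Finset.sum_congr rfl fun j _ =>
            Finset.sum_congr rfl fun k _ => Finset.sum_congr rfl fun l _ => mul_comm _ _
      _ = ∑ i, ∑ j, ∑ k, ∑ l, ∑ g : Fin n → ℤˣ,
            (sgn g i * sgn g j * c i j) * (sgn g k * sgn g l * c k l) := by
          rw [Finset.sum_comm]
          refine Finset.sum_congr rfl fun i _ => ?_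
          rw [Finset.sum_comm]
          refine Finset.sum_congr rfl fun j _ => ?_
          rw [Finset.sum_comm]
          refine Finset.sum_congr rfl fun k _ => ?_
          rw [Finset.sum_comm]
      _ = _ := by
          refine Finset.sum_congr rfl fun i _ => Finset.sum_congr rfl fun j _ => ?_
          simp only [hterm, Finset.sum_add_distrib]
          simp [mul_add]
  have hsymm : ∑ i, ∑ j, c i j * c j i ≤ ∑ i, ∑ j, c i j ^ 2 := by
    have h1 : ∑ i, ∑ j, c j i ^ 2 = ∑ i, ∑ j, c i j ^ 2 := Finset.sum_comm
    have h2 : ∑ i, ∑ j, 2 * (c i j * c j i) ≤ ∑ i, ∑ j, (c i j ^ 2 + c j i ^ 2) :=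
      Finset.sum_le_sum fun i _ => Finset.sum_le_sum fun j _ => by
        nlinarith [sq_nonneg (c i j - c j i)]
    simp only [Finset.sum_add_distrib, ← Finset.mul_sum, h1] at h2
    linarith
  rw [hexp]
  simp only [← Finset.mul_sum, Finset.sum_add_distrib, ← sq]
  have h2n : (0 : ℝ) < 2 ^ n := by positivity
  nlinarith

end Signs

/-! ### Collisions of the hash function and the mean squared error of the sketch. -/

section Hashing

variable {n s : ℕ}

/-- Splitting off the value at `i` from functions that are pairs of a collision at `i`, `j` and a
free value. -/
def collisionEquiv {i j : Fin n} (hij : i ≠ j) :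
    {h : Fin n → Fin s // h i = h j} × Fin s ≃ (Fin n → Fin s) where
  toFun q := Function.update q.1.1 i q.2
  invFun h := (⟨Function.update h i (h j), by simp [hij.symm]⟩, h i)
  left_inv q := by
    obtain ⟨⟨h, hh⟩, t⟩ := q
    simp [hij.symm, ← hh]
  right_inv h := by simp

/-- Two distinct indices collide with probability `1 / s`, stated without division. -/
theorem sum_collision {i j : Fin n} (hij : i ≠ j) :
    (s : ℝ) * ∑ h : Fin n → Fin s, (if h i = h j then (1 : ℝ) else 0) = (s : ℝ) ^ n := by
  have h := Fintype.card_congr (collisionEquiv (s := s) hij)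
  rw [Fintype.card_prod, Fintype.card_fin, Fintype.card_fun, Fintype.card_fin, Fintype.card_fin,
    Fintype.card_subtype] at h
  rw [Finset.sum_boole, mul_comm]
  exact_mod_cast h

/-- For fixed `h` this is the second moment of a chaos whose coefficients are restricted to
colliding pairs; averaging over `h` then gains a factor `1 / s` for each pair. -/
theorem sum_sq_collision_chaos_le (c : Fin n → Fin n → ℝ) :
    (s : ℝ) * ∑ h : Fin n → Fin s, ∑ g : Fin n → ℤˣ,
      (∑ i, ∑ j, sgn g i * sgn g j * if i ≠ j ∧ h i = h j then c i j else 0) ^ 2 ≤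
      2 * 2 ^ n * (s : ℝ) ^ n * ∑ i, ∑ j, c i j ^ 2 := by
  have h1 : ∑ h : Fin n → Fin s, ∑ g : Fin n → ℤˣ,
      (∑ i, ∑ j, sgn g i * sgn g j * if i ≠ j ∧ h i = h j then c i j else 0) ^ 2 ≤
      ∑ h : Fin n → Fin s, 2 * 2 ^ n *
        ∑ i, ∑ j, (if i ≠ j ∧ h i = h j then c i j else 0) ^ 2 :=
    Finset.sum_le_sum fun h _ =>
      sum_sq_chaos_le (c := fun i j => if i ≠ j ∧ h i = h j then c i j else 0) fun i => by simp
  have h2 : (s : ℝ) * ∑ h : Fin n → Fin s,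
      ∑ i, ∑ j, (if i ≠ j ∧ h i = h j then c i j else 0) ^ 2 ≤
      (s : ℝ) ^ n * ∑ i, ∑ j, c i j ^ 2 := by
    rw [Finset.sum_comm, Finset.mul_sum, Finset.mul_sum]
    refine Finset.sum_le_sum fun i _ => ?_
    rw [Finset.sum_comm, Finset.mul_sum, Finset.mul_sum]
    refine Finset.sum_le_sum fun j _ => ?_
    by_cases hij : i = j
    · simp only [hij, ne_eq, not_true_eq_false, false_and, if_false]
      simp only [zero_pow two_ne_zero, Finset.sum_const_zero, mul_zero]
      positivity
    · rw [← sum_collision hij, mul_assoc, Finset.sum_mul]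
      refine le_of_eq (congrArg _ (Finset.sum_congr rfl fun h _ => ?_))
      by_cases hh : h i = h j <;> simp [hij, hh]
  calc _ ≤ (s : ℝ) * ∑ h : Fin n → Fin s, 2 * 2 ^ n *
        ∑ i, ∑ j, (if i ≠ j ∧ h i = h j then c i j else 0) ^ 2 :=
        mul_le_mul_of_nonneg_left h1 (Nat.cast_nonneg s)
    _ = 2 * 2 ^ n * ((s : ℝ) * ∑ h : Fin n → Fin s,
        ∑ i, ∑ j, (if i ≠ j ∧ h i = h j then c i j else 0) ^ 2) := by
        rw [← Finset.mul_sum]; ring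
    _ ≤ 2 * 2 ^ n * ((s : ℝ) ^ n * ∑ i, ∑ j, c i j ^ 2) :=
        mul_le_mul_of_nonneg_left h2 (by positivity)
    _ = _ := by ring

/-- The terms `i = j` reproduce `Aᵀ * A` exactly, since signs square to one. The error consists of
collisions between distinct rows. -/
theorem countSketch_gram_apply {d : ℕ} (h : Fin n → Fin s) (g : Fin n → ℤˣ)
    (A : Matrix (Fin n) (Fin d) ℝ) (a b : Fin d) :
    ((countSketch h g * A)ᵀ * (countSketch h g * A) - Aᵀ * A) a b =
      ∑ i, ∑ j, sgn g i * sgn g j * if i ≠ j ∧ h i = h j then A i a * A j b else 0 := by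
  have h1 : ((countSketch h g * A)ᵀ * (countSketch h g * A)) a b =
      ∑ i, ∑ j, sgn g i * sgn g j * if h i = h j then A i a * A j b else 0 := by
    simp only [mul_apply, transpose_apply, countSketch, of_apply, ite_mul, zero_mul,
      Finset.sum_mul_sum]
    rw [Finset.sum_comm]
    refine Finset.sum_congr rfl fun i _ => ?_
    rw [Finset.sum_comm]
    refine Finset.sum_congr rfl fun j _ => ?_
    rw [Finset.sum_eq_single_of_mem (h i) (Finset.mem_univ _) fun r _ hr => by simp [hr.symm]]
    by_cases hh : h i = h j
    · simp only [hh, if_true, sgn]; ring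
    · simp [hh, Ne.symm hh]
  have h2 : (Aᵀ * A) a b =
      ∑ i, ∑ j, sgn g i * sgn g j * if i = j then A i a * A j b else 0 := by
    rw [mul_apply]
    refine Finset.sum_congr rfl fun i _ => ?_
    simp [sgn_mul_self]
  rw [Matrix.sub_apply, h1, h2]
  simp only [← Finset.sum_sub_distrib, ← mul_sub]
  refine Finset.sum_congr rfl fun i _ => Finset.sum_congr rfl fun j _ => ?_
  by_cases hij : i = j
  · simp [hij]
  · simp [hij]

/-- The squared Frobenius error of the sketched Gram matrix. -/
def sketchError {d : ℕ} (A : Matrix (Fin n) (Fin d) ℝ) (ω : (Fin n → Fin s) × (Fin n → ℤˣ)) : ℝ :=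
  ∑ a, ∑ b, ((countSketch ω.1 ω.2 * A)ᵀ * (countSketch ω.1 ω.2 * A) - Aᵀ * A) a b ^ 2

theorem sketchError_nonneg {d : ℕ} (A : Matrix (Fin n) (Fin d) ℝ)
    (ω : (Fin n → Fin s) × (Fin n → ℤˣ)) : 0 ≤ sketchError A ω :=
  Finset.sum_nonneg fun _ _ => Finset.sum_nonneg fun _ _ => sq_nonneg _

/-- The mean squared error is at most `2 / s` times the fourth power of the Frobenius norm of `A`:
summing `A i a ^ 2 * A j b ^ 2` over all indices factors into the square of the trace. -/
theorem sum_sketchError_le {d : ℕ} (A : Matrix (Fin n) (Fin d) ℝ) :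
    (s : ℝ) * ∑ ω : (Fin n → Fin s) × (Fin n → ℤˣ), sketchError A ω ≤
      2 * Fintype.card ((Fin n → Fin s) × (Fin n → ℤˣ)) * (Aᵀ * A).trace ^ 2 := by
  have hcard : (Fintype.card ((Fin n → Fin s) × (Fin n → ℤˣ)) : ℝ) = (s : ℝ) ^ n * 2 ^ n := by
    simp
  have htr : (Aᵀ * A).trace = ∑ a, ∑ i, A i a ^ 2 :=
    Finset.sum_congr rfl fun a _ => by
      rw [diag_apply, mul_apply]
      exact Finset.sum_congr rfl fun i _ => by rw [transpose_apply, sq]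
  have hsum : ∑ ω : (Fin n → Fin s) × (Fin n → ℤˣ), sketchError A ω =
      ∑ a, ∑ b, ∑ h : Fin n → Fin s, ∑ g : Fin n → ℤˣ,
      (∑ i, ∑ j, sgn g i * sgn g j * if i ≠ j ∧ h i = h j then A i a * A j b else 0) ^ 2 := by
    simp only [sketchError, countSketch_gram_apply]
    rw [Finset.sum_comm]
    refine Finset.sum_congr rfl fun a _ => ?_
    rw [Finset.sum_comm]
    refine Finset.sum_congr rfl fun b _ => ?_
    rw [Fintype.sum_prod_type]
  rw [hsum, Finset.mul_sum, htr, sq, Finset.sum_mul_sum, Finset.mul_sum]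
  refine Finset.sum_le_sum fun a _ => ?_
  rw [Finset.mul_sum, Finset.mul_sum]
  refine Finset.sum_le_sum fun b _ => ?_
  refine (sum_sq_collision_chaos_le fun i j => A i a * A j b).trans_eq ?_
  rw [hcard, Finset.sum_mul_sum]
  simp only [mul_pow]
  ring

end Hashing

/-! ## The probability of a good sketch -/

/-- Markov's inequality for the counting measure. -/
theorem card_mul_le_sum {Ω : Type} [Fintype Ω] {F : Ω → ℝ} (hF : ∀ ω, 0 ≤ F ω) (t : ℝ) :
    t * ({ω | t < F ω}.ncard : ℝ) ≤ ∑ ω, F ω := by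
  classical
  rw [Set.ncard_eq_toFinset_card', mul_comm, ← nsmul_eq_mul]
  refine (Finset.card_nsmul_le_sum _ F t fun ω hω => ?_).trans
    (Finset.sum_le_sum_of_subset_of_nonneg (Finset.subset_univ _) fun ω _ _ => hF ω)
  exact (by simpa using hω : t < F ω).le

theorem one_sub_le_uniformProb {Ω : Type} [Fintype Ω] [Nonempty Ω] {E B C : Set Ω} {b c : ℝ}
    (hsub : ∀ ω, ω ∉ B → ω ∉ C → ω ∈ E) (hB : (B.ncard : ℝ) ≤ b * Fintype.card Ω)
    (hC : (C.ncard : ℝ) ≤ c * Fintype.card Ω) : 1 - (b + c) ≤ uniformProb E := by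
  have hpos : (0 : ℝ) < Fintype.card Ω := by exact_mod_cast Fintype.card_pos
  have h1 : Eᶜ ⊆ B ∪ C := fun ω hω => by
    by_contra h
    rw [Set.mem_union, not_or] at h
    exact hω (hsub ω h.1 h.2)
  have h2 : Eᶜ.ncard ≤ B.ncard + C.ncard :=
    (Set.ncard_le_ncard h1 (Set.toFinite _)).trans (Set.ncard_union_le _ _)
  have h3 : E.ncard + Eᶜ.ncard = Fintype.card Ω := by
    rw [Set.ncard_add_ncard_compl, Nat.card_eq_fintype_card]
  have h2' : (Eᶜ.ncard : ℝ) ≤ B.ncard + C.ncard := by exact_mod_cast h2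
  have h3' : (E.ncard : ℝ) + Eᶜ.ncard = Fintype.card Ω := by exact_mod_cast h3
  rw [uniformProb, le_div_iff₀ hpos]
  linarith

/-! ## Sketched Gram matrices and the condition number -/

theorem trace_quadForm_eq_sum {d p : ℕ} (M : Matrix (Fin d) (Fin d) ℝ) (ξ : Matrix (Fin d) (Fin p) ℝ) :
    (ξᵀ * M * ξ).trace = ∑ j, ξ.col j ⬝ᵥ (M *ᵥ ξ.col j) := by
  refine Finset.sum_congr rfl fun j _ => ?_
  rw [diag_apply, Matrix.mul_assoc]
  rfl

/-- Cauchy–Schwarz over pairs of indices: the Frobenius norm dominates the quadratic form. -/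
theorem sq_dotProduct_mulVec_le {d : ℕ} (E : Matrix (Fin d) (Fin d) ℝ) (u : Fin d → ℝ) :
    (u ⬝ᵥ (E *ᵥ u)) ^ 2 ≤ (∑ a, ∑ b, E a b ^ 2) * (u ⬝ᵥ u) ^ 2 := by
  have h1 : u ⬝ᵥ (E *ᵥ u) = ∑ q : Fin d × Fin d, E q.1 q.2 * (u q.1 * u q.2) := by
    rw [Fintype.sum_prod_type]
    simp only [dotProduct, mulVec, Finset.mul_sum]
    exact Finset.sum_congr rfl fun a _ => Finset.sum_congr rfl fun b _ => by ring
  have h2 : ∑ q : Fin d × Fin d, E q.1 q.2 ^ 2 = ∑ a, ∑ b, E a b ^ 2 := Fintype.sum_prod_type _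
  have h3 : ∑ q : Fin d × Fin d, (u q.1 * u q.2) ^ 2 = (u ⬝ᵥ u) ^ 2 := by
    rw [Fintype.sum_prod_type, sq (u ⬝ᵥ u), dotProduct, Finset.sum_mul_sum]
    exact Finset.sum_congr rfl fun a _ => Finset.sum_congr rfl fun b _ => by ring
  rw [h1, ← h2, ← h3]
  exact Finset.sum_mul_sq_le_sq_mul_sq _ _ _

section Sketch

variable {n s d : ℕ}

/-- The data matrix with columns orthonormalized for the regularized Gram matrix. -/
theorem exists_whitening {X : Matrix (Fin n) (Fin d) ℝ} {lam : ℝ} (hX : (regGram X lam).PosDef) :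
    ∃ (R : Matrix (Fin d) (Fin d) ℝ) (A : Matrix (Fin n) (Fin d) ℝ), Rᵀ * R = regGram X lam ∧
      X = A * R ∧ (Aᵀ * A).trace = statDim X lam := by
  obtain ⟨R, hR, hRR⟩ := exists_cholesky hX
  refine ⟨R, X * R⁻¹, hRR, ?_, ?_⟩
  · rw [Matrix.mul_assoc, nonsing_inv_mul _ hR.isUnit, Matrix.mul_one]
  · rw [statDim, ← hRR, Matrix.mul_inv_rev, transpose_mul, transpose_nonsing_inv,
      ← Matrix.mul_assoc, Matrix.trace_mul_comm]
    simp only [Matrix.mul_assoc]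

/-- The regularization cancels in the difference, which is `Rᵀ * E * R` with `E` the error for the
whitened data. In the variable `w = R *ᵥ u` the reference form is `w ⬝ᵥ w`, so the error is relative
and blind to the conditioning; `1 / 4` is the square of the relative error `1 / 2`. -/
theorem abs_quadForm_sub_le {X A : Matrix (Fin n) (Fin d) ℝ} {lam : ℝ} {R : Matrix (Fin d) (Fin d) ℝ}
    (hR : Rᵀ * R = regGram X lam) (hA : X = A * R) {ω : (Fin n → Fin s) × (Fin n → ℤˣ)}
    (hω : sketchError A ω ≤ 1 / 4) (u : Fin d → ℝ) :
    |u ⬝ᵥ (regGram (countSketch ω.1 ω.2 * X) lam *ᵥ u) - u ⬝ᵥ (regGram X lam *ᵥ u)| ≤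
      1 / 2 * (u ⬝ᵥ (regGram X lam *ᵥ u)) := by
  set S := countSketch ω.1 ω.2
  set E := (S * A)ᵀ * (S * A) - Aᵀ * A
  set w := R *ᵥ u
  have e1 : u ⬝ᵥ (regGram X lam *ᵥ u) = w ⬝ᵥ w := by
    rw [← hR, ← mulVec_mulVec, dotProduct_mulVec, vecMul_transpose]
  have e2 : regGram (S * X) lam - regGram X lam = Rᵀ * E * R := by
    simp only [regGram, E, hA]
    rw [add_sub_add_right_eq_sub, Matrix.mul_sub, Matrix.sub_mul]
    simp only [transpose_mul, Matrix.mul_assoc]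
  have e3 : u ⬝ᵥ (regGram (S * X) lam *ᵥ u) - u ⬝ᵥ (regGram X lam *ᵥ u) = w ⬝ᵥ (E *ᵥ w) := by
    rw [← dotProduct_sub, ← sub_mulVec, e2, Matrix.mul_assoc, ← mulVec_mulVec, dotProduct_mulVec,
      vecMul_transpose, ← mulVec_mulVec]
  have hw : 0 ≤ w ⬝ᵥ w := Finset.sum_nonneg fun _ _ => mul_self_nonneg _
  rw [e3, e1]
  refine abs_le_of_sq_le_sq ?_ (by positivity)
  calc (w ⬝ᵥ (E *ᵥ w)) ^ 2 ≤ sketchError A ω * (w ⬝ᵥ w) ^ 2 := sq_dotProduct_mulVec_le E w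
    _ ≤ 1 / 4 * (w ⬝ᵥ w) ^ 2 := mul_le_mul_of_nonneg_right hω (sq_nonneg _)
    _ = (1 / 2 * (w ⬝ᵥ w)) ^ 2 := by ring

theorem regGram_isHermitian (X : Matrix (Fin n) (Fin d) ℝ) (lam : ℝ) :
    (regGram X lam).IsHermitian := by
  rw [IsHermitian, conjTranspose_eq_transpose_of_trivial]
  simp [regGram, transpose_mul]

theorem posDef_of_quadForm_close {X : Matrix (Fin n) (Fin d) ℝ} {Y : Matrix (Fin s) (Fin d) ℝ} {lam : ℝ}
    (hX : (regGram X lam).PosDef)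
    (h : ∀ u : Fin d → ℝ, |u ⬝ᵥ (regGram Y lam *ᵥ u) - u ⬝ᵥ (regGram X lam *ᵥ u)| ≤
      1 / 2 * (u ⬝ᵥ (regGram X lam *ᵥ u))) : (regGram Y lam).PosDef := by
  refine PosDef.of_dotProduct_mulVec_pos (regGram_isHermitian Y lam) fun u hu => ?_
  have h1 := hX.dotProduct_mulVec_pos hu
  have h2 := (abs_le.1 (h u)).1
  simp only [star_trivial] at h1 ⊢
  linarith

theorem abs_trace_sub_le {p : ℕ} {M B : Matrix (Fin d) (Fin d) ℝ}
    (h : ∀ u : Fin d → ℝ, |u ⬝ᵥ (M *ᵥ u) - u ⬝ᵥ (B *ᵥ u)| ≤ 1 / 2 * (u ⬝ᵥ (B *ᵥ u)))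
    (ξ : Matrix (Fin d) (Fin p) ℝ) :
    |(ξᵀ * M * ξ).trace - (ξᵀ * B * ξ).trace| ≤ 1 / 2 * (ξᵀ * B * ξ).trace := by
  rw [trace_quadForm_eq_sum, trace_quadForm_eq_sum, ← Finset.sum_sub_distrib, Finset.mul_sum]
  exact (Finset.abs_sum_le_sum_abs _ _).trans (Finset.sum_le_sum fun j _ => h _)

/-- Markov's inequality at level `1 / 4` bounds the failure probability by `4 * (2 * t ^ 2 / s)`,
which is at most `8 * δ / 40 = δ / 5`. -/
theorem ncard_sketchError_le {A : Matrix (Fin n) (Fin d) ℝ} {t δ : ℝ} (hs : 0 < s)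
    (hA0 : 0 ≤ (Aᵀ * A).trace) (hA : (Aᵀ * A).trace ≤ t) (ht : 40 * t ^ 2 ≤ δ * s) :
    ({ω : (Fin n → Fin s) × (Fin n → ℤˣ) | 1 / 4 < sketchError A ω}.ncard : ℝ) ≤
      δ / 5 * Fintype.card ((Fin n → Fin s) × (Fin n → ℤˣ)) := by
  have h1 := card_mul_le_sum (sketchError_nonneg (s := s) A) (1 / 4)
  have h2 := sum_sketchError_le (s := s) A
  have h3 : (Aᵀ * A).trace ^ 2 ≤ t ^ 2 := pow_le_pow_left₀ hA0 hA 2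
  set K : ℝ := (Fintype.card ((Fin n → Fin s) × (Fin n → ℤˣ)) : ℝ)
  have hK : 0 ≤ K := Nat.cast_nonneg _
  have hs' : (0 : ℝ) < s := Nat.cast_pos.2 hs
  refine le_of_mul_le_mul_left ?_ hs'
  have h4 := mul_le_mul_of_nonneg_left h1 hs'.le
  have h5 : 2 * K * (Aᵀ * A).trace ^ 2 ≤ 2 * K * (δ * s / 40) :=
    mul_le_mul_of_nonneg_left (by linarith) (by linarith)
  linarith

end Sketch

/-- The condition number bound holds with probability at least `1 - δ` over the sketch. -/
theorem hessCond_sketched {n dx dy p s : ℕ} {P : CCAProblem n dx dy p} {σ : Fin (min dx dy) → ℝ}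
    {δ : ℝ} (hδ : 0 < δ) (hp : 1 ≤ p) (hpd : p ≤ min dx dy) (hx : P.Sxx.PosDef) (hy : P.Syy.PosDef)
    (hm : StrictAnti P.mu) (hm0 : ∀ i, 0 < P.mu i) (hσ : IsCanonicalCorrelations P σ)
    (hgap : ∀ i < p, ext0 σ (i + 1) < ext0 σ i)
    (hs : s = max ⌈40 * (max (statDim P.X P.lamX) (statDim P.Y P.lamY)) ^ 2 / δ⌉₊ (dx + dy)) :
    1 - δ ≤ uniformProb {ω : (Fin n → Fin s) × (Fin n → ℤˣ) |
      (sketchedGeometry P ω.1 ω.2).M1.PosDef ∧ (sketchedGeometry P ω.1 ω.2).M2.PosDef ∧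
      ∀ Z ∈ (sketchedGeometry P ω.1 ω.2).manifold p,
        IsMinOn P.cost ((sketchedGeometry P ω.1 ω.2).manifold p) Z →
        0 ∉ (sketchedGeometry P ω.1 ω.2).hessEigenvalues P.cost Z ∧
        (sketchedGeometry P ω.1 ω.2).hessCond P.cost Z ≤
          3 * kappaStar p (ext0 P.mu) (ext0 σ)} := by
  have hpx : p ≤ dx := hpd.trans (min_le_left _ _)
  have hpy : p ≤ dy := hpd.trans (min_le_right _ _)
  obtain ⟨hσ0, U, V, hU, hV, hUV⟩ := exists_canonical_basis hx hy hσ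
  obtain ⟨_, _, ⟨_, _, _, hanti⟩, _⟩ := hσ
  have hbasis : IsCanonicalBasis P (ext0 σ) U V :=
    ⟨hU, hV, by ext k l; rw [hUV]; rfl⟩
  obtain ⟨R, A, hR, hA, hAt⟩ := exists_whitening hx
  obtain ⟨T, B, hT, hB, hBt⟩ := exists_whitening hy
  have hs0 : 0 < s := by
    have := le_max_right ⌈40 * (max (statDim P.X P.lamX) (statDim P.Y P.lamY)) ^ 2 / δ⌉₊ (dx + dy)
    omega
  have : Nonempty (Fin s) := ⟨⟨0, hs0⟩⟩
  have hst : 40 * (max (statDim P.X P.lamX) (statDim P.Y P.lamY)) ^ 2 ≤ δ * s := by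
    rw [mul_comm δ, ← div_le_iff₀ hδ]
    exact (Nat.le_ceil _).trans (Nat.cast_le.2 (hs ▸ le_max_left _ _))
  have hbadX := ncard_sketchError_le (n := n) hs0 (trace_transpose_mul_self_nonneg A)
    (hAt.trans_le (le_max_left _ _)) hst
  have hbadY := ncard_sketchError_le (n := n) hs0 (trace_transpose_mul_self_nonneg B)
    (hBt.trans_le (le_max_right _ _)) hst
  -- The two bad events have total probability at most `2 * δ / 5`, below `δ`; outside them both
  -- metrics are within relative error `1 / 2`.
  refine le_trans (by linarith) (one_sub_le_uniformProb (fun ω h1 h2 => ?_) hbadX hbadY)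
  have q1 := abs_quadForm_sub_le hR hA (not_lt.1 h1)
  have q2 := abs_quadForm_sub_le hT hB (not_lt.1 h2)
  have p1 : (sketchedGeometry P ω.1 ω.2).M1.PosDef := posDef_of_quadForm_close hx q1
  have p2 : (sketchedGeometry P ω.1 ω.2).M2.PosDef := posDef_of_quadForm_close hy q2
  exact ⟨p1, p2, fun Z hZ hmin => hessCond_le hbasis hp hpx hpy hgap
    (fun k hk => ext0_anti hanti hσ0 hk) (ext0_nonneg hσ0) hm hm0 hx hy rfl rfl p1 p2
    (abs_trace_sub_le q1) (abs_trace_sub_le q2) hZ hmin⟩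

theorem card_add_card_le {n dx dy : ℕ} (PX : Finset (Fin n × Fin dx)) (PY : Finset (Fin n × Fin dy)) :
    PX.card + PY.card ≤ n * (dx + dy) := by
  have h1 := Finset.card_le_univ PX
  have h2 := Finset.card_le_univ PY
  rw [Fintype.card_prod, Fintype.card_fin, Fintype.card_fin] at h1 h2
  rw [mul_add]
  exact Nat.add_le_add h1 h2

end

end SketchCCA

/-! ### Assembly of the conditioning bound and the three cost bounds. -/

theorem mainTheorem3 :
    -- Condition number of the Riemannian Hessian at the optimum
    (∀ (n dx dy p s : ℕ) (P : SketchCCA.CCAProblem n dx dy p) (σ : Fin (min dx dy) → ℝ) (δ : ℝ),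
      0 < δ → δ < 1 → 1 ≤ p → p ≤ min dx dy →
      0 ≤ P.lamX → 0 ≤ P.lamY → P.Sxx.PosDef → P.Syy.PosDef →
      StrictAnti P.mu → (∀ i, 0 < P.mu i) →
      SketchCCA.IsCanonicalCorrelations P σ →
      (∀ i < p, SketchCCA.ext0 σ (i + 1) < SketchCCA.ext0 σ i) → 0 ≤ SketchCCA.ext0 σ p →
      s = max ⌈40 * (max (SketchCCA.statDim P.X P.lamX) (SketchCCA.statDim P.Y P.lamY)) ^ 2 / δ⌉₊
        (dx + dy) →
      1 - δ ≤ SketchCCA.uniformProb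
        {ω : (Fin n → Fin s) × (Fin n → ℤˣ) |
          (SketchCCA.sketchedGeometry P ω.1 ω.2).M1.PosDef ∧
          (SketchCCA.sketchedGeometry P ω.1 ω.2).M2.PosDef ∧
          ∀ Z ∈ (SketchCCA.sketchedGeometry P ω.1 ω.2).manifold p,
            IsMinOn P.cost ((SketchCCA.sketchedGeometry P ω.1 ω.2).manifold p) Z →
            0 ∉ (SketchCCA.sketchedGeometry P ω.1 ω.2).hessEigenvalues P.cost Z ∧
            (SketchCCA.sketchedGeometry P ω.1 ω.2).hessCond P.cost Z ≤
              3 * SketchCCA.kappaStar p (SketchCCA.ext0 P.mu) (SketchCCA.ext0 σ)}) ∧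
    -- Preprocessing, sketching: `O(nnz X + nnz Y)`, which is `O(n d)`
    (∃ C : ℕ, ∀ (n dx dy s : ℕ) (PX : Finset (Fin n × Fin dx)) (PY : Finset (Fin n × Fin dy))
      (h : Fin n → Fin s) (g : Fin n → ℤˣ), dx + dy ≤ n → dx + dy ≤ s →
      SketchCCA.ComputableWithin (SketchCCA.SketchInput.read (PX := PX) (PY := PY))
        (SketchCCA.SketchInput.result h g) (C * (PX.card + PY.card)) ∧
      PX.card + PY.card ≤ n * (dx + dy)) ∧
    -- Preprocessing, factorization of the metric matrices: `O(s d² + d²)`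
    (∃ C : ℕ, ∀ s dx dy : ℕ, dx + dy ≤ s →
      SketchCCA.ComputableWithin (SketchCCA.FactorInput.read (s := s) (dx := dx) (dy := dy))
        SketchCCA.FactorInput.result (C * (s * (dx + dy) ^ 2 + (dx + dy) ^ 2))) ∧
    -- Each iteration of Riemannian CG with at most `L` line-search steps:
    -- `O(p (nnz X + nnz Y) + d p² + d² p)`
    (∀ L : ℕ, ∃ C : ℕ, ∀ (n dx dy p s : ℕ) (PX : Finset (Fin n × Fin dx))
      (PY : Finset (Fin n × Fin dy)) (h : Fin n → Fin s) (g : Fin n → ℤˣ)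
      (k : SketchCCA.RetractionKind) (rule : SketchCCA.BetaRule),
      dx + dy ≤ n → p ≤ dx + dy → dx + dy ≤ s →
      SketchCCA.ComputableWithin
        (SketchCCA.IterInput.read (p := p) (PX := PX) (PY := PY) (h := h) (g := g))
        (SketchCCA.IterInput.result k rule L)
        (C * (p * (PX.card + PY.card) + (dx + dy) * p ^ 2 + (dx + dy) ^ 2 * p))) := by
  refine ⟨?_, ⟨3, ?_⟩, ⟨26, ?_⟩, fun L =>
    ⟨2 * SketchCCA.nextCost L + 2 * (300 * SketchCCA.nextCost L + 6000), ?_⟩⟩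
  · intro n dx dy p s P σ δ hδ _ hp hpd _ _ hx hy hm hm0 hσ hgap _ hs
    exact SketchCCA.hessCond_sketched hδ hp hpd hx hy hm hm0 hσ hgap hs
  · intro n dx dy s PX PY h g _ _
    exact ⟨SketchCCA.sketch_computable, SketchCCA.card_add_card_le PX PY⟩
  · intro s dx dy hs
    exact SketchCCA.factorization_computable hs
  · intro n dx dy p s PX PY h g k rule _ hp _
    exact SketchCCA.iteration_computable k rule L hp
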